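/- Let $A$ be an associative ring with unit, let $(\mathfrak C,\Delta,\epsilon)$ be an $A$-coring (an $A$-bimodule with coassociative comultiplication $\Delta:\mathfrak C\to\mathfrak C\otimes_A\mathfrak C$ and counit $\epsilon:\mathfrak C\to A$, both $A$-bimodule maps), and let $G\subseteq\mathfrak C$ be a set of grouplike elements, i.e. $\Delta(g)=g\otimes_A g$ and $\epsilon(g)=1$ for all $g\in G$. We use the following notation. - For $g,h\in G$ put $A_{g,h}=\{b\in A: hb=bg\}$. Let $S$ be the ring (without unit in general) of all $G\times G$-matrices over $A$ with finitely many nonzero entries, and let $R=\bigoplus_{g,h\in G}A_{g,h}\subseteq S$ be the subring of those matrices whose entry in row $h$ and column $g$ lies in $A_{g,h}$, for all $g,h$. $\mathrm{Mod}\text{-}R$ is the category of unital right $R$-modules, i.e. those $M$ with $M=MR$. A left $R$-module $N$ is faithfully flat if $-\otimes_R N$, from $\mathrm{Mod}\text{-}R$ to abelian groups, is exact and faithful. - $\mathrm{Comod}\text{-}\mathfrak C$ is the category of right $\mathfrak C$-comodules. For $g\in G$, $[g]A$ is the right $\mathfrak C$-comodule $A$ with coaction $a\mapsto 1\otimes_A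 ga$. Let $\Sigma=\bigoplus_{g\in G}[g]A$, the free right $A$-module with basis $\{[g]: g\in G\}$ and coaction $[g]a\mapsto [g]1\otimes_A ga$. The ring $R$ acts on the left of $\Sigma$ by matrices acting on columns, and for a unital right $R$-module $X$ the comodule structure of $\Sigma$ induces one on $X\otimes_R\Sigma$. - $\mathfrak R(G)$ is the $A$-coring $$\mathfrak R(G)=\Big(\bigoplus_{g\in G}A\otimes_{A_{g,g}}A\Big)\Big/\big\langle a\otimes_{A_{h,h}}ta'-at\otimes_{A_{g,g}}a' : g,h\in G,\ a,a'\in A,\ t\in A_{g,h}\big\rangle,$$ with comultiplication $a\otimes_{A_{g,g}}a'\mapsto (a\otimes_{A_{g,g}}1)\otimes_A(1\otimes_{A_{g,g}}a')$ and counit $a\otimes_{A_{g,g}}a'\mapsto aa'$. The map $\mathsf{can}:\mathfrak R(G)\to\mathfrak C$, $a\otimes_{A_{g,g}}a'\mapsto aga'$, is a homomorphism of $A$-corings. $\Sigma$ is also a right $\mathfrak R(G)$-comodule, with coaction $[g]a\mapsto[g]1\otimes_A(1\otimes_{A_{g,g}}a)$. **Theorem.** The following statements are equivalent. 1. $\mathfrak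 C$ is flat as a left $A$-module, $\mathsf{can}:\mathfrak R(G)\to\mathfrak C$ is an isomorphism of $A$-corings, and $S$ is faithfully flat as a left $R$-module. 2. $\mathfrak C$ is flat as a left $A$-module, $\mathsf{can}:\mathfrak R(G)\to\mathfrak C$ is an isomorphism of $A$-corings, and the functor $-\otimes_R\Sigma:\mathrm{Mod}\text{-}R\to\mathrm{Comod}\text{-}\mathfrak R(G)$ is an equivalence of categories. 3. $\mathfrak C$ is flat as a left $A$-module and $\Sigma=\bigoplus_{g\in G}[g]A$ is a projective generator of $\mathrm{Comod}\text{-}\mathfrak C$. 4. $\mathfrak C$ is flat as a left $A$-module and the functor $-\otimes_R\Sigma:\mathrm{Mod}\text{-}R\to\mathrm{Comod}\text{-}\mathfrak C$ is an equivalence of categories. -/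

import Mathlib

universe u

noncomputable section

namespace GaloisCoring

open TensorProduct MulOpposite CategoryTheory

/-! ### Equivariance of some additive maps -/

theorem id_smul {S N : Type*} [AddCommGroup N] [SMul S N] (r : S) (n : N) :
    AddMonoidHom.id N (r • n) = r • AddMonoidHom.id N n := rfl

theorem linear_smul {S M N : Type*} [Ring S] [AddCommGroup M] [AddCommGroup N] [Module S M]
    [Module S N] (f : M →ₗ[S] N) (r : S) (m : M) :
    f.toAddMonoidHom (r • m) = r • f.toAddMonoidHom m := f.map_smul r m

theorem act_smul {B S M : Type*} [AddCommGroup M] [Ring B] [Module B M] [SMul S M]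
    [SMulCommClass B S M] (b : B) (r : S) (m : M) :
    DistribSMul.toAddMonoidHom M b (r • m) = r • DistribSMul.toAddMonoidHom M b m :=
  smul_comm b r m

theorem act_smul' {B S M : Type*} [AddCommGroup M] [Ring B] [Module B M] [SMul S M]
    [SMulCommClass S B M] (b : B) (r : S) (m : M) :
    DistribSMul.toAddMonoidHom M b (r • m) = r • DistribSMul.toAddMonoidHom M b m :=
  (smul_comm r b m).symm

/-! ### Tensor products over a (noncommutative, possibly non-unital) ring -/

section BalTensor

variable (R M N : Type*) [AddCommGroup M] [AddCommGroup N] [SMul Rᵐᵒᵖ M] [SMul R N]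

/-- The subgroup of `M ⊗[ℤ] N` generated by the elements `m r ⊗ n - m ⊗ r n`. -/
def BalTensor.rel : AddSubgroup (M ⊗[ℤ] N) :=
  AddSubgroup.closure {z | ∃ (m : M) (r : R) (n : N), z = (op r • m) ⊗ₜ[ℤ] n - m ⊗ₜ[ℤ] (r • n)}

/-- The tensor product `M ⊗_R N` of a right `R`-module `M` and a left `R`-module `N`,
as an abelian group. The right action of `R` on `M` is written as an action of `Rᵐᵒᵖ`. -/
def BalTensor : Type _ := (M ⊗[ℤ] N) ⧸ BalTensor.rel R M N

instance : AddCommGroup (BalTensor R M N) :=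
  inferInstanceAs (AddCommGroup ((M ⊗[ℤ] N) ⧸ BalTensor.rel R M N))

end BalTensor

namespace BalTensor

section Basic

variable {R M N : Type*} [AddCommGroup M] [AddCommGroup N] [SMul Rᵐᵒᵖ M] [SMul R N]

variable (R) in
/-- The biadditive map `(m, n) ↦ m ⊗_R n`. -/
def mk : M →+ N →+ BalTensor R M N :=
  AddMonoidHom.mk' (fun m => AddMonoidHom.mk'
    (fun n => ((m ⊗ₜ[ℤ] n : M ⊗[ℤ] N) : (M ⊗[ℤ] N) ⧸ rel R M N))
    (fun a b => by rw [TensorProduct.tmul_add]; rfl))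
    (fun a b => by
      ext n
      change ((((a + b) ⊗ₜ[ℤ] n : M ⊗[ℤ] N)) : (M ⊗[ℤ] N) ⧸ rel R M N) = _
      rw [TensorProduct.add_tmul]; rfl)

variable (R) in
/-- The pure tensor `m ⊗_R n`. -/
def tmul (m : M) (n : N) : BalTensor R M N := mk R m n

@[simp] theorem mk_apply (m : M) (n : N) : mk R m n = tmul R m n := rfl

theorem tmul_add (m : M) (n n' : N) : tmul R m (n + n') = tmul R m n + tmul R m n' :=
  map_add (mk R m) n n'

theorem add_tmul (m m' : M) (n : N) : tmul R (m + m') n = tmul R m n + tmul R m' n :=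
  DFunLike.congr_fun (map_add (mk R) m m') n

@[simp] theorem tmul_zero (m : M) : tmul R m (0 : N) = 0 := map_zero (mk R m)

@[simp] theorem zero_tmul (n : N) : tmul R (0 : M) n = 0 :=
  DFunLike.congr_fun (map_zero (mk R)) n

theorem balanced (m : M) (r : R) (n : N) : tmul R (op r • m) n = tmul R m (r • n) := by
  refine (QuotientAddGroup.eq_iff_sub_mem).2 (AddSubgroup.subset_closure ⟨m, r, n, rfl⟩)

theorem ind {p : BalTensor R M N → Prop} (x : BalTensor R M N) (zero : p 0)
    (tmul : ∀ m n, p (tmul R m n)) (add : ∀ x y, p x → p y → p (x + y)) : p x := by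
  obtain ⟨z, rfl⟩ := QuotientAddGroup.mk_surjective x
  induction z using TensorProduct.induction_on with
  | zero => exact zero
  | tmul m n => exact tmul m n
  | add a b ha hb => exact add _ _ ha hb

/-- The universal property of `M ⊗_R N`. -/
def lift {P : Type*} [AddCommGroup P] (f : M →+ N →+ P)
    (hf : ∀ (m : M) (r : R) (n : N), f (op r • m) n = f m (r • n)) : BalTensor R M N →+ P :=
  QuotientAddGroup.lift (rel R M N)
    (TensorProduct.liftAddHom f fun k m n => by simp)
    (by
      rw [rel, AddSubgroup.closure_le]
      rintro _ ⟨m, r, n, rfl⟩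
      simp [AddMonoidHom.mem_ker, hf])

@[simp] theorem lift_tmul {P : Type*} [AddCommGroup P] (f : M →+ N →+ P)
    (hf : ∀ (m : M) (r : R) (n : N), f (op r • m) n = f m (r • n)) (m : M) (n : N) :
    lift f hf (tmul R m n) = f m n := rfl

theorem hom_ext {P : Type*} [AddCommGroup P] {f g : BalTensor R M N →+ P}
    (h : ∀ m n, f (tmul R m n) = g (tmul R m n)) : f = g := by
  ext x
  induction x using ind with
  | zero => simp
  | tmul m n => exact h m n
  | add x y hx hy => simp [hx, hy]

variable {M' N' : Type*} [AddCommGroup M'] [AddCommGroup N'] [SMul Rᵐᵒᵖ M'] [SMul R N']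

/-- The map `f ⊗_R g` for additive maps `f`, `g` commuting with the actions of `R`. -/
def map (f : M →+ M') (g : N →+ N') (hf : ∀ (r : R) (m : M), f (op r • m) = op r • f m)
    (hg : ∀ (r : R) (n : N), g (r • n) = r • g n) : BalTensor R M N →+ BalTensor R M' N' :=
  lift (((mk R).comp f).compr₂ (AddMonoidHom.id _) |>.compl₂ g) (fun m r n => by
    simp [hf, hg, balanced])

@[simp] theorem map_tmul (f : M →+ M') (g : N →+ N')
    (hf : ∀ (r : R) (m : M), f (op r • m) = op r • f m)
    (hg : ∀ (r : R) (n : N), g (r • n) = r • g n) (m : M) (n : N) :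
    map f g hf hg (tmul R m n) = tmul R (f m) (g n) := rfl

end Basic

section Actions

variable {R M N : Type*} [AddCommGroup M] [AddCommGroup N] [SMul Rᵐᵒᵖ M] [SMul R N]

/-- Left multiplication by `b` on the left factor. -/
def leftAct {B : Type*} [Ring B] [Module B M] [SMulCommClass B Rᵐᵒᵖ M] (b : B) :
    BalTensor R M N →+ BalTensor R M N :=
  map (DistribSMul.toAddMonoidHom M b) (AddMonoidHom.id N)
    (fun r => act_smul b (op r)) id_smul

/-- Right multiplication by `b` on the right factor. -/
def rightAct {B : Type*} [Ring B] [Module Bᵐᵒᵖ N] [SMulCommClass R Bᵐᵒᵖ N] (b : Bᵐᵒᵖ) :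
    BalTensor R M N →+ BalTensor R M N :=
  map (AddMonoidHom.id M) (DistribSMul.toAddMonoidHom N b)
    (fun r => id_smul (op r)) (act_smul' b)

/-- If `M` is a `B`-`R`-bimodule, `M ⊗_R N` is a left `B`-module by `b (m ⊗ n) = b m ⊗ n`. -/
instance leftModule {B : Type*} [Ring B] [Module B M] [SMulCommClass B Rᵐᵒᵖ M] :
    Module B (BalTensor R M N) where
  smul b x := leftAct b x
  one_smul x := DFunLike.congr_fun (f := leftAct 1) (g := AddMonoidHom.id _)
    (hom_ext fun m n => by simp [leftAct]) x
  mul_smul b c x := DFunLike.congr_fun (f := leftAct (b * c)) (g := (leftAct b).comp (leftAct c))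
    (hom_ext fun m n => by simp [leftAct, mul_smul]) x
  smul_zero b := map_zero (leftAct b)
  smul_add b := map_add (leftAct b)
  add_smul b c x := DFunLike.congr_fun (f := leftAct (b + c)) (g := leftAct b + leftAct c)
    (hom_ext fun m n => by simp [leftAct, add_smul, add_tmul]) x
  zero_smul x := DFunLike.congr_fun (f := leftAct (0 : B)) (g := 0)
    (hom_ext fun m n => by simp [leftAct]) x

/-- If `N` is an `R`-`B`-bimodule, `M ⊗_R N` is a right `B`-module by `(m ⊗ n) b = m ⊗ n b`. -/
instance rightModule {B : Type*} [Ring B] [Module Bᵐᵒᵖ N] [SMulCommClass R Bᵐᵒᵖ N] :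
    Module Bᵐᵒᵖ (BalTensor R M N) where
  smul b x := rightAct b x
  one_smul x := DFunLike.congr_fun (f := rightAct 1) (g := AddMonoidHom.id _)
    (hom_ext fun m n => by simp [rightAct]) x
  mul_smul b c x := DFunLike.congr_fun (f := rightAct (b * c))
    (g := (rightAct b).comp (rightAct c))
    (hom_ext fun m n => by simp [rightAct, mul_smul]) x
  smul_zero b := map_zero (rightAct b)
  smul_add b := map_add (rightAct b)
  add_smul b c x := DFunLike.congr_fun (f := rightAct (b + c)) (g := rightAct b + rightAct c)
    (hom_ext fun m n => by simp [rightAct, add_smul, tmul_add]) x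
  zero_smul x := DFunLike.congr_fun (f := rightAct (0 : Bᵐᵒᵖ)) (g := 0)
    (hom_ext fun m n => by simp [rightAct]) x

@[simp] theorem smul_tmul {B : Type*} [Ring B] [Module B M] [SMulCommClass B Rᵐᵒᵖ M]
    (b : B) (m : M) (n : N) : b • tmul R m n = tmul R (b • m) n := rfl

@[simp] theorem op_smul_tmul {B : Type*} [Ring B] [Module Bᵐᵒᵖ N] [SMulCommClass R Bᵐᵒᵖ N]
    (b : Bᵐᵒᵖ) (m : M) (n : N) : b • tmul R m n = tmul R m (b • n) := rfl

instance {B B' : Type*} [Ring B] [Module B M] [SMulCommClass B Rᵐᵒᵖ M]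
    [Ring B'] [Module B'ᵐᵒᵖ N] [SMulCommClass R B'ᵐᵒᵖ N] :
    SMulCommClass B B'ᵐᵒᵖ (BalTensor R M N) where
  smul_comm b c x := by
    induction x using ind with
    | zero => simp
    | tmul m n => simp
    | add x y hx hy => simp only [smul_add, hx, hy]

end Actions

section Assoc

variable {A M N P : Type*} [Ring A] [AddCommGroup M] [AddCommGroup N] [AddCommGroup P]
  [Module Aᵐᵒᵖ M] [Module A N] [Module Aᵐᵒᵖ N] [SMulCommClass A Aᵐᵒᵖ N] [Module A P]

/-- Auxiliary map for `assocHom`. -/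
def assocAux : BalTensor A M N →+ P →+ BalTensor A M (BalTensor A N P) :=
  lift (AddMonoidHom.mk' (fun m => (AddMonoidHom.compHom (mk A m)).comp (mk A))
      (fun m m' => by ext n p; exact add_tmul m m' _))
    (fun m a n => by ext p; exact balanced m a (tmul A n p))

@[simp] theorem assocAux_tmul (m : M) (n : N) (p : P) :
    assocAux (tmul A m n) p = tmul A m (tmul A n p) := rfl

theorem assocAux_balanced (x : BalTensor A M N) (a : A) (p : P) :
    assocAux (op a • x) p = assocAux x (a • p) := by
  induction x using ind with
  | zero => rw [smul_zero, map_zero]; rfl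
  | tmul m n => rw [op_smul_tmul, assocAux_tmul, assocAux_tmul, balanced]
  | add x y hx hy =>
    rw [smul_add, map_add, map_add, AddMonoidHom.add_apply, AddMonoidHom.add_apply, hx, hy]

/-- The map `(M ⊗_A N) ⊗_A P → M ⊗_A (N ⊗_A P)`, `(m ⊗ n) ⊗ p ↦ m ⊗ (n ⊗ p)`. -/
def assocHom : BalTensor A (BalTensor A M N) P →+ BalTensor A M (BalTensor A N P) :=
  lift assocAux assocAux_balanced

@[simp] theorem assocHom_tmul (m : M) (n : N) (p : P) :
    assocHom (tmul A (tmul A m n) p) = tmul A m (tmul A n p) := rfl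

theorem assocInvAux_balanced (m : M) (n : N) (a : A) (p : P) :
    (mk A).comp (mk A m) (op a • n) p =
      ((mk A).comp (mk A m) n (a • p) : BalTensor A (BalTensor A M N) P) :=
  balanced (tmul A m n) a p

/-- Auxiliary map for `assocInv`. -/
def assocInvAux : M →+ BalTensor A N P →+ BalTensor A (BalTensor A M N) P :=
  AddMonoidHom.mk' (fun m => lift ((mk A).comp (mk A m)) (assocInvAux_balanced m))
    (fun m m' => hom_ext fun n p => by
      rw [lift_tmul, AddMonoidHom.add_apply, lift_tmul, lift_tmul, map_add]
      exact add_tmul (tmul A m n) (tmul A m' n) p)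

@[simp] theorem assocInvAux_tmul (m : M) (n : N) (p : P) :
    assocInvAux m (tmul A n p) = tmul A (tmul A m n) p := rfl

theorem assocInvAux_op_smul (m : M) (a : A) (x : BalTensor A N P) :
    assocInvAux (op a • m) x = assocInvAux m (a • x) := by
  induction x using ind with
  | zero => rw [smul_zero, map_zero, map_zero]
  | tmul n p => rw [smul_tmul, assocInvAux_tmul, assocInvAux_tmul, balanced]
  | add x y hx hy => rw [smul_add, map_add, map_add, hx, hy]

/-- The inverse of `assocHom`. -/
def assocInv : BalTensor A M (BalTensor A N P) →+ BalTensor A (BalTensor A M N) P :=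
  lift assocInvAux assocInvAux_op_smul

@[simp] theorem assocInv_tmul (m : M) (n : N) (p : P) :
    assocInv (tmul A m (tmul A n p)) = tmul A (tmul A m n) p := rfl

/-- The associativity isomorphism `(M ⊗_A N) ⊗_A P ≃ M ⊗_A (N ⊗_A P)`. -/
def assoc : BalTensor A (BalTensor A M N) P ≃+ BalTensor A M (BalTensor A N P) :=
  { assocHom with
    invFun := assocInv
    left_inv := fun x => by
      refine DFunLike.congr_fun (f := assocInv.comp assocHom) (g := AddMonoidHom.id _)
        (hom_ext fun y p => ?_) x
      induction y using ind with
      | zero => simp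
      | tmul m n => simp
      | add y z hy hz => simp only [add_tmul, map_add, hy, hz]
    right_inv := fun x => by
      refine DFunLike.congr_fun (f := assocHom.comp assocInv) (g := AddMonoidHom.id _)
        (hom_ext fun m y => ?_) x
      induction y using ind with
      | zero => simp
      | tmul n p => simp
      | add y z hy hz => simp only [tmul_add, map_add, hy, hz] }

@[simp] theorem assoc_tmul (m : M) (n : N) (p : P) :
    assoc (tmul A (tmul A m n) p) = tmul A m (tmul A n p) := rfl

end Assoc

section Unit

variable {A M N : Type*} [Ring A] [AddCommGroup M] [AddCommGroup N] [Module Aᵐᵒᵖ M] [Module A N]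

/-- The isomorphism `A ⊗_A N → N`, `a ⊗ n ↦ a n`. -/
def lid : BalTensor A A N →+ N :=
  lift (AddMonoidHom.mk' (fun a => DistribSMul.toAddMonoidHom N a)
    (fun a b => by ext n; simp [add_smul])) (fun a r n => by simp [mul_smul])

@[simp] theorem lid_tmul (a : A) (n : N) : lid (tmul A a n) = a • n := rfl

/-- The isomorphism `M ⊗_A A → M`, `m ⊗ a ↦ m a`. -/
def rid : BalTensor A M A →+ M :=
  lift (AddMonoidHom.mk' (fun m => AddMonoidHom.mk' (fun a : A => op a • m)
      (fun a b => by simp [add_smul]))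
    (fun m m' => by ext a; simp)) (fun m r a => by simp [mul_smul])

@[simp] theorem rid_tmul (m : M) (a : A) : rid (tmul A m a) = op a • m := rfl

end Unit

end BalTensor

/-! ### Corings, comodules -/

/-- An `A`-coring: an `A`-bimodule with a coassociative comultiplication and a counit, both
bimodule maps. -/
structure Coring (A : Type u) [Ring A] where
  /-- the underlying set -/
  carrier : Type u
  [addCommGroup : AddCommGroup carrier]
  [leftModule : Module A carrier]
  [rightModule : Module Aᵐᵒᵖ carrier]
  [smulComm : SMulCommClass A Aᵐᵒᵖ carrier]
  /-- the comultiplication -/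
  comul : carrier →+ BalTensor A carrier carrier
  comul_smul : ∀ (a : A) (c : carrier), comul (a • c) = a • comul c
  comul_op_smul : ∀ (a : A) (c : carrier), comul (op a • c) = op a • comul c
  /-- the counit -/
  counit : carrier →+ A
  counit_smul : ∀ (a : A) (c : carrier), counit (a • c) = a • counit c
  counit_op_smul : ∀ (a : A) (c : carrier), counit (op a • c) = op a • counit c
  coassoc : ∀ c : carrier,
    BalTensor.map (AddMonoidHom.id carrier) comul (fun a => id_smul (op a)) comul_smul (comul c) =
      BalTensor.assoc
        (BalTensor.map comul (AddMonoidHom.id carrier) comul_op_smul id_smul (comul c))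
  counit_comul : ∀ c : carrier, BalTensor.lid
    (BalTensor.map counit (AddMonoidHom.id carrier) counit_op_smul id_smul (comul c)) = c
  comul_counit : ∀ c : carrier, BalTensor.rid
    (BalTensor.map (AddMonoidHom.id carrier) counit (fun a => id_smul (op a)) counit_smul (comul c)) = c

namespace Coring

variable {A : Type u} [Ring A]

instance : CoeSort (Coring A) (Type u) := ⟨Coring.carrier⟩

attribute [instance] Coring.addCommGroup Coring.leftModule Coring.rightModule Coring.smulComm

/-- `g` is grouplike: `Δ(g) = g ⊗ g` and `ε(g) = 1`. -/
def IsGrouplike (C : Coring A) (g : C) : Prop :=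
  C.comul g = BalTensor.tmul A g g ∧ C.counit g = 1

/-- `C` is flat as a left `A`-module: `- ⊗_A C` preserves injective maps of right
`A`-modules. -/
def IsLeftFlat (C : Coring A) : Prop :=
  ∀ (M N : Type u) [AddCommGroup M] [AddCommGroup N] [Module Aᵐᵒᵖ M] [Module Aᵐᵒᵖ N]
    (f : M →ₗ[Aᵐᵒᵖ] N), Function.Injective f →
    Function.Injective (BalTensor.map (R := A) f.toAddMonoidHom (AddMonoidHom.id C)
      (fun a => linear_smul f (op a)) id_smul)

/-- Homomorphisms of `A`-corings: bimodule maps compatible with comultiplication and counit. -/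
structure Hom (C D : Coring A) where
  /-- the underlying additive map -/
  toFun : C →+ D
  map_smul : ∀ (a : A) (c : C), toFun (a • c) = a • toFun c
  map_op_smul : ∀ (a : A) (c : C), toFun (op a • c) = op a • toFun c
  map_comul : ∀ c : C, D.comul (toFun c) =
    BalTensor.map toFun toFun map_op_smul map_smul (C.comul c)
  map_counit : ∀ c : C, D.counit (toFun c) = C.counit c

/-- A coring homomorphism is an isomorphism if it has a two-sided inverse which is a coring
homomorphism. -/
def Hom.IsIso {C D : Coring A} (f : Hom C D) : Prop :=
  ∃ f' : Hom D C, (∀ c, f'.toFun (f.toFun c) = c) ∧ ∀ d, f.toFun (f'.toFun d) = d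

end Coring

/-- A right comodule over the `A`-coring `C`. -/
structure Comod {A : Type u} [Ring A] (C : Coring A) where
  /-- the underlying set -/
  carrier : Type u
  [addCommGroup : AddCommGroup carrier]
  [rightModule : Module Aᵐᵒᵖ carrier]
  /-- the coaction -/
  coact : carrier →ₗ[Aᵐᵒᵖ] BalTensor A carrier C
  coassoc : ∀ m : carrier,
    BalTensor.map (AddMonoidHom.id carrier) C.comul (fun a => id_smul (op a)) C.comul_smul (coact m) =
      BalTensor.assoc (BalTensor.map coact.toAddMonoidHom (AddMonoidHom.id C)
        (fun a => linear_smul coact (op a)) id_smul (coact m))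
  coact_counit : ∀ m : carrier, BalTensor.rid
    (BalTensor.map (AddMonoidHom.id carrier) C.counit (fun a => id_smul (op a)) C.counit_smul
      (coact m)) = m

namespace Comod

variable {A : Type u} [Ring A] {C : Coring A}

attribute [instance] Comod.addCommGroup Comod.rightModule

/-- Morphisms of right comodules. -/
@[ext]
structure Hom (M N : Comod C) where
  /-- the underlying linear map -/
  toLinearMap : M.carrier →ₗ[Aᵐᵒᵖ] N.carrier
  comm : ∀ m : M.carrier, BalTensor.map toLinearMap.toAddMonoidHom (AddMonoidHom.id C)
    (fun a => linear_smul toLinearMap (op a)) id_smul (M.coact m) =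
      N.coact (toLinearMap m)

/-- The category of right `C`-comodules. -/
instance : Category (Comod C) where
  Hom := Hom
  id M := ⟨LinearMap.id, fun m => DFunLike.congr_fun
    (f := BalTensor.map (LinearMap.id (R := Aᵐᵒᵖ) (M := M.carrier)).toAddMonoidHom
      (AddMonoidHom.id C) (fun a => linear_smul _ (op a)) id_smul)
    (g := AddMonoidHom.id _) (BalTensor.hom_ext fun _ _ => rfl) (M.coact m)⟩
  comp f g := ⟨g.toLinearMap.comp f.toLinearMap, fun m => by
    have h := g.comm (f.toLinearMap m)
    rw [← f.comm m] at h
    rw [LinearMap.comp_apply, ← h]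
    generalize Comod.coact _ m = x
    induction x using BalTensor.ind with
    | zero => simp
    | tmul m c => rfl
    | add x y hx hy => simp only [map_add, hx, hy]⟩

end Comod

/-! ### Unital right modules over a ring without unit -/

/-- A right module `M` over a ring `R`, not necessarily with unit, which is unital in the sense
that `M = MR`. The right action is written as an action of `Rᵐᵒᵖ`. -/
structure UnitalMod (R : Type u) [NonUnitalRing R] where
  /-- the underlying set -/
  carrier : Type u
  [addCommGroup : AddCommGroup carrier]
  [smul : SMul Rᵐᵒᵖ carrier]
  smul_add : ∀ (r : R) (x y : carrier), op r • (x + y) = op r • x + op r • y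
  add_smul : ∀ (r s : R) (x : carrier), op (r + s) • x = op r • x + op s • x
  mul_smul : ∀ (r s : R) (x : carrier), op (r * s) • x = op s • op r • x
  unital : AddSubgroup.closure {x : carrier | ∃ (y : carrier) (r : R), x = op r • y} = ⊤

namespace UnitalMod

variable {R : Type u} [NonUnitalRing R]

attribute [instance] UnitalMod.addCommGroup UnitalMod.smul

/-- Homomorphisms of unital right `R`-modules. -/
@[ext]
structure Hom (X Y : UnitalMod R) where
  /-- the underlying additive map -/
  toFun : X.carrier →+ Y.carrier
  map_smul : ∀ (r : R) (x : X.carrier), toFun (op r • x) = op r • toFun x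

/-- The category of unital right `R`-modules. -/
instance : Category (UnitalMod R) where
  Hom := Hom
  id X := ⟨AddMonoidHom.id _, fun _ _ => rfl⟩
  comp f g := ⟨g.toFun.comp f.toFun, fun r x => by
    simp only [AddMonoidHom.comp_apply, f.map_smul, g.map_smul]⟩

/-- The map `f ⊗_R N` induced by a homomorphism `f` of unital right `R`-modules. -/
def tensorMap (N : Type*) [AddCommGroup N] [SMul R N] {X Y : UnitalMod R} (f : X ⟶ Y) :
    BalTensor R X.carrier N →+ BalTensor R Y.carrier N :=
  BalTensor.map (Hom.toFun f) (AddMonoidHom.id N) (Hom.map_smul f) id_smul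

end UnitalMod

/-- The left `R`-module `N` is faithfully flat: the functor `- ⊗_R N` from unital right
`R`-modules to abelian groups is exact and faithful. -/
structure IsFaithfullyFlat (R : Type u) [NonUnitalRing R] (N : Type u) [AddCommGroup N]
    [SMul R N] : Prop where
  exact : ∀ {X Y Z : UnitalMod R} (f : X ⟶ Y) (g : Y ⟶ Z),
    Function.Exact (UnitalMod.Hom.toFun f) (UnitalMod.Hom.toFun g) →
    Function.Exact (UnitalMod.tensorMap N f) (UnitalMod.tensorMap N g)
  faithful : ∀ {X Y : UnitalMod R} (f g : X ⟶ Y),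
    UnitalMod.tensorMap N f = UnitalMod.tensorMap N g → f = g

/-! ### Finite matrices indexed by an arbitrary set -/

/-- `I × I`-matrices over `A` with finitely many nonzero entries; the entry of `M` in row `i` and
column `j` is `M.entry i j`. -/
def FinMat (I : Type u) (A : Type u) [Ring A] : Type u := I × I →₀ A

/-- The free right `A`-module `⨁ i, [i]A` with basis `I`. -/
def FreeSum (I : Type u) (A : Type u) [Ring A] : Type u := I →₀ A

section FinMat

variable {I : Type u} {A : Type u} [Ring A]

instance : AddCommGroup (FinMat I A) := inferInstanceAs (AddCommGroup (I × I →₀ A))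

instance : AddCommGroup (FreeSum I A) := inferInstanceAs (AddCommGroup (I →₀ A))

/-- The element `[i]a` of the free right module. -/
def FreeSum.of (i : I) : A →+ FreeSum I A := Finsupp.singleAddHom i

theorem FreeSum.hom_ext {P : Type*} [AddCommGroup P] {f g : FreeSum I A →+ P}
    (h : ∀ i a, f (FreeSum.of i a) = g (FreeSum.of i a)) : f = g :=
  Finsupp.addHom_ext h

theorem FreeSum.ind {p : FreeSum I A → Prop} (x : FreeSum I A) (zero : p 0)
    (of : ∀ i a, p (FreeSum.of i a)) (add : ∀ x y, p x → p y → p (x + y)) : p x :=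
  Finsupp.induction_linear x zero add of

/-- Additive maps out of the free right module. -/
def FreeSum.lift {P : Type*} [AddCommGroup P] (f : I → A →+ P) : FreeSum I A →+ P :=
  Finsupp.liftAddHom f

@[simp] theorem FreeSum.lift_of {P : Type*} [AddCommGroup P] (f : I → A →+ P) (i : I) (a : A) :
    FreeSum.lift f (FreeSum.of i a) = f i a := Finsupp.liftAddHom_apply_single f i a

/-- The right action `([i]b) a = [i](ba)`. -/
instance : Module Aᵐᵒᵖ (FreeSum I A) := inferInstanceAs (Module Aᵐᵒᵖ (I →₀ A))

@[simp] theorem FreeSum.op_smul_of (i : I) (a : Aᵐᵒᵖ) (b : A) :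
    a • (FreeSum.of i b : FreeSum I A) = FreeSum.of i (a • b) := Finsupp.smul_single a i b

namespace FinMat

/-- The entry in row `i` and column `j`. -/
def entry (i j : I) : FinMat I A →+ A := Finsupp.applyAddHom (i, j)

/-- The matrix with entry `a` in row `i` and column `j` and zeros elsewhere. -/
def single (i j : I) : A →+ FinMat I A := Finsupp.singleAddHom (i, j)

theorem hom_ext {P : Type*} [AddCommGroup P] {f g : FinMat I A →+ P}
    (h : ∀ i j a, f (single i j a) = g (single i j a)) : f = g :=
  Finsupp.addHom_ext fun p a => h p.1 p.2 a

theorem ind {p : FinMat I A → Prop} (x : FinMat I A) (zero : p 0)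
    (single : ∀ i j a, p (single i j a)) (add : ∀ x y, p x → p y → p (x + y)) : p x :=
  Finsupp.induction_linear x zero add fun q a => single q.1 q.2 a

/-- Additive maps out of the group of finite matrices. -/
def lift {P : Type*} [AddCommGroup P] (f : I → I → A →+ P) : FinMat I A →+ P :=
  Finsupp.liftAddHom fun p => f p.1 p.2

@[simp] theorem lift_single {P : Type*} [AddCommGroup P] (f : I → I → A →+ P) (i j : I) (a : A) :
    lift f (single i j a) = f i j a := Finsupp.liftAddHom_apply_single _ (i, j) a

open Classical in
theorem entry_single (i j k l : I) (a : A) :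
    entry i j (single k l a) = if i = k ∧ j = l then a else 0 := by
  change (Finsupp.single (k, l) a) (i, j) = _
  rw [Finsupp.single_apply]
  simp only [Prod.mk.injEq, @eq_comm _ k, @eq_comm _ l]

theorem finite_entries (M : FinMat I A) : {p : I × I | entry p.1 p.2 M ≠ 0}.Finite :=
  Finsupp.hasFiniteSupport (M : I × I →₀ A)

open Classical in
/-- The action of matrices on columns, determined by `(a eᵢⱼ) [k]b = [i](ab)` if `j = k`, and `0`
otherwise. -/
def act : FinMat I A →+ FreeSum I A →+ FreeSum I A :=
  lift fun i j => AddMonoidHom.mk'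
    (fun a => FreeSum.lift fun k =>
      if j = k then (FreeSum.of i).comp (AddMonoidHom.mulLeft a) else 0)
    (fun a b => by
      refine FreeSum.hom_ext fun k c => ?_
      rw [AddMonoidHom.add_apply, FreeSum.lift_of, FreeSum.lift_of, FreeSum.lift_of]
      split_ifs <;> simp [add_mul])

open Classical in
/-- The matrix product, determined by `(a eᵢⱼ) (b eₖₗ) = (ab) eᵢₗ` if `j = k`, and `0` otherwise;
see `FinMat.entry_mul`. -/
def mul : FinMat I A →+ FinMat I A →+ FinMat I A :=
  lift fun i j => AddMonoidHom.mk'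
    (fun a => lift fun k l =>
      if j = k then (single i l).comp (AddMonoidHom.mulLeft a) else 0)
    (fun a b => by
      refine hom_ext fun k l c => ?_
      rw [AddMonoidHom.add_apply, lift_single, lift_single, lift_single]
      split_ifs <;> simp [add_mul])

open Classical in
theorem act_single_of (i j k : I) (a b : A) :
    act (single i j a) (FreeSum.of k b) = if j = k then FreeSum.of i (a * b) else 0 := by
  rw [act, lift_single, AddMonoidHom.mk'_apply, FreeSum.lift_of]
  split_ifs <;> rfl

open Classical in
theorem mul_single_single (i j k l : I) (a b : A) :
    mul (single i j a) (single k l b) = if j = k then single i l (a * b) else 0 := by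
  rw [mul, lift_single, AddMonoidHom.mk'_apply, lift_single]
  split_ifs <;> rfl

theorem mul_assoc' (M N L : FinMat I A) : mul (mul M N) L = mul M (mul N L) := by
  induction M using ind with
  | zero => simp
  | add x y hx hy => simp only [map_add, AddMonoidHom.add_apply, hx, hy]
  | single i j a =>
    induction N using ind with
    | zero => simp
    | add x y hx hy => simp only [map_add, AddMonoidHom.add_apply, hx, hy]
    | single k l b =>
      induction L using ind with
      | zero => simp
      | add x y hx hy => simp only [map_add, hx, hy]
      | single m n c =>
        rw [mul_single_single, mul_single_single]
        split_ifs <;> simp_all [mul_single_single, mul_assoc]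

theorem mul_act (M N : FinMat I A) (v : FreeSum I A) : act (mul M N) v = act M (act N v) := by
  induction M using ind with
  | zero => simp
  | add x y hx hy => simp only [map_add, AddMonoidHom.add_apply, hx, hy]
  | single i j a =>
    induction N using ind with
    | zero => simp
    | add x y hx hy => simp only [map_add, AddMonoidHom.add_apply, hx, hy]
    | single k l b =>
      induction v using FreeSum.ind with
      | zero => simp
      | add x y hx hy => simp only [map_add, hx, hy]
      | of m c =>
        rw [mul_single_single, act_single_of]
        split_ifs <;> simp_all [act_single_of, mul_assoc]

/-- The ring, in general without unit, of finite matrices. -/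
instance : NonUnitalRing (FinMat I A) where
  mul M N := mul M N
  left_distrib M N L := map_add (mul M) N L
  right_distrib M N L := DFunLike.congr_fun (map_add mul M N) L
  zero_mul M := DFunLike.congr_fun (map_zero mul) M
  mul_zero M := map_zero (mul M)
  mul_assoc := mul_assoc'

theorem mul_def (M N : FinMat I A) : M * N = mul M N := rfl

theorem entry_mul (M N : FinMat I A) (i k : I) :
    entry i k (M * N) = ∑ᶠ j, entry i j M * entry j k N := by
  have fin (M : FinMat I A) :
      (Function.support fun j => entry i j M * entry j k N).Finite := by
    refine (M.finite_entries.image Prod.snd).subset fun j hj => ⟨(i, j), fun h => hj ?_, rfl⟩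
    simp only at h
    simp [h]
  induction M using ind with
  | zero => simp
  | add x y hx hy =>
    simp only [add_mul, map_add, hx, hy]
    exact (finsum_add_distrib (fin x) (fin y)).symm
  | single m n a =>
    rw [finsum_eq_single _ n (fun j hj => by simp [entry_single, hj])]
    clear fin
    induction N using ind with
    | zero => simp
    | add x y hx hy => simp only [mul_add, map_add, hx, hy]
    | single p q b =>
      rw [mul_def, mul_single_single]
      split_ifs with h
      · subst h
        simp only [entry_single]
        split_ifs <;> simp_all
      · simp [entry_single, h]

/-- The action of finite matrices on columns. -/
instance : SMul (FinMat I A) (FreeSum I A) := ⟨fun M v => act M v⟩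

theorem smul_def (M : FinMat I A) (v : FreeSum I A) : M • v = act M v := rfl

instance : SMulCommClass (FinMat I A) Aᵐᵒᵖ (FreeSum I A) where
  smul_comm M a v := by
    simp only [smul_def]
    induction M using ind with
    | zero => simp
    | add x y hx hy => simp only [map_add, AddMonoidHom.add_apply, hx, hy, smul_add]
    | single i j b =>
      induction v using FreeSum.ind with
      | zero => simp
      | add x y hx hy => simp only [map_add, hx, hy, smul_add]
      | of k c =>
        rw [FreeSum.op_smul_of, act_single_of, act_single_of]
        split_ifs
        · rw [FreeSum.op_smul_of, mul_smul_comm]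
        · rw [smul_zero]

end FinMat

end FinMat

/-! ### The ring `R` of a family of elements of a coring -/

/-- For a family `γ : I → C` of elements of the coring `C`, the ring `R` of all finite
matrices whose entry `b` in row `h` and column `g` satisfies `γ_h b = b γ_g`. -/
def matRing {A : Type u} [Ring A] (C : Coring A) {I : Type u} (γ : I → C) :
    NonUnitalSubring (FinMat I A) where
  carrier := {M | ∀ h g, op (FinMat.entry h g M) • γ h = FinMat.entry h g M • γ g}
  zero_mem' := fun h g => by simp
  add_mem' := fun {M N} hM hN h g => by simp [add_smul, hM h g, hN h g]
  neg_mem' := fun {M} hM h g => by simp [hM h g]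
  mul_mem' := fun {M N} hM hN i k => by
    have key (j : I) : op (FinMat.entry i j M * FinMat.entry j k N) • γ i =
        (FinMat.entry i j M * FinMat.entry j k N) • γ k := by
      rw [op_mul, mul_smul, hM, mul_smul, ← hN, ← smul_comm]
    rw [FinMat.entry_mul]
    have hf : (Function.support fun j => FinMat.entry i j M * FinMat.entry j k N).Finite := by
      refine (M.finite_entries.image Prod.snd).subset fun j hj => ⟨(i, j), fun h => hj ?_, rfl⟩
      simp only at h
      simp [h]
    rw [finsum_eq_sum _ hf, Finset.op_sum, Finset.sum_smul, Finset.sum_smul]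
    exact Finset.sum_congr rfl fun j _ => key j

theorem matRing_ind {A : Type u} [Ring A] {C : Coring A} {I : Type u} {γ : I → C}
    {p : FinMat I A → Prop} {M : FinMat I A} (hM : M ∈ matRing C γ) (zero : p 0)
    (single : ∀ h g b, op b • γ h = b • γ g → p (FinMat.single h g b))
    (add : ∀ x y, p x → p y → p (x + y)) : p M := by
  have h : (Finsupp.sum (M : I × I →₀ A) fun q b => FinMat.single q.1 q.2 b) = M :=
    Finsupp.sum_single (M : I × I →₀ A)
  rw [← h]
  exact Finset.sum_induction _ p add zero fun q _ => single _ _ _ (hM q.1 q.2)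

/-! ### The comodule `Σ = ⨁ [g]A` -/

section Sigma

variable {A : Type u} [Ring A] (D : Coring A) {I : Type u} (δ : I → D)

theorem FinMat.act_op_smul (M : FinMat I A) (a : A) (v : FreeSum I A) :
    FinMat.act M (op a • v) = op a • FinMat.act M v := smul_comm M (op a) v

theorem op_add_smul_right {M : Type*} [AddCommGroup M] [Module Aᵐᵒᵖ M] (a b : A) (m : M) :
    op (a + b) • m = op a • m + op b • m := by
  rw [MulOpposite.op_add, add_smul]

/-- The map `Σ → Σ ⊗_A D`, `[i]a ↦ [i]1 ⊗ δ_i a`. -/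
def sigmaCoactHom : FreeSum I A →+ BalTensor A (FreeSum I A) D :=
  FreeSum.lift fun i => AddMonoidHom.mk'
    (fun a => BalTensor.tmul A (FreeSum.of i (1 : A)) (op a • δ i))
    (fun a b => by rw [op_add_smul_right, BalTensor.tmul_add])

@[simp] theorem sigmaCoactHom_of (i : I) (a : A) : sigmaCoactHom D δ (FreeSum.of i a) =
    BalTensor.tmul A (FreeSum.of i (1 : A)) (op a • δ i) := FreeSum.lift_of _ _ _

/-- The coaction of `Σ` as a right `A`-linear map. -/
def sigmaCoact : FreeSum I A →ₗ[Aᵐᵒᵖ] BalTensor A (FreeSum I A) D :=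
  { sigmaCoactHom D δ with
    map_smul' := fun a v => by
      change sigmaCoactHom D δ (a • v) = a • sigmaCoactHom D δ v
      induction v using FreeSum.ind with
      | zero => rw [smul_zero, map_zero, smul_zero]
      | add x y hx hy => rw [smul_add, map_add, hx, hy, map_add, smul_add]
      | of i b =>
        rw [FreeSum.op_smul_of, sigmaCoactHom_of, sigmaCoactHom_of, BalTensor.op_smul_tmul,
          smul_smul]
        rfl }

@[simp] theorem sigmaCoact_of (i : I) (a : A) : sigmaCoact D δ (FreeSum.of i a) =
    BalTensor.tmul A (FreeSum.of i (1 : A)) (op a • δ i) := sigmaCoactHom_of D δ i a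

variable {D δ} in
/-- The coaction of `Σ` is left linear over the ring `R`. -/
theorem sigmaCoact_act {M : FinMat I A} (hM : M ∈ matRing D δ) (v : FreeSum I A) :
    BalTensor.map (FinMat.act M) (AddMonoidHom.id D) (FinMat.act_op_smul M) id_smul
      (sigmaCoactHom D δ v) = sigmaCoactHom D δ (FinMat.act M v) := by
  induction v using FreeSum.ind with
  | zero => simp only [map_zero]
  | add x y hx hy => simp only [map_add, hx, hy]
  | of k a =>
    rw [sigmaCoactHom_of, BalTensor.map_tmul, AddMonoidHom.id_apply]
    refine matRing_ind (p := fun M => BalTensor.tmul A (FinMat.act M (FreeSum.of k 1))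
      (op a • δ k) = sigmaCoactHom D δ (FinMat.act M (FreeSum.of k a))) hM ?_ ?_ ?_
    · simp
    · intro i j b h
      rw [FinMat.act_single_of, FinMat.act_single_of]
      split_ifs with hjk
      · subst hjk
        rw [sigmaCoactHom_of, op_mul, mul_smul, h, ← smul_comm, ← BalTensor.balanced,
          FreeSum.op_smul_of, op_smul_eq_mul, one_mul, mul_one]
      · simp
    · intro x y hx hy
      simp only [map_add, AddMonoidHom.add_apply, BalTensor.add_tmul, hx, hy]

variable {δ} (hδ : ∀ i, D.IsGrouplike (δ i))

/-- The right `D`-comodule `Σ = ⨁ᵢ [δ i]A` for a family of grouplike elements `δ i`: the direct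
sum of copies of `A` with coactions `[i]a ↦ [i]1 ⊗ δ_i a`. -/
def sigma : Comod D where
  carrier := FreeSum I A
  coact := sigmaCoact D δ
  coassoc v := by
    induction v using FreeSum.ind with
    | zero => simp only [map_zero]
    | add x y hx hy => simp only [map_add, hx, hy]
    | of i a =>
      simp only [sigmaCoact_of, BalTensor.map_tmul, LinearMap.toAddMonoidHom_coe, op_one, one_smul,
        BalTensor.assoc_tmul, AddMonoidHom.id_apply, D.comul_op_smul, (hδ i).1,
        BalTensor.op_smul_tmul]
  coact_counit v := by
    induction v using FreeSum.ind with
    | zero => simp only [map_zero]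
    | add x y hx hy => simp only [map_add, hx, hy]
    | of i a =>
      simp only [sigmaCoact_of, BalTensor.map_tmul, AddMonoidHom.id_apply, D.counit_op_smul,
        (hδ i).2, BalTensor.rid_tmul, FreeSum.op_smul_of, op_smul_eq_mul, one_mul]

end Sigma

/-! ### The functor `- ⊗_R Σ` -/

section TensorSigma

variable {A : Type u} [Ring A] {D : Coring A} {I : Type u} {δ : I → D}
  (hδ : ∀ i, D.IsGrouplike (δ i)) {R : NonUnitalSubring (FinMat I A)}

theorem mk_op_smul (X : UnitalMod R) (x : X.carrier) (a : A) (v : FreeSum I A) :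
    BalTensor.mk R x (op a • v) = op a • BalTensor.mk R x v := rfl

/-- For `x : X`, the map `Σ → (X ⊗_R Σ) ⊗_A D` that sends `s` to `∑ (x ⊗ s₀) ⊗ s₁`, where
`∑ s₀ ⊗ s₁` is the coaction of `s`. -/
def tensorCoactAux (X : UnitalMod R) :
    X.carrier →+ FreeSum I A →+ BalTensor A (BalTensor R X.carrier (FreeSum I A)) D :=
  AddMonoidHom.mk' (fun x => (BalTensor.map (BalTensor.mk R x) (AddMonoidHom.id D)
      (mk_op_smul X x) id_smul).comp (sigmaCoactHom D δ))
    (fun x y => FreeSum.hom_ext fun i a => by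
      simp [BalTensor.add_tmul])

theorem tensorCoactAux_balanced (hR : R ≤ matRing D δ) (X : UnitalMod R) (x : X.carrier) (r : R) (v : FreeSum I A) :
    tensorCoactAux (δ := δ) X (op r • x) v = tensorCoactAux (δ := δ) X x (r • v) := by
  change _ = BalTensor.map (BalTensor.mk R x) (AddMonoidHom.id D)
      (mk_op_smul X x) id_smul (sigmaCoactHom D δ (FinMat.act r v))
  rw [← sigmaCoact_act (hR r.2)]
  change BalTensor.map (BalTensor.mk R (op r • x)) (AddMonoidHom.id D)
      (mk_op_smul X _) id_smul (sigmaCoactHom D δ v) = _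
  generalize sigmaCoactHom D δ v = z
  induction z using BalTensor.ind with
  | zero => simp only [map_zero]
  | add x y hx hy => simp only [map_add, hx, hy]
  | tmul w d =>
    rw [BalTensor.map_tmul, BalTensor.map_tmul, BalTensor.map_tmul]
    exact congrArg (fun z => BalTensor.tmul A z d) (BalTensor.balanced x r w)

variable (hR : R ≤ matRing D δ)

/-- The coaction `X ⊗_R Σ → (X ⊗_R Σ) ⊗_A D` induced by the coaction of `Σ`. -/
def tensorCoactHom (X : UnitalMod R) : BalTensor R X.carrier (FreeSum I A) →+
    BalTensor A (BalTensor R X.carrier (FreeSum I A)) D :=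
  BalTensor.lift (tensorCoactAux X) (tensorCoactAux_balanced hR X)

@[simp] theorem tensorCoactHom_tmul (X : UnitalMod R) (x : X.carrier) (i : I) (a : A) :
    tensorCoactHom hR X (BalTensor.tmul R x (FreeSum.of i a)) =
      BalTensor.tmul A (BalTensor.tmul R x (FreeSum.of i (1 : A))) (op a • δ i) := by
  rw [tensorCoactHom, BalTensor.lift_tmul]
  change BalTensor.map (BalTensor.mk R x) (AddMonoidHom.id D)
      (mk_op_smul X x) id_smul (sigmaCoactHom D δ (FreeSum.of i a)) = _
  rw [sigmaCoactHom_of, BalTensor.map_tmul]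
  rfl

theorem tensor_ind {X : UnitalMod R} {p : BalTensor R X.carrier (FreeSum I A) → Prop}
    (z : BalTensor R X.carrier (FreeSum I A)) (zero : p 0)
    (tmul : ∀ x i a, p (BalTensor.tmul R x (FreeSum.of i a)))
    (add : ∀ x y, p x → p y → p (x + y)) : p z := by
  induction z using BalTensor.ind with
  | zero => exact zero
  | add x y hx hy => exact add _ _ hx hy
  | tmul x v =>
    induction v using FreeSum.ind with
    | zero => rw [BalTensor.tmul_zero]; exact zero
    | add v w hv hw => rw [BalTensor.tmul_add]; exact add _ _ hv hw
    | of i a => exact tmul x i a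

/-- `tensorCoactHom` as a right `A`-linear map. -/
def tensorCoact (X : UnitalMod R) : BalTensor R X.carrier (FreeSum I A) →ₗ[Aᵐᵒᵖ]
    BalTensor A (BalTensor R X.carrier (FreeSum I A)) D :=
  { tensorCoactHom hR X with
    map_smul' := fun a z => by
      change tensorCoactHom hR X (a • z) = a • tensorCoactHom hR X z
      induction z using tensor_ind with
      | zero => rw [smul_zero, map_zero, smul_zero]
      | add x y hx hy => rw [smul_add, map_add, hx, hy, map_add, smul_add]
      | tmul x i b =>
        rw [BalTensor.op_smul_tmul, FreeSum.op_smul_of, tensorCoactHom_tmul, tensorCoactHom_tmul,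
          BalTensor.op_smul_tmul, smul_smul]
        rfl }

@[simp] theorem tensorCoact_tmul (X : UnitalMod R) (x : X.carrier) (i : I) (a : A) :
    tensorCoact hR X (BalTensor.tmul R x (FreeSum.of i a)) =
      BalTensor.tmul A (BalTensor.tmul R x (FreeSum.of i (1 : A))) (op a • δ i) :=
  tensorCoactHom_tmul hR X x i a

/-- The comodule `X ⊗_R Σ`. -/
def tensorSigmaObj (X : UnitalMod R) : Comod D where
  carrier := BalTensor R X.carrier (FreeSum I A)
  coact := tensorCoact hR X
  coassoc v := by
    induction v using tensor_ind with
    | zero => simp only [map_zero]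
    | add x y hx hy => simp only [map_add, hx, hy]
    | tmul x i a =>
      simp only [tensorCoact_tmul, BalTensor.map_tmul, LinearMap.toAddMonoidHom_coe, op_one,
        one_smul, BalTensor.assoc_tmul, AddMonoidHom.id_apply, D.comul_op_smul, (hδ i).1,
        BalTensor.op_smul_tmul]
  coact_counit v := by
    induction v using tensor_ind with
    | zero => simp only [map_zero]
    | add x y hx hy => simp only [map_add, hx, hy]
    | tmul x i a =>
      simp only [tensorCoact_tmul, BalTensor.map_tmul, AddMonoidHom.id_apply, D.counit_op_smul,
        (hδ i).2, BalTensor.rid_tmul, FreeSum.op_smul_of, op_smul_eq_mul, one_mul,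
        BalTensor.op_smul_tmul]

theorem tensorMap_op_smul {X Y : UnitalMod R} (f : X ⟶ Y) (a : Aᵐᵒᵖ)
    (z : BalTensor R X.carrier (FreeSum I A)) :
    UnitalMod.tensorMap (FreeSum I A) f (a • z) = a • UnitalMod.tensorMap (FreeSum I A) f z := by
  induction z using BalTensor.ind with
  | zero => rw [smul_zero, map_zero, smul_zero]
  | add x y hx hy => rw [smul_add, map_add, hx, hy, map_add, smul_add]
  | tmul x v => rfl

/-- The functor `- ⊗_R Σ` from unital right `R`-modules to right `D`-comodules, where
`Σ = ⨁ᵢ [δ i]A`. -/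
def tensorSigma : UnitalMod R ⥤ Comod D where
  obj X := tensorSigmaObj hδ hR X
  map {X Y} f := Comod.Hom.mk
    { UnitalMod.tensorMap (FreeSum I A) f with map_smul' := tensorMap_op_smul f }
    (fun z => by
      change BalTensor R X.carrier (FreeSum I A) at z
      change _ = tensorCoact hR Y (UnitalMod.tensorMap (FreeSum I A) f z)
      change BalTensor.map (UnitalMod.tensorMap (FreeSum I A) f) (AddMonoidHom.id D)
        (fun a => tensorMap_op_smul f (op a)) id_smul (tensorCoact hR X z) = _
      induction z using tensor_ind with
      | zero => simp only [map_zero]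
      | add x y hx hy => simp only [map_add, hx, hy]
      | tmul x i a =>
        rw [tensorCoact_tmul, BalTensor.map_tmul]
        exact (tensorCoact_tmul hR Y (UnitalMod.Hom.toFun f x) i a).symm)
  map_id X := Comod.Hom.ext (LinearMap.ext fun z => by
    change UnitalMod.tensorMap (FreeSum I A) (𝟙 X) z = z
    exact DFunLike.congr_fun (f := UnitalMod.tensorMap (FreeSum I A) (𝟙 X))
      (g := AddMonoidHom.id _) (BalTensor.hom_ext fun _ _ => rfl) z)
  map_comp {X Y Z} f g := Comod.Hom.ext (LinearMap.ext fun z => by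
    change UnitalMod.tensorMap (FreeSum I A) (f ≫ g) z =
      (UnitalMod.tensorMap (FreeSum I A) g).comp (UnitalMod.tensorMap (FreeSum I A) f) z
    exact DFunLike.congr_fun (f := UnitalMod.tensorMap (FreeSum I A) (f ≫ g))
      (g := (UnitalMod.tensorMap (FreeSum I A) g).comp (UnitalMod.tensorMap (FreeSum I A) f))
      (BalTensor.hom_ext fun _ _ => rfl) z)

end TensorSigma

/-! ### The coring `ℜ(G)` and the canonical map -/

section Comatrix

variable {A : Type u} [Ring A] (C : Coring A) {I : Type u} (γ : I → C)

/-- The set `A_{g,h}` of all `b` in `A` with `h b = b g`. -/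
def homSet (g h : C) : Set A := {b | op b • h = b • g}

/-- The subring `A_{g,g}` of all `b` in `A` with `g b = b g`. -/
def stab (g : C) : Subring A where
  carrier := homSet C g g
  zero_mem' := by simp [homSet]
  one_mem' := by simp [homSet]
  add_mem' {a b} (ha : _ = _) (hb : _ = _) := by
    change op _ • g = _ • g
    rw [op_add_smul_right, ha, hb, add_smul]
  neg_mem' {a} (ha : _ = _) := by
    change op _ • g = _ • g
    rw [MulOpposite.op_neg, neg_smul, ha, neg_smul]
  mul_mem' {a b} (ha : _ = _) (hb : _ = _) := by
    change op _ • g = _ • g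
    rw [op_mul, mul_smul, ha, mul_smul, ← hb, ← smul_comm]

/-- The right action of a subring of `A` on `A`. -/
instance (s : Subring A) : SMul (↥s)ᵐᵒᵖ A := ⟨fun t a => a * (t.unop : A)⟩

theorem subring_op_smul (s : Subring A) (t : s) (a : A) : op t • a = a * (t : A) := rfl

instance (s : Subring A) : SMulCommClass A (↥s)ᵐᵒᵖ A where
  smul_comm a t b := (mul_assoc a b (t.unop : A)).symm

/-- The direct sum of the bimodules `A ⊗_{A_{g,g}} A`. -/
abbrev PreComatrix : Type u := DirectSum I fun i => BalTensor (stab C (γ i)) A A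

open Classical in
/-- The element `a ⊗_{A_{g,g}} a'` of the direct sum, `g = γ i`. -/
def PreComatrix.of (i : I) (a a' : A) : PreComatrix C γ :=
  DirectSum.of (fun i => BalTensor (stab C (γ i)) A A) i (BalTensor.tmul (stab C (γ i)) a a')

/-- The subgroup `𝔍` generated by the elements `a ⊗_{A_{h,h}} t a' - a t ⊗_{A_{g,g}} a'` with `t` in
`A_{g,h}`. -/
def coideal : AddSubgroup (PreComatrix C γ) :=
  AddSubgroup.closure {z | ∃ (g h : I) (t : A) (a a' : A), t ∈ homSet C (γ g) (γ h) ∧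
    z = PreComatrix.of C γ h a (t * a') - PreComatrix.of C γ g (a * t) a'}

/-- The abelian group underlying the coring `ℜ(G)`. -/
def Comatrix : Type u := PreComatrix C γ ⧸ coideal C γ

instance : AddCommGroup (Comatrix C γ) :=
  inferInstanceAs (AddCommGroup (PreComatrix C γ ⧸ coideal C γ))

namespace Comatrix

/-- The projection onto the quotient. -/
def proj : PreComatrix C γ →+ Comatrix C γ := QuotientAddGroup.mk' (coideal C γ)

open Classical in
/-- The biadditive map sending `(a, a')` to the class of `a ⊗_{A_{g,g}} a'`, `g = γ i`. -/
def mk (i : I) : A →+ A →+ Comatrix C γ :=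
  AddMonoidHom.mk' (fun a => ((proj C γ).comp
      (DirectSum.of (fun i => BalTensor (stab C (γ i)) A A) i)).comp
      (BalTensor.mk (stab C (γ i)) a))
    (fun a b => by
      ext c
      simp only [AddMonoidHom.comp_apply, map_add, AddMonoidHom.add_apply])

theorem mk_eq (i : I) (a a' : A) : mk C γ i a a' =
    (PreComatrix.of C γ i a a' : PreComatrix C γ ⧸ coideal C γ) := rfl

theorem mk_rel {g h : I} {t : A} (ht : t ∈ homSet C (γ g) (γ h)) (a a' : A) :
    mk C γ h a (t * a') = mk C γ g (a * t) a' :=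
  (QuotientAddGroup.eq_iff_sub_mem).2 (AddSubgroup.subset_closure ⟨g, h, t, a, a', ht, rfl⟩)

variable {C γ}

open Classical in
theorem ind {p : Comatrix C γ → Prop} (x : Comatrix C γ) (zero : p 0)
    (cls : ∀ i a a', p (mk C γ i a a')) (add : ∀ x y, p x → p y → p (x + y)) : p x := by
  obtain ⟨z, rfl⟩ := QuotientAddGroup.mk_surjective x
  induction z using DirectSum.induction_on with
  | zero => exact zero
  | add x y hx hy => exact add _ _ hx hy
  | of i y =>
    induction y using BalTensor.ind with
    | zero => rw [map_zero]; exact zero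
    | add x y hx hy => rw [map_add]; exact add _ _ hx hy
    | tmul a a' => exact cls i a a'

theorem hom_ext {P : Type*} [AddCommGroup P] {f g : Comatrix C γ →+ P}
    (h : ∀ i a a', f (mk C γ i a a') = g (mk C γ i a a')) : f = g := by
  ext x
  induction x using ind with
  | zero => rw [map_zero, map_zero]
  | cls i a a' => exact h i a a'
  | add x y hx hy => rw [map_add, map_add, hx, hy]

open Classical in
/-- Additive maps out of `ℜ(G)`. -/
def lift {P : Type*} [AddCommGroup P] (f : I → A →+ A →+ P)
    (hf : ∀ (g h : I) (t : A), t ∈ homSet C (γ g) (γ h) →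
      ∀ a a', f h a (t * a') = f g (a * t) a') : Comatrix C γ →+ P :=
  QuotientAddGroup.lift (coideal C γ)
    (DirectSum.toAddMonoid fun i => BalTensor.lift (R := stab C (γ i)) (f i)
      (fun a t a' => (hf i i t t.2 a a').symm))
    (by
      rw [coideal, AddSubgroup.closure_le]
      rintro _ ⟨g, h, t, a, a', ht, rfl⟩
      simp only [PreComatrix.of, SetLike.mem_coe, AddMonoidHom.mem_ker, map_sub,
        DirectSum.toAddMonoid_of, BalTensor.lift_tmul, hf g h t ht, sub_self])

@[simp] theorem lift_cls {P : Type*} [AddCommGroup P] (f : I → A →+ A →+ P)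
    (hf : ∀ (g h : I) (t : A), t ∈ homSet C (γ g) (γ h) →
      ∀ a a', f h a (t * a') = f g (a * t) a') (i : I) (a a' : A) :
    lift f hf (mk C γ i a a') = f i a a' := by
  classical
  change (DirectSum.toAddMonoid fun i => BalTensor.lift (R := stab C (γ i)) (f i)
    (fun a t a' => (hf i i t t.2 a a').symm)) (PreComatrix.of C γ i a a') = _
  rw [PreComatrix.of]
  rw [DirectSum.toAddMonoid_of, BalTensor.lift_tmul]

/-- Left multiplication by `b`. -/
def leftAct (b : A) : Comatrix C γ →+ Comatrix C γ :=
  lift (fun i => (mk C γ i).comp (AddMonoidHom.mulLeft b)) (fun g h t ht a a' => by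
    simp only [AddMonoidHom.comp_apply, AddMonoidHom.coe_mulLeft, mk_rel C γ ht, mul_assoc])

@[simp] theorem leftAct_cls (b : A) (i : I) (a a' : A) :
    leftAct b (mk C γ i a a') = mk C γ i (b * a) a' := lift_cls _ _ _ _ _

/-- Right multiplication by `b`. -/
def rightAct (b : Aᵐᵒᵖ) : Comatrix C γ →+ Comatrix C γ :=
  lift (fun i => (mk C γ i).compl₂ (AddMonoidHom.mulRight b.unop)) (fun g h t ht a a' => by
    simp only [AddMonoidHom.compl₂_apply, AddMonoidHom.mulRight_apply, mul_assoc,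
      mk_rel C γ ht])

@[simp] theorem rightAct_cls (b : Aᵐᵒᵖ) (i : I) (a a' : A) :
    rightAct b (mk C γ i a a') = mk C γ i a (a' * b.unop) := lift_cls _ _ _ _ _

/-- The left action `b (a ⊗ a') = ba ⊗ a'`. -/
instance : Module A (Comatrix C γ) where
  smul b x := leftAct b x
  one_smul x := DFunLike.congr_fun (f := leftAct 1) (g := AddMonoidHom.id _)
    (hom_ext fun i m n => by simp) x
  mul_smul b c x := DFunLike.congr_fun (f := leftAct (b * c)) (g := (leftAct b).comp (leftAct c))
    (hom_ext fun i m n => by simp [mul_assoc]) x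
  smul_zero b := map_zero (leftAct b)
  smul_add b := map_add (leftAct b)
  add_smul b c x := DFunLike.congr_fun (f := leftAct (b + c)) (g := leftAct b + leftAct c)
    (hom_ext fun i m n => by simp [add_mul]) x
  zero_smul x := DFunLike.congr_fun (f := leftAct (0 : A)) (g := 0)
    (hom_ext fun i m n => by simp) x

/-- The right action `(a ⊗ a') b = a ⊗ a'b`. -/
instance : Module Aᵐᵒᵖ (Comatrix C γ) where
  smul b x := rightAct b x
  one_smul x := DFunLike.congr_fun (f := rightAct 1) (g := AddMonoidHom.id _)
    (hom_ext fun i m n => by simp) x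
  mul_smul b c x := DFunLike.congr_fun (f := rightAct (b * c))
    (g := (rightAct b).comp (rightAct c)) (hom_ext fun i m n => by simp [mul_assoc]) x
  smul_zero b := map_zero (rightAct b)
  smul_add b := map_add (rightAct b)
  add_smul b c x := DFunLike.congr_fun (f := rightAct (b + c)) (g := rightAct b + rightAct c)
    (hom_ext fun i m n => by simp [mul_add]) x
  zero_smul x := DFunLike.congr_fun (f := rightAct (0 : Aᵐᵒᵖ)) (g := 0)
    (hom_ext fun i m n => by simp) x

@[simp] theorem smul_cls (b : A) (i : I) (a a' : A) :
    b • mk C γ i a a' = mk C γ i (b * a) a' := leftAct_cls b i a a'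

@[simp] theorem op_smul_cls (b : Aᵐᵒᵖ) (i : I) (a a' : A) :
    b • mk C γ i a a' = mk C γ i a (a' * b.unop) := rightAct_cls b i a a'

instance : SMulCommClass A Aᵐᵒᵖ (Comatrix C γ) where
  smul_comm b c x := by
    induction x using ind with
    | zero => simp
    | add x y hx hy => simp only [smul_add, hx, hy]
    | cls i a a' => simp

variable (C γ) in
/-- The comultiplication `a ⊗_{A_{g,g}} a' ↦ (a ⊗_{A_{g,g}} 1) ⊗_A (1 ⊗_{A_{g,g}} a')`. -/
def comul : Comatrix C γ →+ BalTensor A (Comatrix C γ) (Comatrix C γ) :=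
  lift (fun i => ((BalTensor.mk A).comp ((mk C γ i).flip 1)).compl₂ (mk C γ i 1))
    (fun g h t ht a a' => by
      simp only [AddMonoidHom.compl₂_apply, AddMonoidHom.comp_apply, AddMonoidHom.flip_apply,
        BalTensor.mk_apply]
      rw [mk_rel C γ ht 1 a', ← mk_rel C γ ht a 1, one_mul, mul_one]
      have h1 : mk C γ g t a' = t • mk C γ g 1 a' := by simp
      have h2 : mk C γ h a t = op t • mk C γ h a 1 := by simp
      rw [h1, h2, BalTensor.balanced])

@[simp] theorem comul_cls (i : I) (a a' : A) : comul C γ (mk C γ i a a') =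
    BalTensor.tmul A (mk C γ i a 1) (mk C γ i 1 a') := lift_cls _ _ _ _ _

variable (C γ) in
/-- The counit `a ⊗_{A_{g,g}} a' ↦ a a'`. -/
def counit : Comatrix C γ →+ A :=
  lift (fun _ => AddMonoidHom.mul) (fun _ _ t _ a a' => (mul_assoc a t a').symm)

@[simp] theorem counit_cls (i : I) (a a' : A) : counit C γ (mk C γ i a a') = a * a' :=
  lift_cls _ _ _ _ _

end Comatrix

/-- The `A`-coring `ℜ(G)`. -/
def comatrixCoring : Coring A where
  carrier := Comatrix C γ
  comul := Comatrix.comul C γ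
  comul_smul b x := by
    induction x using Comatrix.ind with
    | zero => simp only [map_zero, smul_zero]
    | add x y hx hy => simp only [map_add, smul_add, hx, hy]
    | cls i a a' => simp
  comul_op_smul b x := by
    induction x using Comatrix.ind with
    | zero => simp only [map_zero, smul_zero]
    | add x y hx hy => simp only [map_add, smul_add, hx, hy]
    | cls i a a' => simp
  counit := Comatrix.counit C γ
  counit_smul b x := by
    induction x using Comatrix.ind with
    | zero => simp only [map_zero, smul_zero]
    | add x y hx hy => simp only [map_add, smul_add, hx, hy]
    | cls i a a' => simp [mul_assoc]
  counit_op_smul b x := by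
    induction x using Comatrix.ind with
    | zero => simp only [map_zero, smul_zero]
    | add x y hx hy => simp only [map_add, smul_add, hx, hy]
    | cls i a a' => simp [mul_assoc]
  coassoc x := by
    induction x using Comatrix.ind with
    | zero => simp only [map_zero]
    | add x y hx hy => simp only [map_add, hx, hy]
    | cls i a a' => simp
  counit_comul x := by
    induction x using Comatrix.ind with
    | zero => simp only [map_zero]
    | add x y hx hy => simp only [map_add, hx, hy]
    | cls i a a' => simp
  comul_counit x := by
    induction x using Comatrix.ind with
    | zero => simp only [map_zero]
    | add x y hx hy => simp only [map_add, hx, hy]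
    | cls i a a' => simp

/-- The grouplike element `1 ⊗_{A_{g,g}} 1` of `ℜ(G)`, `g = γ i`. -/
def comatrixGrouplike (i : I) : comatrixCoring C γ := Comatrix.mk C γ i 1 1

theorem comatrixGrouplike_isGrouplike (i : I) :
    (comatrixCoring C γ).IsGrouplike (comatrixGrouplike C γ i) :=
  ⟨Comatrix.comul_cls i 1 1, (Comatrix.counit_cls i 1 1).trans (one_mul 1)⟩

theorem matRing_le_comatrix :
    matRing C γ ≤ matRing (comatrixCoring C γ) (comatrixGrouplike C γ) := by
  intro M hM h g
  have h1 : op (FinMat.entry h g M) • Comatrix.mk C γ h 1 1 =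
      FinMat.entry h g M • Comatrix.mk C γ g 1 1 := by
    simpa using Comatrix.mk_rel C γ (hM h g) 1 1
  exact h1

/-- The additive map `ℜ(G) → C`, `a ⊗_{A_{g,g}} a' ↦ a g a'`. -/
def canHom : Comatrix C γ →+ C :=
  Comatrix.lift
    (fun i => AddMonoidHom.mk' (fun a => AddMonoidHom.mk' (fun a' => a • op a' • γ i)
        (fun b b' => by rw [op_add_smul_right, smul_add]))
      (fun b b' => by ext a'; exact add_smul b b' _))
    (fun g h t ht a a' => by
      change a • op (t * a') • γ h = (a * t) • op a' • γ g
      rw [op_mul, mul_smul, show op t • γ h = t • γ g from ht, mul_smul, smul_comm t])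

@[simp] theorem canHom_mk (i : I) (a a' : A) :
    canHom C γ (Comatrix.mk C γ i a a') = a • op a' • γ i := Comatrix.lift_cls _ _ _ _ _

theorem canHom_smul (b : A) (x : Comatrix C γ) : canHom C γ (b • x) = b • canHom C γ x := by
  induction x using Comatrix.ind with
  | zero => simp only [map_zero, smul_zero]
  | add x y hx hy => simp only [map_add, smul_add, hx, hy]
  | cls i a a' => rw [Comatrix.smul_cls, canHom_mk, canHom_mk, mul_smul]

theorem canHom_op_smul (b : A) (x : Comatrix C γ) :
    canHom C γ (op b • x) = op b • canHom C γ x := by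
  induction x using Comatrix.ind with
  | zero => simp only [map_zero, smul_zero]
  | add x y hx hy => simp only [map_add, smul_add, hx, hy]
  | cls i a a' =>
    rw [Comatrix.op_smul_cls, canHom_mk, canHom_mk, unop_op, op_mul, mul_smul, smul_comm a]

variable {γ} in
/-- The canonical homomorphism of corings `can : ℜ(G) → C`, `a ⊗_{A_{g,g}} a' ↦ a g a'`. -/
def can (hγ : ∀ i, C.IsGrouplike (γ i)) : Coring.Hom (comatrixCoring C γ) C where
  toFun := canHom C γ
  map_smul := canHom_smul C γ
  map_op_smul := canHom_op_smul C γ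
  map_comul x := by
    change C.comul (canHom C γ x) = BalTensor.map (canHom C γ) (canHom C γ)
      (canHom_op_smul C γ) (canHom_smul C γ) (Comatrix.comul C γ x)
    induction x using Comatrix.ind with
    | zero => simp only [map_zero]
    | add x y hx hy => simp only [map_add, hx, hy]
    | cls i a a' =>
      rw [canHom_mk, C.comul_smul, C.comul_op_smul, (hγ i).1, Comatrix.comul_cls,
        BalTensor.map_tmul, canHom_mk, canHom_mk, BalTensor.op_smul_tmul, BalTensor.smul_tmul,
        op_one, one_smul, one_smul]
  map_counit x := by
    change C.counit (canHom C γ x) = Comatrix.counit C γ x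
    induction x using Comatrix.ind with
    | zero => simp only [map_zero]
    | add x y hx hy => simp only [map_add, hx, hy]
    | cls i a a' =>
      rw [canHom_mk, C.counit_smul, C.counit_op_smul, (hγ i).2, Comatrix.counit_cls,
        op_smul_eq_mul, one_mul, smul_eq_mul]

end Comatrix

end GaloisCoring

end

/-! For a comodule M and a grouplike g, let M^{co g} be the group of all m with ρ(m) = m ⊗ g. A
morphism Σ → M is the same as a family of elements m_g in M^{co g}. If hb = bg, then multiplication
by b carries M^{co h} into M^{co g}, so the finite families of coinvariants form a right R-module.
This gives a right adjoint M ↦ ⨁ M^{co g} of - ⊗_R Σ (`tensorAdj`), with unit x ↦ (x ⊗ [g]1)_g and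
counit w ⊗ [g]a ↦ w_g a. Being an equivalence means that unit and counit are bijective. The finite
sums of the diagonal idempotents e_g are local units of R (`exists_idem_smul`) and do the work of a
unit element.

One computation carries the passage between comodules and R-modules. In a direct sum of comodules
[g_j]A, the coordinates of a k-coinvariant vector lie in A_{k,g_j} (`coord_of_mem_coinv`), so they
are entries of matrices in R and can be moved across ⊗_R. Hence a morphism from such a sum to X ⊗_R
Σ takes k-coinvariants to elements x ⊗ [k]1 (`tensorDesc_of_mem_coinv`).

Generator implies equivalence. Flatness of the coring makes kernels into comodules, a generator
makes every comodule the span of its coinvariants, and projectivity lifts coinvariants along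
surjections. The counit is surjective by the spanning property. It is injective because M is covered
by a sum of comodules [g]A, and the coinvariants of the kernel of this cover already die in ⨁ M^{co
g} ⊗_R Σ. The unit is surjective by lifting coinvariants from a sum of comodules [g]A, and injective
by comparing X with a presentation by a free module, where injectivity can be read off from columns
of matrices (`unitMap_injective_of_projective`).

Equivalence implies the rest. The right adjoint preserves epimorphisms, which are surjective for
unital modules, so coinvariants lift and Σ is projective; surjectivity of the counit makes it a
separator. Exactness of - ⊗_R Σ is checked on the coinvariants that span a kernel
(`isFaithfullyFlat_of_isEquivalence`), and S is a direct sum of copies of Σ, one for each column.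
The coinvariants of the coring itself are the elements ag, so the counit at the coring factors as a
surjection onto ℜ(G) followed by `can`; this makes `can` bijective.

Faithful flatness implies equivalence by descent. The coinvariant rows are the kernel of a map
between modules of rows. After tensoring with Σ and using `can`, this map becomes the difference of
ρ ⊗ C and M ⊗ Δ, whose kernel is ρ(M) (`counitMap_bijective_of_flat`). The unit is then bijective by
a triangle identity, since a faithful functor reflects monomorphisms and epimorphisms. Finally,
comodules over ℜ(G) and over the coring are interchangeable when `can` is an isomorphism. -/

noncomputable section

namespace GaloisCoring

open MulOpposite CategoryTheory

/-! ### Functoriality and right exactness of tensor products -/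

namespace BalTensor

section Exactness

variable {R M₁ M₂ M₃ N : Type*} [AddCommGroup M₁] [AddCommGroup M₂] [AddCommGroup M₃]
  [AddCommGroup N] [SMul Rᵐᵒᵖ M₁] [SMul Rᵐᵒᵖ M₂] [SMul Rᵐᵒᵖ M₃] [SMul R N]

/-- Right exactness holds without any unit in R: modulo the image T of the first map, a tensor m ⊗ n
depends only on g(m) and n. This yields a map from M₃ ⊗ N back to the quotient by T, and it composes
with g ⊗ N to the projection. -/
theorem exact_map_id (f : M₁ →+ M₂) (g : M₂ →+ M₃)
    (hf : ∀ (r : R) m, f (op r • m) = op r • f m) (hg : ∀ (r : R) m, g (op r • m) = op r • g m)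
    (hfg : Function.Exact f g) (hs : Function.Surjective g) :
    Function.Exact (map f (AddMonoidHom.id N) hf id_smul)
      (map g (AddMonoidHom.id N) hg id_smul) := by
  intro z
  refine ⟨fun hz => ?_, ?_⟩
  · let T := (map f (AddMonoidHom.id N) hf id_smul).range
    have key (m m' : M₂) (n : N) (h : g m = g m') :
        QuotientAddGroup.mk' T (tmul R m n) = QuotientAddGroup.mk' T (tmul R m' n) := by
      obtain ⟨k, hk⟩ := (hfg (m - m')).1 (by rw [map_sub, h, sub_self])
      refine (QuotientAddGroup.eq_iff_sub_mem).2 ⟨tmul R k n, ?_⟩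
      rw [map_tmul, hk, AddMonoidHom.id_apply, eq_sub_iff_add_eq, ← add_tmul, sub_add_cancel]
    -- The section s is only a map of sets; it becomes additive and balanced after passing to the
    -- quotient by T.
    let s := Function.surjInv hs
    have hs' (m : M₃) : g (s m) = m := Function.surjInv_eq hs m
    let F : M₃ →+ N →+ BalTensor R M₂ N ⧸ T := AddMonoidHom.mk'
      (fun m => (QuotientAddGroup.mk' T).comp (mk R (s m)))
      (fun m m' => by
        ext n
        change QuotientAddGroup.mk' T (tmul R (s (m + m')) n) =
          QuotientAddGroup.mk' T (tmul R (s m) n) + QuotientAddGroup.mk' T (tmul R (s m') n)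
        rw [← map_add, ← add_tmul]
        exact key _ _ _ (by rw [map_add, hs', hs', hs']))
    have hF (m : M₃) (r : R) (n : N) : F (op r • m) n = F m (r • n) := by
      change QuotientAddGroup.mk' T (tmul R (s (op r • m)) n) =
        QuotientAddGroup.mk' T (tmul R (s m) (r • n))
      rw [← balanced]
      exact key _ _ _ (by rw [hg, hs', hs'])
    have h : (lift F hF).comp (map g (AddMonoidHom.id N) hg id_smul) = QuotientAddGroup.mk' T :=
      hom_ext fun m n => key _ _ _ (hs' _)
    have h0 := DFunLike.congr_fun h z
    rw [AddMonoidHom.comp_apply, hz, map_zero] at h0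
    exact (QuotientAddGroup.eq_zero_iff z).1 h0.symm
  · rintro ⟨w, rfl⟩
    refine DFunLike.congr_fun (f := (map g (AddMonoidHom.id N) hg id_smul).comp
      (map f (AddMonoidHom.id N) hf id_smul)) (g := 0) (hom_ext fun m n => ?_) w
    rw [AddMonoidHom.comp_apply, map_tmul, map_tmul, hfg.apply_apply_eq_zero, zero_tmul]
    rfl

end Exactness

section RTensor

variable {A M M' M'' N P : Type*} [Ring A] [AddCommGroup M] [AddCommGroup M'] [AddCommGroup M'']
  [AddCommGroup N] [AddCommGroup P]
  [Module Aᵐᵒᵖ M] [Module Aᵐᵒᵖ M'] [Module Aᵐᵒᵖ M''] [Module A N] [Module Aᵐᵒᵖ N]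
  [SMulCommClass A Aᵐᵒᵖ N] [Module A P] [Module Aᵐᵒᵖ P] [SMulCommClass A Aᵐᵒᵖ P]

variable (N) in
/-- The right linear map `f ⊗_A N`. -/
def rTensor (f : M →ₗ[Aᵐᵒᵖ] M') : BalTensor A M N →ₗ[Aᵐᵒᵖ] BalTensor A M' N :=
  { map (R := A) f.toAddMonoidHom (AddMonoidHom.id N) (fun a => linear_smul f (op a)) id_smul with
    map_smul' := fun a z => by
      change map (R := A) f.toAddMonoidHom (AddMonoidHom.id N) (fun a => linear_smul f (op a))
        id_smul (a • z) = a • map (R := A) f.toAddMonoidHom (AddMonoidHom.id N)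
          (fun a => linear_smul f (op a)) id_smul z
      induction z using ind with
      | zero => rw [smul_zero, map_zero, smul_zero]
      | tmul m n => rfl
      | add x y hx hy => rw [smul_add, map_add, hx, hy, map_add, smul_add] }

@[simp] theorem rTensor_tmul (f : M →ₗ[Aᵐᵒᵖ] M') (m : M) (n : N) :
    rTensor N f (tmul A m n) = tmul A (f m) n := rfl

theorem rTensor_comp (g : M' →ₗ[Aᵐᵒᵖ] M'') (f : M →ₗ[Aᵐᵒᵖ] M') (z : BalTensor A M N) :
    rTensor N (g.comp f) z = rTensor N g (rTensor N f z) :=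
  DFunLike.congr_fun (f := (rTensor N (g.comp f)).toAddMonoidHom)
    (g := ((rTensor N g).comp (rTensor N f)).toAddMonoidHom) (hom_ext fun _ _ => rfl) z

theorem rTensor_id (z : BalTensor A M N) : rTensor N LinearMap.id z = z :=
  DFunLike.congr_fun (f := (rTensor N (LinearMap.id (R := Aᵐᵒᵖ) (M := M))).toAddMonoidHom)
    (g := AddMonoidHom.id _) (hom_ext fun _ _ => rfl) z

theorem exact_rTensor (f : M →ₗ[Aᵐᵒᵖ] M') (g : M' →ₗ[Aᵐᵒᵖ] M'') (h : Function.Exact f g)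
    (hs : Function.Surjective g) : Function.Exact (rTensor N f) (rTensor N g) :=
  exact_map_id f.toAddMonoidHom g.toAddMonoidHom (fun a => linear_smul f (op a))
    (fun a => linear_smul g (op a)) h hs

/-- The additive map `M ⊗_A g`. -/
def lTensor (M : Type*) [AddCommGroup M] [Module Aᵐᵒᵖ M] {N P : Type*} [AddCommGroup N]
    [AddCommGroup P] [Module A N] [Module A P] (g : N →+ P)
    (hg : ∀ (a : A) n, g (a • n) = a • g n) : BalTensor A M N →+ BalTensor A M P :=
  map (AddMonoidHom.id M) g (fun a => id_smul (op a)) hg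

@[simp] theorem lTensor_tmul {M N P : Type*} [AddCommGroup M] [AddCommGroup N] [AddCommGroup P]
    [Module Aᵐᵒᵖ M] [Module A N] [Module A P] (g : N →+ P) (hg : ∀ (a : A) n, g (a • n) = a • g n) (m : M) (n : N) :
    lTensor M g hg (tmul A m n) = tmul A m (g n) := rfl

theorem lTensor_leftInverse {M N P : Type*} [AddCommGroup M] [AddCommGroup N] [AddCommGroup P]
    [Module Aᵐᵒᵖ M] [Module A N] [Module A P] (f : N →+ P) (hf : ∀ (a : A) n, f (a • n) = a • f n)
    (g : P →+ N) (hg : ∀ (a : A) n, g (a • n) = a • g n) (h : ∀ n, g (f n) = n)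
    (z : BalTensor A M N) : lTensor M g hg (lTensor M f hf z) = z := by
  induction z using ind with
  | zero => simp only [map_zero]
  | add x y hx hy => simp only [map_add, hx, hy]
  | tmul m c => rw [lTensor_tmul, lTensor_tmul, h]

theorem lTensor_rTensor (f : M →ₗ[Aᵐᵒᵖ] M') (g : N →+ P) (hg : ∀ (a : A) n, g (a • n) = a • g n)
    (z : BalTensor A M N) :
    lTensor M' g hg (rTensor N f z) = rTensor P f (lTensor M g hg z) :=
  DFunLike.congr_fun (f := (lTensor M' g hg).comp (rTensor N f).toAddMonoidHom)
    (g := (rTensor P f).toAddMonoidHom.comp (lTensor M g hg)) (hom_ext fun _ _ => rfl) z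

theorem assoc_rTensor (f : M →ₗ[Aᵐᵒᵖ] M') (z : BalTensor A (BalTensor A M N) P) :
    assoc (rTensor P (rTensor N f) z) = rTensor (BalTensor A N P) f (assoc z) := by
  induction z using ind with
  | zero => simp only [map_zero]
  | add x y hx hy => simp only [map_add, hx, hy]
  | tmul w p =>
    induction w using ind with
    | zero => simp only [map_zero, zero_tmul]
    | add x y hx hy => simp only [map_add, add_tmul, hx, hy]
    | tmul m n => rfl

theorem rid_rTensor (f : M →ₗ[Aᵐᵒᵖ] M') (z : BalTensor A M A) :
    rid (rTensor A f z) = f (rid z) := by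
  induction z using ind with
  | zero => simp only [map_zero]
  | add x y hx hy => simp only [map_add, hx, hy]
  | tmul m a => rw [rTensor_tmul, rid_tmul, rid_tmul, map_smul]

end RTensor

end BalTensor

/-! ### Morphisms, quotients and kernels of comodules -/

namespace Comod

open BalTensor

variable {A : Type u} [Ring A] {C : Coring A}

/-- The linear map underlying a morphism of comodules. -/
def lin {M N : Comod C} (f : M ⟶ N) : M.carrier →ₗ[Aᵐᵒᵖ] N.carrier := Comod.Hom.toLinearMap f

@[simp] theorem lin_comp {M N P : Comod C} (f : M ⟶ N) (g : N ⟶ P) (m : M.carrier) :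
    lin (f ≫ g) m = lin g (lin f m) := rfl

@[simp] theorem lin_id (M : Comod C) (m : M.carrier) : lin (𝟙 M) m = m := rfl

theorem hom_ext {M N : Comod C} {f g : M ⟶ N} (h : ∀ m, lin f m = lin g m) : f = g :=
  Comod.Hom.ext (LinearMap.ext h)

theorem rTensor_coact {M N : Comod C} (f : M ⟶ N) (m : M.carrier) :
    rTensor C (lin f) (M.coact m) = N.coact (lin f m) := Comod.Hom.comm f m

/-- A morphism of comodules from a linear map. -/
def ofLin {M N : Comod C} (f : M.carrier →ₗ[Aᵐᵒᵖ] N.carrier)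
    (h : ∀ m, rTensor C f (M.coact m) = N.coact (f m)) : M ⟶ N := Comod.Hom.mk f h

theorem isIso_of_bijective {M N : Comod C} (f : M ⟶ N) (hf : Function.Bijective (lin f)) :
    IsIso f := by
  let e := LinearEquiv.ofBijective (lin f) hf
  have h1 (n) : lin f (e.symm n) = n := e.apply_symm_apply n
  have h2 (m) : e.symm (lin f m) = m := e.symm_apply_apply m
  refine ⟨ofLin e.symm.toLinearMap fun n => ?_, hom_ext h2, hom_ext h1⟩
  obtain ⟨m, rfl⟩ := hf.2 n
  rw [← rTensor_coact, ← rTensor_comp]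
  have : e.symm.toLinearMap.comp (lin f) = LinearMap.id := LinearMap.ext h2
  rw [this, rTensor_id]
  exact congrArg M.coact (h2 m).symm

theorem bijective_of_isIso {M N : Comod C} (f : M ⟶ N) [IsIso f] : Function.Bijective (lin f) :=
  Function.bijective_iff_has_inverse.2 ⟨lin (inv f),
    fun m => by rw [← lin_comp, IsIso.hom_inv_id, lin_id],
    fun m => by rw [← lin_comp, IsIso.inv_hom_id, lin_id]⟩

theorem coassoc' (M : Comod C) (m : M.carrier) :
    lTensor M.carrier C.comul C.comul_smul (M.coact m) = assoc (rTensor C M.coact (M.coact m)) :=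
  M.coassoc m

theorem coact_counit' (M : Comod C) (m : M.carrier) :
    rid (lTensor M.carrier C.counit C.counit_smul (M.coact m)) = m :=
  M.coact_counit m

/-- The counit provides a left inverse of the coaction. -/
theorem coact_injective (M : Comod C) : Function.Injective M.coact := fun x y h => by
  rw [← M.coact_counit' x, h, M.coact_counit']

/-- The quotient of a comodule by a submodule whose coaction vanishes in the quotient. -/
def quot (M : Comod C) (N : Submodule Aᵐᵒᵖ M.carrier)
    (hN : ∀ n ∈ N, rTensor C N.mkQ (M.coact n) = 0) : Comod C :=
  let σ : (M.carrier ⧸ N) →ₗ[Aᵐᵒᵖ] BalTensor A (M.carrier ⧸ N) C :=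
    N.liftQ ((rTensor C N.mkQ).comp M.coact) hN
  have hσ (m : M.carrier) : σ (N.mkQ m) = rTensor C N.mkQ (M.coact m) := rfl
  { carrier := M.carrier ⧸ N
    coact := σ
    coassoc := fun q => by
      obtain ⟨m, rfl⟩ := N.mkQ_surjective q
      change lTensor _ C.comul C.comul_smul (σ (N.mkQ m)) = assoc (rTensor C σ (σ (N.mkQ m)))
      rw [hσ, lTensor_rTensor, coassoc', ← assoc_rTensor, ← rTensor_comp, ← rTensor_comp]
      rfl
    coact_counit := fun q => by
      obtain ⟨m, rfl⟩ := N.mkQ_surjective q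
      change rid (lTensor _ C.counit C.counit_smul (σ (N.mkQ m))) = _
      rw [hσ, lTensor_rTensor, rid_rTensor, coact_counit'] }

/-- The projection onto the quotient comodule. -/
def quotMk (M : Comod C) (N : Submodule Aᵐᵒᵖ M.carrier)
    (hN : ∀ n ∈ N, rTensor C N.mkQ (M.coact n) = 0) : M ⟶ M.quot N hN :=
  ofLin N.mkQ fun _ => rfl

theorem rTensor_injective (hC : C.IsLeftFlat) {M N : Type u} [AddCommGroup M] [AddCommGroup N]
    [Module Aᵐᵒᵖ M] [Module Aᵐᵒᵖ N] (f : M →ₗ[Aᵐᵒᵖ] N) (hf : Function.Injective f) :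
    Function.Injective (rTensor C f) := hC M N f hf

/-- The map f is factored through its image: right exactness handles the surjection onto the image,
and flatness keeps the inclusion of the image injective after tensoring. So the kernel of f ⊗ C
comes from ker f ⊗ C, and it contains ρ(m) by colinearity. -/
theorem exists_rTensor_ker (hC : C.IsLeftFlat) {M N : Comod C} (f : M ⟶ N) (m : LinearMap.ker (lin f)) :
    ∃ z, rTensor C (LinearMap.ker (lin f)).subtype z = M.coact m := by
  refine (exact_rTensor (N := C) (LinearMap.ker (lin f)).subtype (lin f).rangeRestrict ?_
    (lin f).surjective_rangeRestrict _).1 ?_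
  · intro x
    rw [Subtype.ext_iff]
    exact ⟨fun h => ⟨⟨x, h⟩, rfl⟩, fun ⟨y, hy⟩ => hy ▸ y.2⟩
  · refine rTensor_injective hC (LinearMap.range (lin f)).subtype
      (Submodule.injective_subtype _) ?_
    rw [← rTensor_comp, map_zero]
    change rTensor C (lin f) (M.coact m) = 0
    rw [rTensor_coact, m.2, map_zero]

/-- The coaction of the kernel of a morphism. -/
def kerCoact (hC : C.IsLeftFlat) {M N : Comod C} (f : M ⟶ N) : LinearMap.ker (lin f) →ₗ[Aᵐᵒᵖ] BalTensor A (LinearMap.ker (lin f)) C :=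
  (LinearEquiv.ofInjective (rTensor C (LinearMap.ker (lin f)).subtype)
    (rTensor_injective hC _ (Submodule.injective_subtype _))).symm.toLinearMap.comp
  ((M.coact.comp (LinearMap.ker (lin f)).subtype).codRestrict _ (exists_rTensor_ker hC f))

theorem rTensor_kerCoact (hC : C.IsLeftFlat) {M N : Comod C} (f : M ⟶ N) (m : LinearMap.ker (lin f)) :
    rTensor C (LinearMap.ker (lin f)).subtype (kerCoact hC f m) = M.coact m :=
  congrArg Subtype.val (LinearEquiv.apply_symm_apply
    (LinearEquiv.ofInjective (rTensor C (LinearMap.ker (lin f)).subtype)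
      (rTensor_injective hC _ (Submodule.injective_subtype _))) ⟨M.coact m, exists_rTensor_ker hC f m⟩)

/-- The kernel of a morphism of comodules. -/
def ker (hC : C.IsLeftFlat) {M N : Comod C} (f : M ⟶ N) : Comod C :=
  { carrier := LinearMap.ker (lin f)
    coact := kerCoact hC f
    coassoc := fun m => by
      change lTensor _ C.comul C.comul_smul (kerCoact hC f m) =
        assoc (rTensor C (kerCoact hC f) (kerCoact hC f m))
      rw [← assoc.symm.injective.eq_iff, AddEquiv.symm_apply_apply]
      -- By flatness, used twice, coassociativity may be tested in M ⊗ C ⊗ C, where it is that of M.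
      refine rTensor_injective hC (rTensor C (LinearMap.ker (lin f)).subtype)
        (rTensor_injective hC _ (Submodule.injective_subtype _)) (assoc.injective ?_)
      rw [assoc_rTensor, AddEquiv.apply_symm_apply, ← lTensor_rTensor, rTensor_kerCoact,
        coassoc', ← rTensor_comp, ← rTensor_kerCoact hC f m, ← rTensor_comp]
      congr 2
      congr 1
      exact LinearMap.ext fun m => (rTensor_kerCoact hC f m).symm
    coact_counit := fun m => by
      change rid (lTensor _ C.counit C.counit_smul (kerCoact hC f m)) = m
      refine Subtype.ext ?_
      change (LinearMap.ker (lin f)).subtype _ = _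
      rw [← rid_rTensor, ← lTensor_rTensor, rTensor_kerCoact, coact_counit'] }

theorem kerCoact_eq (hC : C.IsLeftFlat) {M N : Comod C} (f : M ⟶ N) {m : LinearMap.ker (lin f)}
    {g : C} (h : M.coact m = tmul A (m : M.carrier) g) : kerCoact hC f m = tmul A m g := by
  refine rTensor_injective hC (LinearMap.ker (lin f)).subtype (Submodule.injective_subtype _) ?_
  rw [rTensor_tmul, rTensor_kerCoact, h]
  rfl

/-- The inclusion of the kernel. -/
def kerι (hC : C.IsLeftFlat) {M N : Comod C} (f : M ⟶ N) : ker hC f ⟶ M := ofLin (LinearMap.ker (lin f)).subtype (rTensor_kerCoact hC f)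

end Comod

/-! ### Coinvariants -/

/-- The coefficient of `[i]`. -/
def FreeSum.coord {I A : Type u} [Ring A] (i : I) : FreeSum I A →+ A := Finsupp.applyAddHom i

open Classical in
theorem FreeSum.coord_of {I A : Type u} [Ring A] (i j : I) (a : A) :
    FreeSum.coord i (FreeSum.of j a) = if j = i then a else 0 :=
  Finsupp.single_apply

theorem FreeSum.eq_sum {I A : Type u} [Ring A] (v : FreeSum I A) :
    ∃ s : Finset I, v = ∑ i ∈ s, FreeSum.of i (FreeSum.coord i v) :=
  ⟨Finsupp.support (v : I →₀ A), (Finsupp.sum_single (v : I →₀ A)).symm⟩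

namespace Comod

open BalTensor

variable {A : Type u} [Ring A] {C : Coring A}

/-- The coinvariants `{m | ρ(m) = m ⊗ g}` of a comodule with respect to `g`. -/
def coinv (M : Comod C) (g : C) : AddSubgroup M.carrier where
  carrier := {m | M.coact m = tmul A m g}
  zero_mem' := by simp
  add_mem' {a b} (ha : _ = _) (hb : _ = _) := by
    change _ = _
    rw [map_add, ha, hb, add_tmul]
  neg_mem' {a} (ha : _ = _) := by
    change _ = BalTensor.mk A (-a) g
    rw [map_neg, ha, map_neg]
    rfl

theorem mem_coinv {M : Comod C} {g : C} {m : M.carrier} :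
    m ∈ M.coinv g ↔ M.coact m = tmul A m g := Iff.rfl

theorem lin_mem_coinv {M N : Comod C} (f : M ⟶ N) {g : C} {m : M.carrier} (hm : m ∈ M.coinv g) :
    lin f m ∈ N.coinv g := by
  rw [mem_coinv, ← rTensor_coact, mem_coinv.1 hm, rTensor_tmul]

/-- The source of the right R-action on families of coinvariants: in mb ⊗ g the scalar b passes to
the right factor, where bg = hb. -/
theorem op_smul_mem_coinv {M : Comod C} {g h : C} {b : A} (hb : op b • h = b • g) {m : M.carrier}
    (hm : m ∈ M.coinv h) : op b • m ∈ M.coinv g := by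
  rw [mem_coinv, map_smul, mem_coinv.1 hm, op_smul_tmul, hb, balanced]

/-- The right linear map `[j]a ↦ m_j a`. -/
def sigmaLin {J M : Type u} [AddCommGroup M] [Module Aᵐᵒᵖ M] (m : J → M) :
    FreeSum J A →ₗ[Aᵐᵒᵖ] M :=
  { FreeSum.lift fun j => AddMonoidHom.mk' (fun a => op a • m j) fun a b => op_add_smul_right a b _
    with
    map_smul' := fun a v => by
      change FreeSum.lift _ (a • v) = a • FreeSum.lift _ v
      induction v using FreeSum.ind with
      | zero => rw [smul_zero, map_zero, smul_zero]
      | add x y hx hy => rw [smul_add, map_add, hx, hy, map_add, smul_add]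
      | of i b =>
        rw [FreeSum.op_smul_of, FreeSum.lift_of, FreeSum.lift_of]
        exact mul_smul a (op b) (m i) }

@[simp] theorem sigmaLin_of {J M : Type u} [AddCommGroup M] [Module Aᵐᵒᵖ M] (m : J → M) (j : J)
    (a : A) : sigmaLin m (FreeSum.of j a) = op a • m j := FreeSum.lift_of _ _ _

variable {J : Type u} {δ : J → C} (hδ : ∀ j, C.IsGrouplike (δ j))

/-- The element `[j]a` of the comodule `Σ`. -/
def sigmaOf (j : J) : A →+ (sigma C hδ).carrier := FreeSum.of j

/-- The coefficient of `[j]`, as a function on the comodule `Σ`. -/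
def sigmaCoord (j : J) : (sigma C hδ).carrier →+ A := FreeSum.coord j

open Classical in
theorem sigmaCoord_sigmaOf (i j : J) (a : A) :
    sigmaCoord hδ i (sigmaOf hδ j a) = if j = i then a else 0 := FreeSum.coord_of i j a

theorem sigmaOf_eq_sum (v : (sigma C hδ).carrier) :
    ∃ s : Finset J, v = ∑ i ∈ s, sigmaOf hδ i (sigmaCoord hδ i v) := FreeSum.eq_sum v

theorem op_smul_sigmaOf (j : J) (a b : A) :
    op b • sigmaOf hδ j a = sigmaOf hδ j (a * b) := FreeSum.op_smul_of j (op b) a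

theorem sigmaOf_eq_smul (j : J) (a : A) : sigmaOf hδ j a = op a • sigmaOf hδ j 1 := by
  rw [op_smul_sigmaOf, one_mul]

@[elab_as_elim]
theorem sigma_ind {p : (sigma C hδ).carrier → Prop} (v : (sigma C hδ).carrier) (zero : p 0)
    (of : ∀ j a, p (sigmaOf hδ j a)) (add : ∀ x y, p x → p y → p (x + y)) : p v :=
  FreeSum.ind (p := p) v zero of add

theorem sigma_coact_of (j : J) (a : A) : (sigma C hδ).coact (sigmaOf hδ j a) =
    tmul A (sigmaOf hδ j 1) (op a • δ j) := sigmaCoact_of C δ j a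

/-- The morphism `Σ → M`, `[j]a ↦ m_j a`, given by a family of coinvariants. -/
def sigmaDesc {M : Comod C} (m : J → M.carrier) (hm : ∀ j, m j ∈ M.coinv (δ j)) :
    sigma C hδ ⟶ M :=
  let f : (sigma C hδ).carrier →ₗ[Aᵐᵒᵖ] M.carrier := sigmaLin m
  have hf (j : J) (a : A) : f (sigmaOf hδ j a) = op a • m j := sigmaLin_of m j a
  ofLin f fun v => by
    induction v using sigma_ind with
    | zero => simp only [map_zero]
    | add x y hx hy => simp only [map_add, hx, hy]
    | of i a =>
      rw [sigma_coact_of, rTensor_tmul, hf, hf, map_smul, mem_coinv.1 (hm i),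
        op_one, one_smul, op_smul_tmul]

@[simp] theorem sigmaDesc_of {M : Comod C} (m : J → M.carrier) (hm : ∀ j, m j ∈ M.coinv (δ j))
    (j : J) (a : A) : lin (sigmaDesc hδ m hm) (sigmaOf hδ j a) = op a • m j :=
  sigmaLin_of m j a

/-- The universal coinvariants; together with `sigmaDesc` they identify morphisms out of Σ with
families of coinvariants. -/
theorem of_one_mem_coinv (j : J) : sigmaOf hδ j 1 ∈ (sigma C hδ).coinv (δ j) := by
  rw [mem_coinv, sigma_coact_of, op_one, one_smul]

/-- The link between coinvariants and the ring R: the coordinates of a coinvariant vector are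
admissible matrix entries. The family δ may have repetitions, which allows arbitrary sums of
comodules of the form [g]A. -/
theorem coord_of_mem_coinv {g : C} {v : (sigma C hδ).carrier} (hv : v ∈ (sigma C hδ).coinv g)
    (j : J) : op (sigmaCoord hδ j v) • δ j = sigmaCoord hδ j v • g := by
  -- The map p : v ⊗ c ↦ v_j c is applied to both sides of ρ(v) = v ⊗ g.
  let p : BalTensor A (sigma C hδ).carrier C →+ C := BalTensor.lift
    (AddMonoidHom.mk' (fun v => DistribSMul.toAddMonoidHom C (sigmaCoord hδ j v))
      (fun v w => by ext c; simp [add_smul]))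
    (fun v a c => by
      change sigmaCoord hδ j (op a • v) • c = sigmaCoord hδ j v • a • c
      rw [smul_smul]
      rfl)
  have hp' (v) (c : C) : p (tmul A v c) = sigmaCoord hδ j v • c := rfl
  have hp (v) : p ((sigma C hδ).coact v) = op (sigmaCoord hδ j v) • δ j := by
    induction v using sigma_ind with
    | zero => simp only [map_zero, op_zero, zero_smul]
    | add x y hx hy => rw [map_add, map_add, hx, hy, map_add, op_add_smul_right]
    | of i a =>
      rw [sigma_coact_of, hp', sigmaCoord_sigmaOf, sigmaCoord_sigmaOf]
      split_ifs with h
      · rw [h, one_smul]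
      · rw [zero_smul, op_zero, zero_smul]
  rw [← hp, mem_coinv.1 hv, hp']

theorem epi_of_surjective {M N : Comod C} (f : M ⟶ N) (hf : Function.Surjective (lin f)) :
    Epi f := ⟨fun g h e => hom_ext fun n => by
      obtain ⟨m, rfl⟩ := hf n
      rw [← lin_comp, e, lin_comp]⟩

/-- The coinvariant n defines the morphism Σ → N with [j]1 ↦ n that vanishes on the other basis
vectors; the image of [j]1 under a factorization through f is the lift. -/
theorem exists_coinv_lift [Projective (sigma C hδ)] {M N : Comod C} (f : M ⟶ N)
    (hf : Function.Surjective (lin f)) (j : J) {n : N.carrier} (hn : n ∈ N.coinv (δ j)) :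
    ∃ m ∈ M.coinv (δ j), lin f m = n := by
  classical
  have := epi_of_surjective f hf
  let t : sigma C hδ ⟶ N := sigmaDesc hδ (fun i => if i = j then n else 0) fun i => by
    split_ifs with h
    · exact h ▸ hn
    · exact zero_mem _
  refine ⟨lin (Projective.factorThru t f) (sigmaOf hδ j 1),
    lin_mem_coinv _ (of_one_mem_coinv hδ j), ?_⟩
  rw [← lin_comp, Projective.factorThru_comp, sigmaDesc_of, if_pos rfl, op_one, one_smul]

/-- The coaction of a coinvariant m is m ⊗ g, so it dies when m does, and the quotient of M by the
span is a comodule. Each morphism Σ → M has its image in the span, so a separator cannot distinguish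
the projection to this quotient from zero. -/
theorem span_coinv_eq_top (hs : IsSeparator (sigma C hδ)) (M : Comod C) :
    Submodule.span Aᵐᵒᵖ {m | ∃ j, m ∈ M.coinv (δ j)} = ⊤ := by
  set N := Submodule.span Aᵐᵒᵖ {m | ∃ j, m ∈ M.coinv (δ j)} with hN
  have h0 : ∀ n ∈ N, rTensor C N.mkQ (M.coact n) = 0 := fun n hn => by
    refine (LinearMap.mem_ker (f := (rTensor C N.mkQ).comp M.coact)).1
      (Submodule.span_le.2 ?_ hn)
    rintro m ⟨j, hm⟩
    change rTensor C N.mkQ (M.coact m) = 0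
    rw [mem_coinv.1 hm, rTensor_tmul, Submodule.mkQ_apply,
      (Submodule.Quotient.mk_eq_zero N).2 (Submodule.subset_span ⟨j, hm⟩), zero_tmul]
  have h1 : M.quotMk N h0 = ofLin 0 (fun m => by
      have : rTensor C (0 : M.carrier →ₗ[Aᵐᵒᵖ] (M.quot N h0).carrier) (M.coact m) = 0 := by
        generalize M.coact m = z
        induction z using BalTensor.ind with
        | zero => rw [map_zero]
        | add x y hx hy => rw [map_add, hx, hy, add_zero]
        | tmul m c => rw [rTensor_tmul, LinearMap.zero_apply, zero_tmul]
      rw [this, LinearMap.zero_apply, map_zero]) := by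
    refine (isSeparator_def _).1 hs _ _ fun t => hom_ext fun v => ?_
    rw [lin_comp, lin_comp]
    induction v using sigma_ind with
    | zero => simp only [map_zero]
    | add x y hx hy => simp only [map_add, hx, hy]
    | of j a =>
      rw [sigmaOf_eq_smul]
      simp only [map_smul]
      congr 1
      exact (Submodule.Quotient.mk_eq_zero N).2
        (Submodule.subset_span ⟨j, lin_mem_coinv t (of_one_mem_coinv hδ j)⟩)
  refine eq_top_iff.2 fun m _ => (Submodule.Quotient.mk_eq_zero N).1 ?_
  exact congrArg (fun f => lin f m) h1

theorem mem_coinv_ker (hC : C.IsLeftFlat) {M N : Comod C} (f : M ⟶ N) {g : C} {m : M.carrier}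
    (hm : m ∈ M.coinv g) (h : lin f m = 0) :
    ∃ l ∈ (ker hC f).coinv g, lin (kerι hC f) l = m :=
  ⟨⟨m, h⟩, kerCoact_eq hC f hm, rfl⟩

theorem kerι_lin (hC : C.IsLeftFlat) {M N : Comod C} (f : M ⟶ N) (l : (ker hC f).carrier) :
    lin f (lin (kerι hC f) l) = 0 := Subtype.property (p := (· ∈ LinearMap.ker (lin f))) l

theorem kerι_injective (hC : C.IsLeftFlat) {M N : Comod C} (f : M ⟶ N) :
    Function.Injective (lin (kerι hC f)) := Submodule.injective_subtype _

theorem exists_kerι (hC : C.IsLeftFlat) {M N : Comod C} (f : M ⟶ N) (m : M.carrier)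
    (h : lin f m = 0) : ∃ l, lin (kerι hC f) l = m := ⟨⟨m, h⟩, rfl⟩

end Comod

/-! ### Unital modules over the ring `R` -/

namespace UnitalMod

variable {R : Type u} [NonUnitalRing R]

/-- The additive map underlying a homomorphism of unital modules. -/
def fn {X Y : UnitalMod R} (f : X ⟶ Y) : X.carrier →+ Y.carrier := UnitalMod.Hom.toFun f

theorem fn_smul {X Y : UnitalMod R} (f : X ⟶ Y) (r : R) (x : X.carrier) :
    fn f (op r • x) = op r • fn f x := UnitalMod.Hom.map_smul f r x

/-- A homomorphism of unital modules from an additive map. -/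
def ofFn {X Y : UnitalMod R} (f : X.carrier →+ Y.carrier)
    (h : ∀ (r : R) x, f (op r • x) = op r • f x) : X ⟶ Y := UnitalMod.Hom.mk f h

@[simp] theorem fn_comp {X Y Z : UnitalMod R} (f : X ⟶ Y) (g : Y ⟶ Z) (x : X.carrier) :
    fn (f ≫ g) x = fn g (fn f x) := rfl

@[simp] theorem fn_id (X : UnitalMod R) (x : X.carrier) : fn (𝟙 X) x = x := rfl

theorem hom_ext {X Y : UnitalMod R} {f g : X ⟶ Y} (h : ∀ x, fn f x = fn g x) : f = g :=
  UnitalMod.Hom.ext (DFunLike.ext _ _ h)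

/-- The action of an element of `R` as an additive map. -/
def smulHom (X : UnitalMod R) (r : R) : X.carrier →+ X.carrier :=
  AddMonoidHom.mk' (fun x => op r • x) (X.smul_add r)

theorem op_smul_zero (X : UnitalMod R) (r : R) : op r • (0 : X.carrier) = 0 := map_zero (smulHom X r)

theorem op_smul_neg (X : UnitalMod R) (r : R) (x : X.carrier) : op r • (-x) = -(op r • x) :=
  map_neg (smulHom X r) x

theorem op_zero_smul (X : UnitalMod R) (x : X.carrier) : op (0 : R) • x = 0 := by
  have h := X.add_smul 0 0 x
  rwa [add_zero, left_eq_add] at h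

theorem isIso_of_bijective {X Y : UnitalMod R} (f : X ⟶ Y) (hf : Function.Bijective (fn f)) :
    IsIso f := by
  let e := AddEquiv.ofBijective (fn f) hf
  have h1 (n) : fn f (e.symm n) = n := e.apply_symm_apply n
  have h2 (m) : e.symm (fn f m) = m := e.symm_apply_apply m
  refine ⟨ofFn e.symm.toAddMonoidHom fun r y => hf.1 ?_, hom_ext h2, hom_ext h1⟩
  rw [fn_smul]
  exact (h1 _).trans (congrArg (op r • ·) (h1 y).symm)

theorem bijective_of_isIso {X Y : UnitalMod R} (f : X ⟶ Y) [IsIso f] :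
    Function.Bijective (fn f) :=
  Function.bijective_iff_has_inverse.2 ⟨fn (inv f),
    fun m => by rw [← fn_comp, IsIso.hom_inv_id, fn_id],
    fun m => by rw [← fn_comp, IsIso.inv_hom_id, fn_id]⟩

/-- The quotient of a unital module by a submodule. -/
def quot (X : UnitalMod R) (N : AddSubgroup X.carrier) (hN : ∀ (r : R), ∀ x ∈ N, op r • x ∈ N) :
    UnitalMod R :=
  let act (r : R) : X.carrier ⧸ N →+ X.carrier ⧸ N :=
    QuotientAddGroup.map N N (smulHom X r) (hN r)
  { carrier := X.carrier ⧸ N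
    smul := ⟨fun r x => act r.unop x⟩
    smul_add := fun r x y => map_add (act r) x y
    add_smul := fun r s x => by
      obtain ⟨x, rfl⟩ := QuotientAddGroup.mk_surjective x
      exact congrArg (QuotientAddGroup.mk' N) (X.add_smul r s x)
    mul_smul := fun r s x => by
      obtain ⟨x, rfl⟩ := QuotientAddGroup.mk_surjective x
      exact congrArg (QuotientAddGroup.mk' N) (X.mul_smul r s x)
    unital := by
      refine eq_top_iff.2 fun x _ => ?_
      obtain ⟨x, rfl⟩ := QuotientAddGroup.mk_surjective x
      have hx : x ∈ AddSubgroup.closure {x : X.carrier | ∃ (y : X.carrier) (r : R), x = op r • y} :=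
        X.unital ▸ AddSubgroup.mem_top x
      refine (AddSubgroup.closure_le (K := AddSubgroup.comap (QuotientAddGroup.mk' N)
        (AddSubgroup.closure _))).2 ?_ hx
      rintro _ ⟨y, r, rfl⟩
      exact AddSubgroup.subset_closure ⟨QuotientAddGroup.mk' N y, r, rfl⟩ }

/-- The projection to the cokernel is compared with the zero map; quotients of unital modules are
unital. -/
theorem surjective_of_epi {X Y : UnitalMod R} (f : X ⟶ Y) [Epi f] : Function.Surjective (fn f) := by
  have hN : ∀ (r : R), ∀ y ∈ (fn f).range, op r • y ∈ (fn f).range := by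
    rintro r _ ⟨x, rfl⟩
    exact ⟨op r • x, fn_smul f r x⟩
  let q : Y ⟶ Y.quot _ hN := ofFn (QuotientAddGroup.mk' (fn f).range) fun _ _ => rfl
  let z : Y ⟶ Y.quot _ hN := ofFn 0 fun r _ => (op_smul_zero _ r).symm
  have h : q = z := by
    rw [← cancel_epi f]
    exact hom_ext fun x => (QuotientAddGroup.eq_zero_iff (fn f x)).2 ⟨x, rfl⟩
  exact fun y => (QuotientAddGroup.eq_zero_iff y).1 (congrArg (fun g => fn g y) h)

end UnitalMod

/-! ### Elementary matrices and local units in the ring R -/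

section MatRing

variable {A : Type u} [Ring A] {C : Coring A} {I : Type u} {γ : I → C}

/-- The matrix with the entry `b` of `A_{g,h}`, `g = γ j`, `h = γ i`, in row `i` and column `j`. -/
def matUnit {i j : I} {b : A} (hb : op b • γ i = b • γ j) : matRing C γ :=
  ⟨FinMat.single i j b, fun h g => by
    classical
    rw [FinMat.entry_single]
    split_ifs with e
    · rw [e.1, e.2, hb]
    · rw [op_zero, zero_smul, zero_smul]⟩

variable (C γ) in
/-- The idempotent with `1` in row and column `i`. -/
def matIdem (i : I) : matRing C γ :=
  matUnit (b := 1) (i := i) (j := i) (by rw [op_one, one_smul, one_smul])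

theorem matUnit_mul_matIdem {i j : I} {b : A} (hb : op b • γ i = b • γ j) :
    matUnit hb * matIdem C γ j = matUnit hb := by
  refine Subtype.ext ?_
  change FinMat.mul (FinMat.single i j b) (FinMat.single j j 1) = FinMat.single i j b
  rw [FinMat.mul_single_single, if_pos rfl, mul_one]

theorem matUnit_mul_matIdem_of_ne {i j k : I} {b : A} (hb : op b • γ i = b • γ j) (h : k ≠ j) :
    matUnit hb * matIdem C γ k = 0 := by
  refine Subtype.ext ?_
  change FinMat.mul (FinMat.single i j b) (FinMat.single k k 1) = 0
  rw [FinMat.mul_single_single, if_neg h.symm]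

open Classical in
theorem matUnit_smul_of {i j : I} {b : A} (hb : op b • γ i = b • γ j) (k : I) (a : A) :
    matUnit hb • (FreeSum.of k a : FreeSum I A) = if j = k then FreeSum.of i (b * a) else 0 :=
  FinMat.act_single_of i j k b a

@[elab_as_elim]
theorem matRing_induction {p : matRing C γ → Prop} (r : matRing C γ) (zero : p 0)
    (unit : ∀ (i j : I) (b : A) (hb : op b • γ i = b • γ j), p (matUnit hb))
    (add : ∀ x y, p x → p y → p (x + y)) : p r := by
  obtain ⟨M, hM⟩ := r
  refine (matRing_ind (p := fun M => ∃ h : M ∈ matRing C γ, p ⟨M, h⟩) hM ⟨zero_mem _, zero⟩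
    (fun i j b hb => ⟨(matUnit hb).2, unit i j b hb⟩) ?_).2
  rintro x y ⟨hx, hpx⟩ ⟨hy, hpy⟩
  exact ⟨add_mem hx hy, add _ _ hpx hpy⟩

namespace UnitalMod

/-- Finite sums of diagonal idempotents are local units of R, so they fix the elements of unital
modules. Asking this of all larger index sets lets the union of two sets serve a sum of two
elements. -/
theorem exists_idem_smul (X : UnitalMod (matRing C γ)) (x : X.carrier) :
    ∃ F : Finset I, ∀ F', F ⊆ F' → op (∑ i ∈ F', matIdem C γ i) • x = x := by
  classical
  have hx : x ∈ AddSubgroup.closure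
      {x : X.carrier | ∃ (y : X.carrier) (r : matRing C γ), x = op r • y} :=
    X.unital ▸ AddSubgroup.mem_top x
  induction hx using AddSubgroup.closure_induction with
  | zero => exact ⟨∅, fun F' _ => op_smul_zero X _⟩
  | add x y _ _ hx hy =>
    obtain ⟨F, hF⟩ := hx
    obtain ⟨F₁, hF₁⟩ := hy
    refine ⟨F ∪ F₁, fun F' h => ?_⟩
    rw [X.smul_add, hF _ (Finset.union_subset_left h), hF₁ _ (Finset.union_subset_right h)]
  | neg x _ hx =>
    obtain ⟨F, hF⟩ := hx
    exact ⟨F, fun F' h => by rw [op_smul_neg, hF _ h]⟩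
  | mem x hx =>
    obtain ⟨y, r, rfl⟩ := hx
    suffices ∃ F : Finset I, ∀ F', F ⊆ F' → r * (∑ i ∈ F', matIdem C γ i) = r by
      obtain ⟨F, hF⟩ := this
      exact ⟨F, fun F' h => by rw [← X.mul_smul, hF _ h]⟩
    induction r using matRing_induction with
    | zero => exact ⟨∅, fun F' _ => zero_mul _⟩
    | add x y hx hy =>
      obtain ⟨F, hF⟩ := hx
      obtain ⟨F₁, hF₁⟩ := hy
      refine ⟨F ∪ F₁, fun F' h => ?_⟩
      rw [add_mul, hF _ (Finset.union_subset_left h), hF₁ _ (Finset.union_subset_right h)]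
    | unit i j b hb =>
      refine ⟨{j}, fun F' h => ?_⟩
      rw [Finset.mul_sum, Finset.sum_eq_single j (fun k _ hk => matUnit_mul_matIdem_of_ne hb hk)
        (fun hj => absurd (Finset.singleton_subset_iff.1 h) hj), matUnit_mul_matIdem]

theorem exists_eq_sum (X : UnitalMod (matRing C γ)) (x : X.carrier) :
    ∃ F : Finset I, x = ∑ i ∈ F, op (matIdem C γ i) • x := by
  classical
  obtain ⟨F, hF⟩ := X.exists_idem_smul x
  refine ⟨F, (hF F subset_rfl).symm.trans ?_⟩
  clear hF
  induction F using Finset.induction_on with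
  | empty => exact op_zero_smul X x
  | insert i F hi h => rw [Finset.sum_insert hi, Finset.sum_insert hi, X.add_smul, h]

theorem eq_zero_of_matIdem_smul (X : UnitalMod (matRing C γ)) {x : X.carrier}
    (h : ∀ i, op (matIdem C γ i) • x = 0) : x = 0 := by
  obtain ⟨F, hF⟩ := X.exists_eq_sum x
  rw [hF, Finset.sum_eq_zero fun i _ => h i]

/-- A submodule of a unital module over the ring `R`. -/
def sub (X : UnitalMod (matRing C γ)) (N : AddSubgroup X.carrier)
    (hN : ∀ (r : matRing C γ), ∀ x ∈ N, op r • x ∈ N) : UnitalMod (matRing C γ) :=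
  { carrier := N
    smul := ⟨fun r x => ⟨op r.unop • x, hN r.unop x x.2⟩⟩
    smul_add := fun r x y => Subtype.ext (X.smul_add r x y)
    add_smul := fun r s x => Subtype.ext (X.add_smul r s x)
    mul_smul := fun r s x => Subtype.ext (X.mul_smul r s x)
    unital := by
      refine eq_top_iff.2 fun x _ => AddSubgroup.subset_closure ?_
      -- A local unit that fixes x in the ambient module exhibits x as a product inside the
      -- submodule, so submodules are again unital.
      obtain ⟨F, hF⟩ := X.exists_idem_smul x
      exact ⟨x, _, Subtype.ext (hF F subset_rfl).symm⟩ }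

/-- The inclusion of a submodule. -/
def subι (X : UnitalMod (matRing C γ)) (N : AddSubgroup X.carrier)
    (hN : ∀ (r : matRing C γ), ∀ x ∈ N, op r • x ∈ N) : X.sub N hN ⟶ X :=
  ofFn N.subtype fun _ _ => rfl

theorem ker_closed {X Y : UnitalMod (matRing C γ)} (f : X ⟶ Y) (r : matRing C γ) (x : X.carrier)
    (hx : x ∈ (fn f).ker) : op r • x ∈ (fn f).ker := by
  rw [AddMonoidHom.mem_ker, fn_smul, (AddMonoidHom.mem_ker).1 hx, op_smul_zero]

/-- The kernel is a unital module because R has local units; its inclusion and the zero map agree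
after composition with f. -/
theorem injective_of_mono {X Y : UnitalMod (matRing C γ)} (f : X ⟶ Y) [Mono f] :
    Function.Injective (fn f) := by
  let z : X.sub (fn f).ker (ker_closed f) ⟶ X := ofFn 0 fun r _ => (op_smul_zero _ r).symm
  have h : X.subι (fn f).ker (ker_closed f) = z := by
    rw [← cancel_mono f]
    exact hom_ext fun x => x.2.trans (map_zero (fn f)).symm
  refine (injective_iff_map_eq_zero (fn f)).2 fun x hx => ?_
  exact congrArg (fun g : X.sub (fn f).ker (ker_closed f) ⟶ X => fn g ⟨x, hx⟩) h

end UnitalMod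

-- Both sides are additive in the matrix and in the column, so balancedness over R needs to be
-- checked only on elementary matrices and multiples of basis vectors. The maps out of X ⊗_R Σ below
-- are constructed in this way.
open Classical in
theorem balanced_of_matUnit {X : UnitalMod (matRing C γ)} {P : Type*} [AddCommGroup P]
    (f : X.carrier →+ FreeSum I A →+ P)
    (h : ∀ (i j : I) (b : A) (hb : op b • γ i = b • γ j) (x : X.carrier) (k : I) (a : A),
      f (op (matUnit hb) • x) (FreeSum.of k a) = if j = k then f x (FreeSum.of i (b * a)) else 0)
    (x : X.carrier) (r : matRing C γ) (v : FreeSum I A) : f (op r • x) v = f x (r • v) := by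
  induction r using matRing_induction with
  | zero =>
    have : (0 : matRing C γ) • v = 0 := DFunLike.congr_fun (map_zero FinMat.act) v
    rw [UnitalMod.op_zero_smul, this, map_zero, map_zero]
    rfl
  | add r s hr hs =>
    have : (r + s) • v = r • v + s • v :=
      DFunLike.congr_fun (map_add FinMat.act (r : FinMat I A) s) v
    rw [UnitalMod.add_smul, this, map_add, map_add, AddMonoidHom.add_apply, hr, hs]
  | unit i j b hb =>
    induction v using FreeSum.ind with
    | zero =>
      have : matUnit hb • (0 : FreeSum I A) = 0 := map_zero (FinMat.act _)
      rw [this, map_zero, map_zero]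
    | add v w hv hw =>
      have : matUnit hb • (v + w) = matUnit hb • v + matUnit hb • w :=
        map_add (FinMat.act _) v w
      rw [this, map_add, map_add, hv, hw]
    | of k a =>
      rw [matUnit_smul_of, h, apply_ite (f x), map_zero]

end MatRing

/-! ### The right adjoint of `- ⊗_R Σ` -/

section RowMod

variable {A : Type u} [Ring A] {C : Coring A} {I : Type u} {γ : I → C}
  {M N : Type u} [AddCommGroup M] [Module Aᵐᵒᵖ M] [AddCommGroup N] [Module Aᵐᵒᵖ N]

/-- The right action of matrices on rows with entries in a right `A`-module. -/
def rowAct : FinMat I A →+ (I →₀ M) →+ (I →₀ M) :=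
  FinMat.lift fun i j => AddMonoidHom.mk'
    (fun b => ((Finsupp.singleAddHom j).comp (DistribSMul.toAddMonoidHom M (op b))).comp
      (Finsupp.applyAddHom i))
    (fun a b => AddMonoidHom.ext fun w => by
      change Finsupp.single j (op (a + b) • w i) =
        Finsupp.single j (op a • w i) + Finsupp.single j (op b • w i)
      rw [op_add_smul_right, Finsupp.single_add])

@[simp] theorem rowAct_single (i j : I) (b : A) (w : I →₀ M) :
    rowAct (FinMat.single i j b) w = Finsupp.single j (op b • w i) := by
  rw [rowAct, FinMat.lift_single]
  rfl

theorem rowAct_mul (r s : FinMat I A) (w : I →₀ M) :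
    rowAct (FinMat.mul r s) w = rowAct s (rowAct r w) := by
  classical
  induction r using FinMat.ind with
  | zero => simp only [map_zero, AddMonoidHom.zero_apply]
  | add x y hx hy => simp only [map_add, AddMonoidHom.add_apply, hx, hy]
  | single i j b =>
    induction s using FinMat.ind with
    | zero => simp only [map_zero, AddMonoidHom.zero_apply]
    | add x y hx hy => simp only [map_add, AddMonoidHom.add_apply, hx, hy]
    | single k l c =>
      rw [FinMat.mul_single_single, rowAct_single, rowAct_single, Finsupp.single_apply]
      split_ifs
      · rw [rowAct_single, op_mul, mul_smul]
      · rw [map_zero, smul_zero, Finsupp.single_zero]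
        rfl

/-- The action of the ring `R` on rows. -/
def rowActR : matRing C γ →+ (I →₀ M) →+ (I →₀ M) :=
  rowAct.comp (AddMonoidHom.mk' (fun r : matRing C γ => r.1) fun _ _ => rfl)

theorem rowActR_mul (r s : matRing C γ) (w : I →₀ M) :
    rowActR (r * s) w = rowActR s (rowActR r w) := rowAct_mul r.1 s.1 w

theorem rowActR_matUnit {i j : I} {b : A} (hb : op b • γ i = b • γ j) (w : I →₀ M) :
    rowActR (matUnit hb) w = Finsupp.single j (op b • w i) := rowAct_single i j b w

variable (γ M) in
/-- The unital right `R`-module of finite rows with entries in a right `A`-module `M`. -/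
def rowMod : UnitalMod (matRing C γ) :=
  { carrier := I →₀ M
    smul := ⟨fun r w => rowActR r.unop w⟩
    smul_add := fun r => map_add (rowActR r)
    add_smul := fun r s => DFunLike.congr_fun (map_add rowActR r s)
    mul_smul := rowActR_mul
    unital := by
      refine eq_top_iff.2 fun w _ => ?_
      induction w using Finsupp.induction_linear with
      | zero => exact zero_mem _
      | add x y hx hy => exact add_mem (hx trivial) (hy trivial)
      | single i m =>
        refine AddSubgroup.subset_closure ⟨Finsupp.single i m, matIdem C γ i, ?_⟩
        refine Eq.trans ?_ (rowActR_matUnit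
          (by rw [op_one, one_smul, one_smul]) _).symm
        rw [Finsupp.single_eq_same, op_one, one_smul] }

variable (γ M) in
/-- The row with entry `m` in position `i`. -/
def rowOf (i : I) : M →+ (rowMod γ M).carrier := Finsupp.singleAddHom i

variable (γ M) in
/-- The entry in position `i`. -/
def rowCoord (i : I) : (rowMod γ M).carrier →+ M := Finsupp.applyAddHom i

theorem row_ext {w w' : (rowMod γ M).carrier} (h : ∀ i, rowCoord γ M i w = rowCoord γ M i w') :
    w = w' := Finsupp.ext h

@[elab_as_elim]
theorem row_ind {p : (rowMod γ M).carrier → Prop} (w : (rowMod γ M).carrier) (zero : p 0)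
    (of : ∀ i m, p (rowOf γ M i m)) (add : ∀ x y, p x → p y → p (x + y)) : p w :=
  Finsupp.induction_linear w zero add of

theorem row_eq_sum (w : (rowMod γ M).carrier) :
    ∃ s : Finset I, w = ∑ i ∈ s, rowOf γ M i (rowCoord γ M i w) :=
  ⟨Finsupp.support w, (Finsupp.sum_single w).symm⟩

open Classical in
theorem rowCoord_rowOf (i j : I) (m : M) :
    rowCoord γ M i (rowOf γ M j m) = if j = i then m else 0 := Finsupp.single_apply

theorem matUnit_smul_row {i j : I} {b : A} (hb : op b • γ i = b • γ j) (w : (rowMod γ M).carrier) :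
    op (matUnit hb) • w = rowOf γ M j (op b • rowCoord γ M i w) := rowActR_matUnit hb w

variable (γ) in
/-- The additive map between row modules induced by a linear map. -/
def rowMapHom (f : M →ₗ[Aᵐᵒᵖ] N) : (rowMod γ M).carrier →+ (rowMod γ N).carrier :=
  Finsupp.mapRange.addMonoidHom f.toAddMonoidHom

theorem rowMapHom_rowOf (f : M →ₗ[Aᵐᵒᵖ] N) (i : I) (m : M) :
    rowMapHom γ f (rowOf γ M i m) = rowOf γ N i (f m) :=
  Finsupp.mapRange_single (hf := map_zero f)

theorem rowCoord_rowMapHom (f : M →ₗ[Aᵐᵒᵖ] N) (i : I) (w : (rowMod γ M).carrier) :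
    rowCoord γ N i (rowMapHom γ f w) = f (rowCoord γ M i w) := rfl

theorem rowMapHom_smul (f : M →ₗ[Aᵐᵒᵖ] N) (r : matRing C γ) (w : (rowMod γ M).carrier) :
    rowMapHom γ f (op r • w) = op r • rowMapHom γ f w := by
  induction r using matRing_induction with
  | zero => rw [UnitalMod.op_zero_smul, UnitalMod.op_zero_smul, map_zero]
  | add x y hx hy => rw [UnitalMod.add_smul, UnitalMod.add_smul, map_add, hx, hy]
  | unit i j b hb =>
    rw [matUnit_smul_row, matUnit_smul_row, rowMapHom_rowOf, map_smul, rowCoord_rowMapHom]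

/-- The evaluation map `w ⊗ [i]a ↦ w_i a`. -/
def rowEval : BalTensor (matRing C γ) (rowMod γ M).carrier (FreeSum I A) →+ M :=
  BalTensor.lift
    (AddMonoidHom.mk' (fun w => FreeSum.lift fun i => AddMonoidHom.mk'
        (fun a => op a • rowCoord γ M i w) fun a b => op_add_smul_right a b _)
      (fun v w => FreeSum.hom_ext fun i a => by
        rw [AddMonoidHom.add_apply, FreeSum.lift_of, FreeSum.lift_of, FreeSum.lift_of]
        exact (congrArg (op a • ·) (map_add _ v w)).trans (smul_add _ _ _)))
    (balanced_of_matUnit _ fun i j b hb w k a => by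
      rw [AddMonoidHom.mk'_apply, FreeSum.lift_of, FreeSum.lift_of,
        AddMonoidHom.mk'_apply, AddMonoidHom.mk'_apply, matUnit_smul_row, rowCoord_rowOf]
      split_ifs
      · rw [op_mul, mul_smul]
      · rw [smul_zero])

@[simp] theorem rowEval_tmul (w : (rowMod γ M).carrier) (i : I) (a : A) :
    rowEval (BalTensor.tmul (matRing C γ) w (FreeSum.of i a)) = op a • rowCoord γ M i w := by
  rw [rowEval, BalTensor.lift_tmul, AddMonoidHom.mk'_apply, FreeSum.lift_of, AddMonoidHom.mk'_apply]

end RowMod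

section Adjunction

variable {A : Type u} [Ring A] {C : Coring A} {I : Type u} {γ : I → C}

/-- The rows of coinvariants of a comodule. -/
def coinvRow (γ : I → C) (M : Comod C) : AddSubgroup (rowMod γ M.carrier).carrier where
  carrier := {w | ∀ i, rowCoord γ M.carrier i w ∈ M.coinv (γ i)}
  zero_mem' i := by rw [map_zero]; exact zero_mem _
  add_mem' ha hb i := by rw [map_add]; exact add_mem (ha i) (hb i)
  neg_mem' ha i := by rw [map_neg]; exact neg_mem (ha i)

theorem rowOf_mem_coinvRow {M : Comod C} {i : I} {m : M.carrier} (hm : m ∈ M.coinv (γ i)) :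
    rowOf γ M.carrier i m ∈ coinvRow γ M := fun j => by
  classical
  rw [rowCoord_rowOf]
  split_ifs with h
  · exact h ▸ hm
  · exact zero_mem _

theorem op_smul_mem_coinvRow (M : Comod C) (r : matRing C γ) (w : (rowMod γ M.carrier).carrier)
    (hw : w ∈ coinvRow γ M) : op r • w ∈ coinvRow γ M := by
  induction r using matRing_induction with
  | zero => rw [UnitalMod.op_zero_smul]; exact zero_mem _
  | add x y hx hy => rw [UnitalMod.add_smul]; exact add_mem hx hy
  | unit i j b hb =>
    rw [matUnit_smul_row]
    exact rowOf_mem_coinvRow (Comod.op_smul_mem_coinv hb (hw i))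

variable (γ) in
/-- The unital `R`-module `⨁ᵢ M^{co γ_i}`. -/
def coinvObj (M : Comod C) : UnitalMod (matRing C γ) :=
  (rowMod γ M.carrier).sub (coinvRow γ M) (op_smul_mem_coinvRow M)

variable (γ) in
/-- The inclusion of `⨁ᵢ M^{co γ_i}` into the module of all rows. -/
def coinvι (M : Comod C) : coinvObj γ M ⟶ rowMod γ M.carrier :=
  UnitalMod.subι _ _ _

theorem coinvι_mem (M : Comod C) (w : (coinvObj γ M).carrier) (i : I) :
    rowCoord γ M.carrier i (UnitalMod.fn (coinvι γ M) w) ∈ M.coinv (γ i) :=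
  Subtype.property (p := (· ∈ coinvRow γ M)) w i

theorem coinvι_injective (M : Comod C) : Function.Injective (UnitalMod.fn (coinvι γ M)) :=
  Subtype.val_injective

theorem exists_coinvι (M : Comod C) {w : (rowMod γ M.carrier).carrier} (hw : w ∈ coinvRow γ M) :
    ∃ w', UnitalMod.fn (coinvι γ M) w' = w := ⟨⟨w, hw⟩, rfl⟩

/-- A homomorphism into `⨁ᵢ M^{co γ_i}` from one into the module of rows. -/
def coinvLift {M : Comod C} {X : UnitalMod (matRing C γ)} (f : X ⟶ rowMod γ M.carrier)
    (hf : ∀ x, UnitalMod.fn f x ∈ coinvRow γ M) : X ⟶ coinvObj γ M :=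
  let f' : X.carrier →+ (coinvObj γ M).carrier := (UnitalMod.fn f).codRestrict (coinvRow γ M) hf
  UnitalMod.ofFn f' fun r x => Subtype.ext (UnitalMod.fn_smul f r x)

theorem coinv_ext {M : Comod C} {w w' : (coinvObj γ M).carrier}
    (h : ∀ i, rowCoord γ M.carrier i (UnitalMod.fn (coinvι γ M) w) =
      rowCoord γ M.carrier i (UnitalMod.fn (coinvι γ M) w')) : w = w' :=
  coinvι_injective M (row_ext h)

/-- The homomorphism of row modules induced by a linear map. -/
def rowMap {M N : Type u} [AddCommGroup M] [Module Aᵐᵒᵖ M] [AddCommGroup N] [Module Aᵐᵒᵖ N]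
    (f : M →ₗ[Aᵐᵒᵖ] N) : rowMod γ M ⟶ rowMod γ N :=
  UnitalMod.ofFn (rowMapHom γ f) (rowMapHom_smul f)

/-- The homomorphism `⨁ᵢ M^{co γ_i} → ⨁ᵢ N^{co γ_i}` induced by a morphism `M → N`. -/
def coinvMap {M N : Comod C} (f : M ⟶ N) : coinvObj γ M ⟶ coinvObj γ N :=
  coinvLift (coinvι γ M ≫ rowMap (Comod.lin f)) fun w i =>
    Comod.lin_mem_coinv f (coinvι_mem M w i)

theorem rowCoord_coinvMap {M N : Comod C} (f : M ⟶ N) (w : (coinvObj γ M).carrier) (i : I) :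
    rowCoord γ N.carrier i (UnitalMod.fn (coinvι γ N) (UnitalMod.fn (coinvMap f) w)) =
      Comod.lin f (rowCoord γ M.carrier i (UnitalMod.fn (coinvι γ M) w)) := rfl

variable (γ) in
/-- The functor `M ↦ ⨁ᵢ M^{co γ_i}`. -/
def coinvFunctor : Comod C ⥤ UnitalMod (matRing C γ) where
  obj M := coinvObj γ M
  map f := coinvMap f
  map_id M := UnitalMod.hom_ext fun w => coinv_ext fun i => by
    rw [rowCoord_coinvMap, Comod.lin_id, UnitalMod.fn_id]
  map_comp f g := UnitalMod.hom_ext fun w => coinv_ext fun i => by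
    rw [rowCoord_coinvMap, Comod.lin_comp, UnitalMod.fn_comp, rowCoord_coinvMap,
      rowCoord_coinvMap]

variable (hγ : ∀ i, C.IsGrouplike (γ i))

/-- The functor `- ⊗_R Σ` for the ring `R` of the coring itself. -/
abbrev tensorF : UnitalMod (matRing C γ) ⥤ Comod C := tensorSigma hγ (le_refl (matRing C γ))

/-- The element `x ⊗ [i]a` of `X ⊗_R Σ`. -/
def tensorOf (X : UnitalMod (matRing C γ)) (i : I) :
    X.carrier →+ A →+ ((tensorF hγ).obj X).carrier :=
  (BalTensor.mk (matRing C γ)).compl₂ (FreeSum.of i)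

theorem tensorOf_eq (X : UnitalMod (matRing C γ)) (i : I) (x : X.carrier) (a : A) :
    tensorOf hγ X i x a = BalTensor.tmul (matRing C γ) x (FreeSum.of i a) := rfl

@[elab_as_elim]
theorem tensor_induction {X : UnitalMod (matRing C γ)} {p : ((tensorF hγ).obj X).carrier → Prop}
    (z : ((tensorF hγ).obj X).carrier) (zero : p 0) (of : ∀ i x a, p (tensorOf hγ X i x a))
    (add : ∀ x y, p x → p y → p (x + y)) : p z :=
  tensor_ind (p := p) z zero (fun x i a => of i x a) add

theorem op_smul_tensorOf (X : UnitalMod (matRing C γ)) (i : I) (x : X.carrier) (a b : A) :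
    op b • tensorOf hγ X i x a = tensorOf hγ X i x (a * b) :=
  congrArg (BalTensor.tmul (matRing C γ) x) (FreeSum.op_smul_of i (op b) a)

theorem tensorOf_eq_smul (X : UnitalMod (matRing C γ)) (i : I) (x : X.carrier) (a : A) :
    tensorOf hγ X i x a = op a • tensorOf hγ X i x 1 := by
  rw [op_smul_tensorOf, one_mul]

-- The rule for computing in X ⊗_R Σ: an elementary matrix is moved to the right factor, where it
-- acts on a basis vector.
open Classical in
theorem tensorOf_matUnit (X : UnitalMod (matRing C γ)) {i j : I} {b : A}
    (hb : op b • γ i = b • γ j) (x : X.carrier) (k : I) (a : A) :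
    tensorOf hγ X k (op (matUnit hb) • x) a =
      if j = k then tensorOf hγ X i x (b * a) else 0 := by
  rw [tensorOf_eq, BalTensor.balanced, matUnit_smul_of]
  split_ifs
  · rfl
  · exact BalTensor.tmul_zero _

theorem tensorOf_matIdem (X : UnitalMod (matRing C γ)) (x : X.carrier) (i : I) (a : A) :
    tensorOf hγ X i (op (matIdem C γ i) • x) a = tensorOf hγ X i x a := by
  classical
  rw [matIdem, tensorOf_matUnit, if_pos rfl, one_mul]

theorem tensorOf_matIdem_of_ne (X : UnitalMod (matRing C γ)) (x : X.carrier) {i j : I} (h : j ≠ i)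
    (a : A) : tensorOf hγ X i (op (matIdem C γ j) • x) a = 0 := by
  classical
  rw [matIdem, tensorOf_matUnit, if_neg h]

theorem coact_tensorOf (X : UnitalMod (matRing C γ)) (i : I) (x : X.carrier) (a : A) :
    ((tensorF hγ).obj X).coact (tensorOf hγ X i x a) =
      BalTensor.tmul A (tensorOf hγ X i x 1) (op a • γ i) :=
  tensorCoact_tmul (le_refl (matRing C γ)) X x i a

theorem tensorOf_mem_coinv (X : UnitalMod (matRing C γ)) (i : I) (x : X.carrier) :
    tensorOf hγ X i x 1 ∈ ((tensorF hγ).obj X).coinv (γ i) := by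
  rw [Comod.mem_coinv, coact_tensorOf, op_one, one_smul]

theorem tensorF_map {X Y : UnitalMod (matRing C γ)} (f : X ⟶ Y) (i : I) (x : X.carrier) (a : A) :
    Comod.lin ((tensorF hγ).map f) (tensorOf hγ X i x a) =
      tensorOf hγ Y i (UnitalMod.fn f x) a := rfl

/-- The map `X → (X ⊗_R Σ)^{co}`, `x ↦ (x ⊗ [i]1)ᵢ`, as a map to rows. -/
def unitRow (X : UnitalMod (matRing C γ)) :
    X.carrier →+ (rowMod γ ((tensorF hγ).obj X).carrier).carrier :=
  AddMonoidHom.mk' (fun x => Finsupp.ofSupportFinite (fun i => tensorOf hγ X i x 1) (by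
      -- Since x is the sum of the x e_j for j in F, and e_j kills [i]1 for i ≠ j, the entries
      -- outside F vanish.
      obtain ⟨F, hF⟩ := X.exists_eq_sum x
      refine F.finite_toSet.subset fun i hi => ?_
      by_contra h
      refine hi ?_
      change tensorOf hγ X i x 1 = 0
      rw [hF, map_sum, AddMonoidHom.finsetSum_apply]
      exact Finset.sum_eq_zero fun j hj => tensorOf_matIdem_of_ne hγ X x (by
        rintro rfl
        exact h hj) 1))
    (fun x y => row_ext fun i => DFunLike.congr_fun (map_add (tensorOf hγ X i) x y) 1)

theorem rowCoord_unitRow (X : UnitalMod (matRing C γ)) (x : X.carrier) (i : I) :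
    rowCoord γ _ i (unitRow hγ X x) = tensorOf hγ X i x 1 := rfl

theorem unitRow_smul (X : UnitalMod (matRing C γ)) (r : matRing C γ) (x : X.carrier) :
    unitRow hγ X (op r • x) = op r • unitRow hγ X x := by
  classical
  induction r using matRing_induction with
  | zero => rw [UnitalMod.op_zero_smul, UnitalMod.op_zero_smul, map_zero]
  | add r s hr hs => rw [UnitalMod.add_smul, UnitalMod.add_smul, map_add, hr, hs]
  | unit i j b hb =>
    refine row_ext fun k => ?_
    rw [rowCoord_unitRow, tensorOf_matUnit, matUnit_smul_row, rowCoord_rowOf, rowCoord_unitRow,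
      op_smul_tensorOf, one_mul, mul_one]

/-- The unit of the adjunction. -/
def unitMap (X : UnitalMod (matRing C γ)) : X ⟶ coinvObj γ ((tensorF hγ).obj X) :=
  coinvLift (UnitalMod.ofFn (unitRow hγ X) (unitRow_smul hγ X))
    fun x i => tensorOf_mem_coinv hγ X i x

theorem rowCoord_unitMap (X : UnitalMod (matRing C γ)) (x : X.carrier) (i : I) :
    rowCoord γ _ i (UnitalMod.fn (coinvι γ _) (UnitalMod.fn (unitMap hγ X) x)) =
      tensorOf hγ X i x 1 := rfl

/-- The additive map `w ⊗ [i]a ↦ w_i a` for rows of elements of `M`. -/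
def rowEvalHom (M : Type u) [AddCommGroup M] [Module Aᵐᵒᵖ M] :
    ((tensorF hγ).obj (rowMod γ M)).carrier →+ M := rowEval

theorem rowEvalHom_of {M : Type u} [AddCommGroup M] [Module Aᵐᵒᵖ M] (i : I)
    (w : (rowMod γ M).carrier) (a : A) :
    rowEvalHom hγ M (tensorOf hγ _ i w a) = op a • rowCoord γ M i w := rowEval_tmul w i a

/-- The linear map `w ⊗ [i]a ↦ w_i a` for rows of elements of `M`. -/
def rowEvalLin (M : Type u) [AddCommGroup M] [Module Aᵐᵒᵖ M] :
    ((tensorF hγ).obj (rowMod γ M)).carrier →ₗ[Aᵐᵒᵖ] M :=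
  { rowEvalHom hγ M with
    map_smul' := fun b z => by
      change rowEvalHom hγ M (op b.unop • z) = op b.unop • rowEvalHom hγ M z
      induction z using tensor_induction with
      | zero => rw [smul_zero, map_zero, smul_zero]
      | add x y hx hy => rw [smul_add, map_add, map_add, hx, hy, smul_add]
      | of i w a =>
        rw [op_smul_tensorOf, rowEvalHom_of, rowEvalHom_of, smul_smul]
        rfl }

@[simp] theorem rowEvalLin_of {M : Type u} [AddCommGroup M] [Module Aᵐᵒᵖ M] (i : I)
    (w : (rowMod γ M).carrier) (a : A) :
    rowEvalLin hγ M (tensorOf hγ _ i w a) = op a • rowCoord γ M i w := rowEval_tmul w i a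

/-- The counit of the adjunction. -/
def counitMap (M : Comod C) : (tensorF hγ).obj (coinvObj γ M) ⟶ M :=
  Comod.ofLin ((rowEvalLin hγ M.carrier).comp (Comod.lin ((tensorF hγ).map (coinvι γ M))))
    fun z => by
      induction z using tensor_induction with
      | zero => simp only [map_zero]
      | add x y hx hy => simp only [map_add, hx, hy]
      | of i w a =>
        rw [coact_tensorOf, BalTensor.rTensor_tmul, LinearMap.comp_apply, LinearMap.comp_apply,
          tensorF_map, tensorF_map, rowEvalLin_of, rowEvalLin_of, map_smul,
          Comod.mem_coinv.1 (coinvι_mem M w i), op_one, one_smul, BalTensor.op_smul_tmul]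

theorem counitMap_of (M : Comod C) (i : I) (w : (coinvObj γ M).carrier) (a : A) :
    Comod.lin (counitMap hγ M) (tensorOf hγ _ i w a) =
      op a • rowCoord γ M.carrier i (UnitalMod.fn (coinvι γ M) w) :=
  rowEvalLin_of hγ i _ a

theorem tensor_lin_ext {X : UnitalMod (matRing C γ)} {M : Comod C}
    {f g : (tensorF hγ).obj X ⟶ M}
    (h : ∀ i x, Comod.lin f (tensorOf hγ X i x 1) = Comod.lin g (tensorOf hγ X i x 1)) : f = g := by
  refine Comod.hom_ext fun z => ?_
  induction z using tensor_induction with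
  | zero => simp only [map_zero]
  | add x y hx hy => simp only [map_add, hx, hy]
  | of i w a => rw [tensorOf_eq_smul, map_smul, map_smul, h]

/-- The functor `- ⊗_R Σ` is left adjoint to `M ↦ ⨁ᵢ M^{co γ_i}`. -/
def tensorAdj : tensorF hγ ⊣ coinvFunctor γ where
  unit :=
    { app := unitMap hγ
      naturality := fun X Y f => UnitalMod.hom_ext fun x => coinv_ext fun i => rfl }
  counit :=
    { app := counitMap hγ
      naturality := fun M N f => tensor_lin_ext hγ fun i w => by
        refine (counitMap_of hγ N i _ 1).trans (Eq.trans ?_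
          (congrArg (Comod.lin f) (counitMap_of hγ M i w 1)).symm)
        rw [map_smul]
        rfl }
  left_triangle_components X := tensor_lin_ext hγ fun i x => by
    refine (counitMap_of hγ _ i _ 1).trans ?_
    rw [op_one, one_smul]
    rfl
  right_triangle_components M := UnitalMod.hom_ext fun w => coinv_ext fun i => by
    refine (counitMap_of hγ M i w 1).trans ?_
    rw [op_one, one_smul]
    rfl

theorem tensorF_isEquivalence (h1 : ∀ X, Function.Bijective (UnitalMod.fn (unitMap hγ X)))
    (h2 : ∀ M, Function.Bijective (Comod.lin (counitMap hγ M))) : (tensorF hγ).IsEquivalence := by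
  have (X : UnitalMod (matRing C γ)) : IsIso ((tensorAdj hγ).unit.app X) := UnitalMod.isIso_of_bijective _ (h1 X)
  have (M : Comod C) : IsIso ((tensorAdj hγ).counit.app M) := Comod.isIso_of_bijective _ (h2 M)
  exact (tensorAdj hγ).toEquivalence.isEquivalence_functor

theorem bijective_unitMap [(tensorF hγ).IsEquivalence] (X : UnitalMod (matRing C γ)) :
    Function.Bijective (UnitalMod.fn (unitMap hγ X)) :=
  UnitalMod.bijective_of_isIso ((tensorAdj hγ).unit.app X)

theorem bijective_counitMap [(tensorF hγ).IsEquivalence] (M : Comod C) :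
    Function.Bijective (Comod.lin (counitMap hγ M)) := by
  have := (tensorAdj hγ).isEquivalence_right_of_isEquivalence_left
  exact Comod.bijective_of_isIso ((tensorAdj hγ).counit.app M)

end Adjunction

/-! ### Projective generators and equivalences -/

namespace Comod

variable {A : Type u} [Ring A] {C : Coring A}

theorem sigma_hom_ext {J : Type u} {δ : J → C} (hδ : ∀ j, C.IsGrouplike (δ j)) {M : Comod C}
    {f g : sigma C hδ ⟶ M} (h : ∀ j, lin f (sigmaOf hδ j 1) = lin g (sigmaOf hδ j 1)) : f = g := by
  refine hom_ext fun v => ?_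
  induction v using sigma_ind with
  | zero => simp only [map_zero]
  | add x y hx hy => simp only [map_add, hx, hy]
  | of j a => rw [sigmaOf_eq_smul, map_smul, map_smul, h]

/-- The factorization of a morphism through the kernel. -/
def kerLift (hC : C.IsLeftFlat) {M N P : Comod C} (f : M ⟶ N) (g : P ⟶ M)
    (h : ∀ p, lin f (lin g p) = 0) : P ⟶ ker hC f :=
  let t : P.carrier →ₗ[Aᵐᵒᵖ] (ker hC f).carrier := (lin g).codRestrict (LinearMap.ker (lin f)) h
  ofLin t fun p => by
    refine rTensor_injective hC (lin (kerι hC f)) (kerι_injective hC f) ?_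
    rw [← BalTensor.rTensor_comp, rTensor_coact]
    exact rTensor_coact g p

end Comod

section Generator

variable {A : Type u} [Ring A] {C : Coring A} {I : Type u} {γ : I → C}
  (hγ : ∀ i, C.IsGrouplike (γ i))

theorem counitMap_coinv {M : Comod C} {m : M.carrier} {i : I} (hm : m ∈ M.coinv (γ i)) :
    ∃ w : (coinvObj γ M).carrier, UnitalMod.fn (coinvι γ M) w = rowOf γ M.carrier i m ∧
      ∀ a, Comod.lin (counitMap hγ M) (tensorOf hγ _ i w a) = op a • m := by
  classical
  obtain ⟨w, hw⟩ := exists_coinvι M (rowOf_mem_coinvRow hm)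
  exact ⟨w, hw, fun a => by rw [counitMap_of, hw, rowCoord_rowOf, if_pos rfl]⟩

/-- Morphisms out of Σ are families of coinvariants, so it suffices to lift coinvariants along an
epimorphism e. The right adjoint is an equivalence and preserves the epimorphism, which is then a
surjection of modules of coinvariants. -/
theorem projective_sigma [(tensorF hγ).IsEquivalence] : Projective (sigma C hγ) where
  factors {M N} f e he := by
    classical
    have := (tensorAdj hγ).isEquivalence_right_of_isEquivalence_left
    have hs := UnitalMod.surjective_of_epi ((coinvFunctor γ).map e)
    have h (i : I) : ∃ m ∈ M.coinv (γ i),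
        Comod.lin e m = Comod.lin f (Comod.sigmaOf hγ i 1) := by
      obtain ⟨w, hw⟩ := exists_coinvι N (rowOf_mem_coinvRow
        (Comod.lin_mem_coinv f (Comod.of_one_mem_coinv hγ i)))
      obtain ⟨v, rfl⟩ := hs w
      refine ⟨_, coinvι_mem M v i, ?_⟩
      refine (rowCoord_coinvMap e v i).symm.trans ((congrArg (rowCoord γ N.carrier i) hw).trans ?_)
      rw [rowCoord_rowOf, if_pos rfl]
    choose m hm h using h
    refine ⟨Comod.sigmaDesc hγ m hm, Comod.sigma_hom_ext hγ fun i => ?_⟩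
    rw [Comod.lin_comp, Comod.sigmaDesc_of, op_one, one_smul, h]

/-- As the counit is surjective, M is generated by its coinvariants, and each of these is in the
image of a morphism from Σ. -/
theorem isSeparator_sigma [(tensorF hγ).IsEquivalence] : IsSeparator (sigma C hγ) := by
  refine (isSeparator_def _).2 fun M N f g h => ?_
  have := Comod.epi_of_surjective _ (bijective_counitMap hγ M).2
  refine (cancel_epi (counitMap hγ M)).1 (tensor_lin_ext hγ fun i w => ?_)
  rw [Comod.lin_comp, Comod.lin_comp, counitMap_of]
  have h' := congrArg (fun f => Comod.lin f (Comod.sigmaOf hγ i 1))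
    (h (Comod.sigmaDesc hγ _ (coinvι_mem M w)))
  simpa only [Comod.lin_comp, Comod.sigmaDesc_of] using h'

section Desc

variable {X : UnitalMod (matRing C γ)} {J : Type u} (x : J → X.carrier) (i : J → I)

/-- The morphism `[j]a ↦ x_j ⊗ [i_j]a` from a direct sum of comodules `[γ_{i_j}]A`. -/
def tensorDesc : sigma C (fun j => hγ (i j)) ⟶ (tensorF hγ).obj X :=
  Comod.sigmaDesc _ (fun j => tensorOf hγ X (i j) (x j) 1)
    fun j => tensorOf_mem_coinv hγ X (i j) (x j)

theorem tensorDesc_of (j : J) (a : A) :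
    Comod.lin (tensorDesc hγ x i) (Comod.sigmaOf _ j a) = tensorOf hγ X (i j) (x j) a := by
  rw [tensorDesc, Comod.sigmaDesc_of, ← tensorOf_eq_smul]

/-- The coordinate v_j is admissible as an entry in row i_j and column k, so x_j ⊗ [i_j]v_j = x_j
u_j ⊗ [k]1 for the elementary matrix u_j with that entry. All terms thus acquire the same right
factor [k]1 and add up to a single pure tensor. -/
theorem tensorDesc_of_mem_coinv {k : I} {v : (sigma C (fun j => hγ (i j))).carrier}
    (hv : v ∈ (sigma C (fun j => hγ (i j))).coinv (γ k)) :
    ∃ s : Finset J, v = ∑ j ∈ s, Comod.sigmaOf _ j (Comod.sigmaCoord _ j v) ∧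
      Comod.lin (tensorDesc hγ x i) v = tensorOf hγ X k
        (∑ j ∈ s, op (matUnit (Comod.coord_of_mem_coinv (fun j => hγ (i j)) hv j)) • x j) 1 := by
  classical
  obtain ⟨s, hs⟩ := Comod.sigmaOf_eq_sum (fun j => hγ (i j)) v
  refine ⟨s, hs, ?_⟩
  conv_lhs => rw [hs]
  rw [map_sum, map_sum, AddMonoidHom.finsetSum_apply]
  refine Finset.sum_congr rfl fun j _ => ?_
  rw [tensorDesc_of, tensorOf_matUnit, if_pos rfl, mul_one]

end Desc

theorem counitMap_surjective (hs : IsSeparator (sigma C hγ)) (M : Comod C) :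
    Function.Surjective (Comod.lin (counitMap hγ M)) := by
  refine LinearMap.range_eq_top.1 (eq_top_iff.2 ?_)
  rw [← Comod.span_coinv_eq_top hγ hs M, Submodule.span_le]
  rintro m ⟨i, hm⟩
  obtain ⟨w, -, h⟩ := counitMap_coinv hγ hm
  exact ⟨_, (h 1).trans (by rw [op_one, one_smul])⟩

/-- The counit is compared with a cover of its source. The sum P of comodules [γ_i]A over all pairs
of an index i and a coinvariant m in M^{co γ_i} maps to M by π and onto ⨁ M^{co γ_i} ⊗_R Σ by τ, and
π is τ followed by the counit. It remains to see that τ kills ker π. -/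
theorem counitMap_injective (hC : C.IsLeftFlat) (hs : IsSeparator (sigma C hγ)) (M : Comod C) :
    Function.Injective (Comod.lin (counitMap hγ M)) := by
  classical
  let J := {p : M.carrier × I // p.1 ∈ M.coinv (γ p.2)}
  choose w hw hw' using fun j : J => counitMap_coinv hγ j.2
  let i : J → I := fun j => j.1.2
  have hπ (v) : Comod.lin (counitMap hγ M) (Comod.lin (tensorDesc hγ w i) v) =
      Comod.lin (Comod.sigmaDesc (fun j => hγ (i j)) (fun j : J => j.1.1) (fun j => j.2)) v := by
    rw [← Comod.lin_comp]
    congr 2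
    refine Comod.sigma_hom_ext _ fun j => ?_
    rw [Comod.lin_comp, tensorDesc_of, hw', Comod.sigmaDesc_of]
  set π := Comod.sigmaDesc (fun j => hγ (i j)) (fun j : J => j.1.1) (fun j => j.2) with hπd
  have hker : ∀ l : (Comod.ker hC π).carrier,
      Comod.lin (tensorDesc hγ w i) (Comod.lin (Comod.kerι hC π) l) = 0 := fun l => by
    -- The kernel of π is a comodule by flatness and hence the span of its coinvariants, so only
    -- those need to be tested.
    suffices h : ⊤ ≤ LinearMap.ker
        ((Comod.lin (tensorDesc hγ w i)).comp (Comod.lin (Comod.kerι hC π))) from h trivial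
    rw [← Comod.span_coinv_eq_top hγ hs, Submodule.span_le]
    rintro l ⟨k, hl⟩
    change Comod.lin (tensorDesc hγ w i) (Comod.lin (Comod.kerι hC π) l) = 0
    have h0 := Comod.kerι_lin hC π l
    have hv := Comod.lin_mem_coinv (Comod.kerι hC π) hl
    generalize Comod.lin (Comod.kerι hC π) l = v at h0 hv
    obtain ⟨s, hs, h⟩ := tensorDesc_of_mem_coinv hγ w i hv
    rw [h]
    -- The left factor is a row whose only possible nonzero entry, in position k, is π(v) = 0.
    refine Eq.trans (congrArg (fun x => tensorOf hγ (coinvObj γ M) k x 1) ?_)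
      (DFunLike.congr_fun (map_zero (tensorOf hγ (coinvObj γ M) k)) (1 : A))
    refine coinvι_injective M ?_
    rw [map_zero, map_sum]
    refine Eq.trans ?_ ((congrArg (rowOf γ M.carrier k) h0).trans (map_zero _))
    conv_rhs => rw [hs]
    rw [map_sum, map_sum]
    refine Finset.sum_congr rfl fun j _ => ?_
    rw [UnitalMod.fn_smul, matUnit_smul_row, hw, rowCoord_rowOf, if_pos rfl, hπd,
      Comod.sigmaDesc_of]
  have hsurj : Function.Surjective (Comod.lin (tensorDesc hγ w i)) := fun z => by
    induction z using tensor_induction with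
    | zero => exact ⟨0, map_zero _⟩
    | add x y hx hy =>
      obtain ⟨a, rfl⟩ := hx
      obtain ⟨b, rfl⟩ := hy
      exact ⟨a + b, map_add _ _ _⟩
    | of k v a =>
      let j : J := ⟨(_, k), coinvι_mem M v k⟩
      refine ⟨Comod.sigmaOf _ j a, ?_⟩
      rw [tensorDesc_of]
      change tensorOf hγ _ k (w j) a = _
      -- The row v may have further entries; multiplication by e_k removes them without changing the
      -- tensor, and leaves the row w_j.
      rw [← tensorOf_matIdem hγ _ v k]
      congr 2
      refine coinvι_injective M ?_
      rw [hw, UnitalMod.fn_smul, matIdem, matUnit_smul_row, op_one, one_smul]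
  refine (injective_iff_map_eq_zero (Comod.lin (counitMap hγ M))).2 fun z hz => ?_
  obtain ⟨v, rfl⟩ := hsurj z
  rw [hπ] at hz
  obtain ⟨l, rfl⟩ := Comod.exists_kerι hC π v hz
  exact hker l

theorem unitMap_surjective {X : UnitalMod (matRing C γ)}
    (h : ∀ i, ∀ y ∈ ((tensorF hγ).obj X).coinv (γ i), ∃ x, tensorOf hγ X i x 1 = y) :
    Function.Surjective (UnitalMod.fn (unitMap hγ X)) := fun w => by
  classical
  choose x hx using fun i => h i _ (coinvι_mem _ w i)
  obtain ⟨s, hs⟩ := row_eq_sum (UnitalMod.fn (coinvι γ _) w)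
  -- The factors e_i keep the preimages of different entries from interfering: x_i e_i ⊗ [k]1 = 0
  -- for k ≠ i.
  refine ⟨∑ i ∈ s, op (matIdem C γ i) • x i, coinvι_injective _ (Eq.trans ?_ hs.symm)⟩
  rw [map_sum, map_sum]
  refine Finset.sum_congr rfl fun i _ => row_ext fun k => ?_
  rw [rowCoord_unitMap, rowCoord_rowOf]
  split_ifs with e
  · rw [← e, tensorOf_matIdem, hx]
  · rw [tensorOf_matIdem_of_ne hγ X _ e]

theorem unitMap_injective {X : UnitalMod (matRing C γ)}
    (h : ∀ x, (∀ i, tensorOf hγ X i x 1 = 0) → x = 0) :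
    Function.Injective (UnitalMod.fn (unitMap hγ X)) :=
  (injective_iff_map_eq_zero _).2 fun x hx => h x fun i => by
    rw [← rowCoord_unitMap, hx, map_zero, map_zero]

/-- The comodule X ⊗_R Σ is covered by the sum of copies of [γ_i]A over all pairs (x, i). By
projectivity a coinvariant lifts to this sum, and `tensorDesc_of_mem_coinv` gives the form of its
image. -/
theorem exists_tensorOf_eq [Projective (sigma C hγ)] (X : UnitalMod (matRing C γ)) (k : I)
    {y : ((tensorF hγ).obj X).carrier} (hy : y ∈ ((tensorF hγ).obj X).coinv (γ k)) :
    ∃ x, tensorOf hγ X k x 1 = y := by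
  have hsurj : Function.Surjective
      (Comod.lin (tensorDesc hγ (fun j : X.carrier × I => j.1) fun j => j.2)) := fun z => by
    induction z using tensor_induction with
    | zero => exact ⟨0, map_zero _⟩
    | add x y hx hy =>
      obtain ⟨a, rfl⟩ := hx
      obtain ⟨b, rfl⟩ := hy
      exact ⟨a + b, map_add _ _ _⟩
    | of k x a => exact ⟨Comod.sigmaOf _ (x, k) a, tensorDesc_of hγ _ _ _ _⟩
  obtain ⟨v, hv, rfl⟩ := Comod.exists_coinv_lift hγ _ hsurj k hy
  obtain ⟨s, -, h⟩ := tensorDesc_of_mem_coinv hγ _ _ hv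
  exact ⟨_, h.symm⟩

end Generator

/-! ### Free modules over R and injectivity of the unit -/

section FreeModule

variable {A : Type u} [Ring A] {C : Coring A} {I : Type u} {γ : I → C}

/-- The map `Σ → S` onto the matrices supported in column `k`. -/
def colEmb (k : I) : FreeSum I A →+ FinMat I A := FreeSum.lift fun i => FinMat.single i k

@[simp] theorem colEmb_of (k i : I) (a : A) : colEmb k (FreeSum.of i a) = FinMat.single i k a :=
  FreeSum.lift_of _ _ _

theorem colEmb_act (k : I) (M : FinMat I A) (v : FreeSum I A) :
    colEmb k (FinMat.act M v) = FinMat.mul M (colEmb k v) := by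
  classical
  induction M using FinMat.ind with
  | zero => simp only [map_zero, AddMonoidHom.zero_apply]
  | add x y hx hy => simp only [map_add, AddMonoidHom.add_apply, hx, hy]
  | single i j b =>
    induction v using FreeSum.ind with
    | zero => simp only [map_zero]
    | add x y hx hy => simp only [map_add, hx, hy]
    | of l a =>
      rw [colEmb_of, FinMat.act_single_of, FinMat.mul_single_single]
      split_ifs
      · rw [colEmb_of]
      · rw [map_zero]

variable (C γ) in
/-- The free unital right `R`-module on a set. -/
def freeMod (J : Type u) : UnitalMod (matRing C γ) :=
  let act (r : matRing C γ) : (J →₀ matRing C γ) →+ (J →₀ matRing C γ) :=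
    Finsupp.mapRange.addMonoidHom (AddMonoidHom.mulRight r)
  have act_single (r : matRing C γ) (j : J) (s : matRing C γ) :
      act r (Finsupp.single j s) = Finsupp.single j (s * r) :=
    Finsupp.mapRange_single (hf := zero_mul r)
  { carrier := J →₀ matRing C γ
    smul := ⟨fun r x => act r.unop x⟩
    smul_add := fun r => map_add (act r)
    add_smul := fun r s x => Finsupp.ext fun j => mul_add (x j) r s
    mul_smul := fun r s x => Finsupp.ext fun j => (mul_assoc (x j) r s).symm
    unital := by
      refine eq_top_iff.2 fun w _ => ?_
      induction w using Finsupp.induction_linear with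
      | zero => exact zero_mem _
      | add x y hx hy => exact add_mem (hx trivial) (hy trivial)
      | single j r =>
        induction r using matRing_induction with
        | zero => rw [Finsupp.single_zero]; exact zero_mem _
        | add r s hr hs => rw [Finsupp.single_add]; exact add_mem (hr trivial) (hs trivial)
        | unit i k b hb =>
          refine AddSubgroup.subset_closure ⟨Finsupp.single j (matUnit hb), matIdem C γ k, ?_⟩
          refine Eq.trans ?_ (act_single _ j _).symm
          exact congrArg (Finsupp.single j) (matUnit_mul_matIdem hb).symm }

variable {J : Type u}

/-- The element of the free module with entry `r` at `j`. -/
def freeOf (j : J) : matRing C γ →+ (freeMod C γ J).carrier := Finsupp.singleAddHom j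

/-- The entry at `j` of an element of the free module. -/
def freeCoord (j : J) : (freeMod C γ J).carrier →+ matRing C γ := Finsupp.applyAddHom j

theorem free_ext {x y : (freeMod C γ J).carrier} (h : ∀ j, freeCoord j x = freeCoord j y) :
    x = y := Finsupp.ext h

theorem freeCoord_smul (j : J) (r : matRing C γ) (x : (freeMod C γ J).carrier) :
    freeCoord j (op r • x) = freeCoord j x * r := rfl

theorem op_smul_freeOf (j : J) (r s : matRing C γ) :
    op r • (freeOf j s : (freeMod C γ J).carrier) = freeOf j (s * r) :=
  Finsupp.mapRange_single (hf := zero_mul r)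

@[elab_as_elim]
theorem free_ind {p : (freeMod C γ J).carrier → Prop} (x : (freeMod C γ J).carrier) (zero : p 0)
    (of : ∀ j r, p (freeOf j r)) (add : ∀ x y, p x → p y → p (x + y)) : p x :=
  Finsupp.induction_linear x zero add of

/-- The additive map from the free module on the elements of `X` to `X`. -/
def freeDescHom (X : UnitalMod (matRing C γ)) : (freeMod C γ X.carrier).carrier →+ X.carrier :=
  Finsupp.liftAddHom fun x => AddMonoidHom.mk' (fun r => op r • x) fun r s => X.add_smul r s x

theorem freeDescHom_of (X : UnitalMod (matRing C γ)) (x : X.carrier) (r : matRing C γ) :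
    freeDescHom X (freeOf x r) = op r • x := Finsupp.liftAddHom_apply_single _ x r

/-- The canonical homomorphism from the free module on the elements of `X` to `X`. -/
def freeDesc (X : UnitalMod (matRing C γ)) : freeMod C γ X.carrier ⟶ X :=
  UnitalMod.ofFn (freeDescHom X) fun r x => by
    induction x using free_ind with
    | zero => rw [UnitalMod.op_smul_zero, map_zero, UnitalMod.op_smul_zero]
    | add x y hx hy => rw [UnitalMod.smul_add, map_add, hx, hy, map_add, UnitalMod.smul_add]
    | of j s => rw [op_smul_freeOf, freeDescHom_of, freeDescHom_of, UnitalMod.mul_smul]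

theorem freeDesc_surjective (X : UnitalMod (matRing C γ)) :
    Function.Surjective (UnitalMod.fn (freeDesc X)) := fun x => by
  obtain ⟨F, hF⟩ := X.exists_idem_smul x
  exact ⟨freeOf x _, (freeDescHom_of X x _).trans (hF F subset_rfl)⟩

variable (hγ : ∀ i, C.IsGrouplike (γ i))

/-- The case of a free module, where no projectivity is needed: each coordinate of x is a matrix
that kills [i]1, so its column i is zero. -/
theorem freeMod_matIdem_smul_eq_zero {i : I} {x : (freeMod C γ J).carrier}
    (h : tensorOf hγ _ i x 1 = 0) : op (matIdem C γ i) • x = 0 := by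
  refine free_ext fun j => ?_
  -- The j-th coordinate followed by the action of R on Σ, that is, x ⊗ v ↦ x_j v.
  let φ : ((tensorF hγ).obj (freeMod C γ J)).carrier →+ FreeSum I A := BalTensor.lift
    (R := matRing C γ) (FinMat.act.comp
      ((AddMonoidHom.mk' (fun r : matRing C γ => r.1) fun _ _ => rfl).comp (freeCoord j)))
    (fun x r v => FinMat.mul_act (freeCoord j x).1 r.1 v)
  have h0 : FinMat.act (freeCoord j x).1 (FreeSum.of i 1) = 0 := (congrArg φ h).trans (map_zero φ)
  rw [freeCoord_smul, map_zero]
  refine Subtype.ext ?_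
  change FinMat.mul (freeCoord j x).1 (FinMat.single i i 1) = 0
  rw [← colEmb_of, ← colEmb_act, h0, map_zero]

/-- Let 0 → K → F → X → 0 be exact with F free, and let p in F lie over x. If x ⊗ [i]1 = 0, then p
can be altered by an element of K so that p ⊗ [i]1 = 0 already in F ⊗_R Σ. This forces p e_i = 0,
and hence x e_i = 0. -/
theorem unitMap_injective_of_projective (hC : C.IsLeftFlat) [Projective (sigma C hγ)]
    (X : UnitalMod (matRing C γ)) : Function.Injective (UnitalMod.fn (unitMap hγ X)) := by
  refine unitMap_injective hγ fun x hx => X.eq_zero_of_matIdem_smul fun i => ?_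
  obtain ⟨p, rfl⟩ := freeDesc_surjective X x
  set f := freeDesc X with hf
  let K := (freeMod C γ X.carrier).sub (UnitalMod.fn f).ker (UnitalMod.ker_closed f)
  let ι : K ⟶ freeMod C γ X.carrier := UnitalMod.subι _ _ (UnitalMod.ker_closed f)
  have hι (k) : UnitalMod.fn f (UnitalMod.fn ι k) = 0 :=
    Subtype.property (p := (· ∈ (UnitalMod.fn f).ker)) k
  have hex : Function.Exact (Comod.lin ((tensorF hγ).map ι)) (Comod.lin ((tensorF hγ).map f)) :=
    BalTensor.exact_map_id (UnitalMod.fn ι) (UnitalMod.fn f) (UnitalMod.fn_smul ι)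
      (UnitalMod.fn_smul f) (fun y => ⟨fun hy => ⟨⟨y, hy⟩, rfl⟩, by rintro ⟨k, rfl⟩; exact hι k⟩)
      (freeDesc_surjective X)
  let φ := Comod.kerLift hC ((tensorF hγ).map f) ((tensorF hγ).map ι)
    hex.apply_apply_eq_zero
  -- By right exactness, K ⊗_R Σ covers the kernel of F ⊗_R Σ → X ⊗_R Σ.
  have hφ : Function.Surjective (Comod.lin φ) := fun l => by
    obtain ⟨z, hz⟩ := (hex _).1 (Comod.kerι_lin hC _ l)
    exact ⟨z, Comod.kerι_injective hC _ hz⟩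
  -- The element p ⊗ [i]1 is a coinvariant of this kernel, so it lifts to a coinvariant of K ⊗_R Σ,
  -- which has the form k ⊗ [i]1.
  obtain ⟨l, hl, hl'⟩ := Comod.mem_coinv_ker hC ((tensorF hγ).map f)
    (tensorOf_mem_coinv hγ _ i p) (hx i)
  obtain ⟨z, hz, rfl⟩ := Comod.exists_coinv_lift hγ φ hφ i hl
  obtain ⟨k, rfl⟩ := exists_tensorOf_eq hγ K i hz
  have h1 : tensorOf hγ _ i (UnitalMod.fn ι k) 1 = tensorOf hγ _ i p 1 := hl'
  have h2 : tensorOf hγ _ i (UnitalMod.fn ι k - p) 1 = 0 := by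
    rw [map_sub, AddMonoidHom.sub_apply, h1, sub_self]
  have h3 := congrArg (UnitalMod.fn f) (freeMod_matIdem_smul_eq_zero hγ h2)
  rw [UnitalMod.fn_smul, map_sub, hι, zero_sub, UnitalMod.op_smul_neg, map_zero, neg_eq_zero] at h3
  exact h3

theorem tensorF_isEquivalence_of_generator (hC : C.IsLeftFlat) (hp : Projective (sigma C hγ))
    (hs : IsSeparator (sigma C hγ)) : (tensorF hγ).IsEquivalence :=
  tensorF_isEquivalence hγ
    (fun X => ⟨unitMap_injective_of_projective hγ hC X,
      unitMap_surjective hγ fun i _ hy => exists_tensorOf_eq hγ X i hy⟩)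
    (fun M => ⟨counitMap_injective hγ hC hs M, counitMap_surjective hγ hs M⟩)

end FreeModule

/-! ### Faithful flatness -/

section FaithfullyFlat

variable {A : Type u} [Ring A] {C : Coring A} {I : Type u} {γ : I → C}

open Classical in
/-- The projection of a matrix to its column `k`. -/
def colProj (k : I) : FinMat I A →+ FreeSum I A :=
  FinMat.lift fun i j => if j = k then FreeSum.of i else 0

open Classical in
theorem colProj_single (k i j : I) (a : A) :
    colProj k (FinMat.single i j a) = if j = k then FreeSum.of i a else 0 := by
  rw [colProj, FinMat.lift_single]
  split_ifs <;> rfl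

theorem colProj_mul (k : I) (M N : FinMat I A) :
    colProj k (FinMat.mul M N) = FinMat.act M (colProj k N) := by
  classical
  induction M using FinMat.ind with
  | zero => simp only [map_zero, AddMonoidHom.zero_apply]
  | add x y hx hy => simp only [map_add, AddMonoidHom.add_apply, hx, hy]
  | single i j b =>
    induction N using FinMat.ind with
    | zero => simp only [map_zero]
    | add x y hx hy => simp only [map_add, hx, hy]
    | single l m a =>
      rw [FinMat.mul_single_single, colProj_single]
      split_ifs with h1 h2 h2
      · rw [colProj_single, if_pos h2, FinMat.act_single_of, if_pos h1]
      · rw [colProj_single, if_neg h2, map_zero]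
      · rw [map_zero, FinMat.act_single_of, if_neg h1]
      · rw [map_zero, map_zero]

/-- The map `X ⊗_R Σ → X ⊗_R S` induced by the inclusion of column `k`. -/
def tensorCol (X : UnitalMod (matRing C γ)) (k : I) :
    BalTensor (matRing C γ) X.carrier (FreeSum I A) →+
      BalTensor (matRing C γ) X.carrier (FinMat I A) :=
  BalTensor.map (AddMonoidHom.id _) (colEmb k) (fun _ => id_smul _) fun r v => colEmb_act k r.1 v

/-- The map `X ⊗_R S → X ⊗_R Σ` induced by the projection to column `k`. -/
def tensorColProj (X : UnitalMod (matRing C γ)) (k : I) :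
    BalTensor (matRing C γ) X.carrier (FinMat I A) →+
      BalTensor (matRing C γ) X.carrier (FreeSum I A) :=
  BalTensor.map (AddMonoidHom.id _) (colProj k) (fun _ => id_smul _) fun r M => colProj_mul k r.1 M

theorem tensorCol_of (X : UnitalMod (matRing C γ)) (k i : I) (x : X.carrier) (a : A) :
    tensorCol X k (BalTensor.tmul _ x (FreeSum.of i a)) =
      BalTensor.tmul (matRing C γ) x (FinMat.single i k a) := by
  rw [tensorCol, BalTensor.map_tmul, colEmb_of]
  rfl

open Classical in
theorem tensorColProj_single (X : UnitalMod (matRing C γ)) (k i j : I) (x : X.carrier) (a : A) :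
    tensorColProj X k (BalTensor.tmul _ x (FinMat.single i j a)) =
      if j = k then BalTensor.tmul (matRing C γ) x (FreeSum.of i a) else 0 := by
  rw [tensorColProj, BalTensor.map_tmul, colProj_single]
  split_ifs
  · rfl
  · rw [BalTensor.tmul_zero]

@[elab_as_elim]
theorem tensor_finMat_induction {X : UnitalMod (matRing C γ)}
    {p : BalTensor (matRing C γ) X.carrier (FinMat I A) → Prop}
    (z : BalTensor (matRing C γ) X.carrier (FinMat I A)) (zero : p 0)
    (single : ∀ i j x a, p (BalTensor.tmul _ x (FinMat.single i j a)))
    (add : ∀ x y, p x → p y → p (x + y)) : p z := by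
  induction z using BalTensor.ind with
  | zero => exact zero
  | add x y hx hy => exact add _ _ hx hy
  | tmul x M =>
    induction M using FinMat.ind with
    | zero => rw [BalTensor.tmul_zero]; exact zero
    | add v w hv hw => rw [BalTensor.tmul_add]; exact add _ _ hv hw
    | single i j a => exact single i j x a

theorem tensorColProj_tensorCol (X : UnitalMod (matRing C γ)) (k : I)
    (z : BalTensor (matRing C γ) X.carrier (FreeSum I A)) :
    tensorColProj X k (tensorCol X k z) = z := by
  classical
  induction z using tensor_ind with
  | zero => simp only [map_zero]
  | add x y hx hy => simp only [map_add, hx, hy]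
  | tmul x i a => rw [tensorCol_of, tensorColProj_single, if_pos rfl]

theorem exists_eq_sum_tensorCol (X : UnitalMod (matRing C γ))
    (z : BalTensor (matRing C γ) X.carrier (FinMat I A)) :
    ∃ s : Finset I, ∀ s', s ⊆ s' → z = ∑ k ∈ s', tensorCol X k (tensorColProj X k z) := by
  classical
  induction z using tensor_finMat_induction with
  | zero => exact ⟨∅, fun s' _ => by simp only [map_zero, Finset.sum_const_zero]⟩
  | add x y hx hy =>
    obtain ⟨s, hs⟩ := hx
    obtain ⟨t, ht⟩ := hy
    refine ⟨s ∪ t, fun s' h => ?_⟩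
    simp only [map_add, Finset.sum_add_distrib]
    rw [← hs _ (Finset.union_subset_left h), ← ht _ (Finset.union_subset_right h)]
  | single i j x a =>
    refine ⟨{j}, fun s' h => ?_⟩
    rw [Finset.sum_eq_single j (fun k _ hk => by
        rw [tensorColProj_single, if_neg hk.symm, map_zero])
      (fun hj => absurd (Finset.singleton_subset_iff.1 h) hj), tensorColProj_single, if_pos rfl,
      tensorCol_of]

theorem tensorMap_tensorCol {X Y : UnitalMod (matRing C γ)} (f : X ⟶ Y) (k : I)
    (z : BalTensor (matRing C γ) X.carrier (FreeSum I A)) :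
    UnitalMod.tensorMap (FinMat I A) f (tensorCol X k z) =
      tensorCol Y k (UnitalMod.tensorMap (FreeSum I A) f z) :=
  DFunLike.congr_fun (f := (UnitalMod.tensorMap (FinMat I A) f).comp (tensorCol X k))
    (g := (tensorCol Y k).comp (UnitalMod.tensorMap (FreeSum I A) f))
    (BalTensor.hom_ext fun _ _ => rfl) z

theorem tensorMap_tensorColProj {X Y : UnitalMod (matRing C γ)} (f : X ⟶ Y) (k : I)
    (z : BalTensor (matRing C γ) X.carrier (FinMat I A)) :
    UnitalMod.tensorMap (FreeSum I A) f (tensorColProj X k z) =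
      tensorColProj Y k (UnitalMod.tensorMap (FinMat I A) f z) :=
  DFunLike.congr_fun (f := (UnitalMod.tensorMap (FreeSum I A) f).comp (tensorColProj X k))
    (g := (tensorColProj Y k).comp (UnitalMod.tensorMap (FinMat I A) f))
    (BalTensor.hom_ext fun _ _ => rfl) z

/-- The module `S` is faithfully flat over `R` if and only if `Σ` is, as `S` is a direct sum of
copies of `Σ`, indexed by the columns. -/
theorem isFaithfullyFlat_finMat_iff : IsFaithfullyFlat (matRing C γ) (FinMat I A) ↔
    IsFaithfullyFlat (matRing C γ) (FreeSum I A) := by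
  classical
  refine ⟨fun H => ⟨fun {X Y Z} f g hfg y => ?_, fun {X Y} f g h => ?_⟩,
    fun H => ⟨fun {X Y Z} f g hfg y => ?_, fun {X Y} f g h => ?_⟩⟩
  · refine ⟨fun hy => ?_, ?_⟩
    -- Any one column embeds Σ as a direct summand of S. Without an index there is no column, but
    -- then Σ = 0 and the tensor products vanish.
    · rcases isEmpty_or_nonempty I with hI | ⟨⟨k⟩⟩
      · exact ⟨0, (map_zero _).trans (tensor_ind (p := fun z => 0 = z) y rfl
          (fun x i a => hI.elim i) fun x y hx hy => by rw [← hx, ← hy, add_zero])⟩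
      · obtain ⟨u, hu⟩ := (H.exact f g hfg (tensorCol Y k y)).1
          (by rw [tensorMap_tensorCol, hy, map_zero])
        exact ⟨tensorColProj X k u, by
          rw [tensorMap_tensorColProj, hu, tensorColProj_tensorCol]⟩
    · rintro ⟨x, rfl⟩
      rcases isEmpty_or_nonempty I with hI | ⟨⟨k⟩⟩
      · exact tensor_ind (p := fun z => z = 0) _ rfl (fun x i a => hI.elim i)
            fun x y hx hy => by rw [hx, hy, add_zero]
      · rw [← tensorColProj_tensorCol X k x, tensorMap_tensorColProj, tensorMap_tensorColProj,
          (H.exact f g hfg).apply_apply_eq_zero, map_zero]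
  · refine H.faithful f g (BalTensor.hom_ext fun x M => ?_)
    induction M using FinMat.ind with
    | zero => rw [BalTensor.tmul_zero, map_zero, map_zero]
    | add v w hv hw => rw [BalTensor.tmul_add, map_add, map_add, hv, hw]
    | single i j a => rw [← tensorCol_of, tensorMap_tensorCol, tensorMap_tensorCol, h]
  · refine ⟨fun hy => ?_, ?_⟩
    · have h (k : I) : ∃ x, UnitalMod.tensorMap (FreeSum I A) f x = tensorColProj Y k y :=
        (H.exact f g hfg _).1 (by rw [tensorMap_tensorColProj, hy, map_zero])
      choose x hx using h
      obtain ⟨s, hs⟩ := exists_eq_sum_tensorCol Y y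
      refine ⟨∑ k ∈ s, tensorCol X k (x k), ?_⟩
      rw [hs s subset_rfl, map_sum]
      exact Finset.sum_congr rfl fun k _ => by rw [tensorMap_tensorCol, hx]
    · rintro ⟨x, rfl⟩
      obtain ⟨s, hs⟩ := exists_eq_sum_tensorCol X x
      rw [hs s subset_rfl, map_sum, map_sum]
      exact Finset.sum_eq_zero fun k _ => by
        rw [tensorMap_tensorCol, tensorMap_tensorCol, (H.exact f g hfg).apply_apply_eq_zero,
          map_zero]
  · refine H.faithful f g (BalTensor.hom_ext fun x v => ?_)
    induction v using FreeSum.ind with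
    | zero => rw [BalTensor.tmul_zero, map_zero, map_zero]
    | add v w hv hw => rw [BalTensor.tmul_add, map_add, map_add, hv, hw]
    | of i a =>
      rw [← tensorColProj_tensorCol X i (BalTensor.tmul _ x (FreeSum.of i a)),
        tensorMap_tensorColProj, tensorMap_tensorColProj, h]

variable (hγ : ∀ i, C.IsGrouplike (γ i))

/-- An equivalence is faithful. For exactness, the kernel of Y ⊗_R Σ → Z ⊗_R Σ is spanned by
coinvariants y ⊗ [i]1, and the injectivity of the unit at Z turns their vanishing in Z ⊗_R Σ into an
equation in Z, to which exactness of the given sequence applies. -/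
theorem isFaithfullyFlat_of_isEquivalence (hC : C.IsLeftFlat) [(tensorF hγ).IsEquivalence] :
    IsFaithfullyFlat (matRing C γ) (FreeSum I A) where
  exact {X Y Z} f g hfg := by
    have := projective_sigma hγ
    have key (y : ((tensorF hγ).obj Y).carrier) : Comod.lin ((tensorF hγ).map g) y = 0 ↔
        y ∈ LinearMap.range (Comod.lin ((tensorF hγ).map f)) := by
      refine ⟨fun hy => ?_, ?_⟩
      · obtain ⟨l, rfl⟩ := Comod.exists_kerι hC _ y hy
        clear hy
        suffices h : ⊤ ≤ (LinearMap.range (Comod.lin ((tensorF hγ).map f))).comap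
          (Comod.lin (Comod.kerι hC ((tensorF hγ).map g))) from h trivial
        rw [← Comod.span_coinv_eq_top hγ (isSeparator_sigma hγ), Submodule.span_le]
        rintro l ⟨i, hl⟩
        have h0 := Comod.kerι_lin hC _ l
        change Comod.lin (Comod.kerι hC ((tensorF hγ).map g)) l ∈
          LinearMap.range (Comod.lin ((tensorF hγ).map f))
        obtain ⟨y, hy⟩ := exists_tensorOf_eq hγ Y i (Comod.lin_mem_coinv (Comod.kerι hC _) hl)
        -- With y replaced by y e_i, the entries of the unit at positions other than i vanish
        -- automatically.
        rw [← hy, ← tensorOf_matIdem] at h0 ⊢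
        have h1 : UnitalMod.fn g (op (matIdem C γ i) • y) = 0 := by
          refine (bijective_unitMap hγ Z).1 (coinv_ext fun j => ?_)
          rw [rowCoord_unitMap, map_zero, map_zero, map_zero]
          by_cases hj : i = j
          · exact hj ▸ h0
          · rw [UnitalMod.fn_smul, tensorOf_matIdem_of_ne hγ Z _ hj]
        obtain ⟨x, hx⟩ := (hfg _).1 h1
        exact ⟨tensorOf hγ X i x 1, congrArg (fun y => tensorOf hγ Y i y 1) hx⟩
      · rintro ⟨x, rfl⟩
        induction x using tensor_induction with
        | zero => simp only [map_zero]
        | add x y hx hy => simp only [map_add, hx, hy, add_zero]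
        | of i x a =>
          rw [tensorF_map, tensorF_map]
          refine (congrArg (fun z => tensorOf hγ Z i z a) (hfg.apply_apply_eq_zero x)).trans ?_
          exact DFunLike.congr_fun (map_zero (tensorOf hγ Z i)) a
    exact key
  faithful {X Y} f g h := (tensorF hγ).map_injective
    (Comod.hom_ext fun z => DFunLike.congr_fun h z)

end FaithfullyFlat

/-! ### The canonical map -/

section Can

variable {A : Type u} [Ring A]

/-- A coring as a right comodule over itself. -/
def Comod.regular (C : Coring A) : Comod C where
  carrier := C
  coact :=
    { C.comul with
      map_smul' := fun a c => C.comul_op_smul a.unop c }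
  coassoc := C.coassoc
  coact_counit := C.comul_counit

theorem Coring.Hom.isIso_of_bijective {C D : Coring A} (f : Coring.Hom C D)
    (hf : Function.Bijective f.toFun) : f.IsIso := by
  let e := AddEquiv.ofBijective f.toFun hf
  have h1 (n) : f.toFun (e.symm n) = n := e.apply_symm_apply n
  have h2 (m) : e.symm (f.toFun m) = m := e.symm_apply_apply m
  refine ⟨⟨e.symm.toAddMonoidHom, fun a d => hf.1 ?_, fun a d => hf.1 ?_, fun d => ?_,
    fun d => ?_⟩, h2, h1⟩
  · rw [f.map_smul]
    exact (h1 _).trans (congrArg (a • ·) (h1 d).symm)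
  · rw [f.map_op_smul]
    exact (h1 _).trans (congrArg (op a • ·) (h1 d).symm)
  · obtain ⟨c, rfl⟩ := hf.2 d
    rw [f.map_comul]
    refine (congrArg C.comul (h2 c)).trans ?_
    generalize C.comul c = z
    induction z using BalTensor.ind with
    | zero => simp only [map_zero]
    | add x y hx hy => simp only [map_add, ← hx, ← hy]
    | tmul c c' =>
      rw [BalTensor.map_tmul, BalTensor.map_tmul]
      exact congrArg₂ (BalTensor.tmul A) (h2 c).symm (h2 c').symm
  · obtain ⟨c, rfl⟩ := hf.2 d
    rw [f.map_counit]
    exact congrArg C.counit (h2 c)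

variable {C : Coring A} {I : Type u} {γ : I → C}

/-- The counit axiom applied to Δ(c) = c ⊗ g. For grouplike g, the coinvariants of the coring are
therefore exactly the multiples ag. -/
theorem mem_coinv_regular {g c : C} (hc : c ∈ (Comod.regular C).coinv g) :
    c = C.counit c • g := by
  conv_lhs => rw [← C.counit_comul c]
  rw [show C.comul c = BalTensor.tmul A c g from hc]
  rfl

theorem smul_mem_coinv_regular {g : C} (hg : C.IsGrouplike g) (a : A) :
    a • g ∈ (Comod.regular C).coinv g := by
  change C.comul (a • g) = _
  rw [C.comul_smul, hg.1]
  rfl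

variable (hγ : ∀ i, C.IsGrouplike (γ i))

/-- The entries of a row of coinvariants of the coring, as elements of the coring. -/
def regularCoord (i : I) : (coinvObj γ (Comod.regular C)).carrier →+ C :=
  (rowCoord γ (Comod.regular C).carrier i).comp (UnitalMod.fn (coinvι γ (Comod.regular C)))

open Classical in
theorem regularCoord_smul {i j : I} {b : A} (hb : op b • γ i = b • γ j)
    (w : (coinvObj γ (Comod.regular C)).carrier) (k : I) :
    regularCoord k (op (matUnit hb) • w) = if j = k then op b • regularCoord i w else 0 := by
  change rowCoord γ _ k (UnitalMod.fn (coinvι γ (Comod.regular C)) _) = _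
  rw [UnitalMod.fn_smul, matUnit_smul_row, rowCoord_rowOf]
  rfl

/-- The map `w ⊗ [i]a ↦ ε(w_i) ⊗ a`. -/
def toComatrix : ((tensorF hγ).obj (coinvObj γ (Comod.regular C))).carrier →+ Comatrix C γ :=
  BalTensor.lift (R := matRing C γ)
    (AddMonoidHom.mk' (fun w => FreeSum.lift fun i =>
        Comatrix.mk C γ i (C.counit (regularCoord i w)))
      (fun v w => FreeSum.hom_ext fun i a => by
        rw [AddMonoidHom.add_apply, FreeSum.lift_of, FreeSum.lift_of, FreeSum.lift_of, map_add,
          map_add, map_add, AddMonoidHom.add_apply]))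
    (balanced_of_matUnit _ fun i j b hb w k a => by
      rw [AddMonoidHom.mk'_apply, FreeSum.lift_of, regularCoord_smul]
      split_ifs with h
      · subst h
        rw [FreeSum.lift_of, C.counit_op_smul, op_smul_eq_mul,
          Comatrix.mk_rel C γ hb]
      · rw [map_zero, map_zero]
        rfl)

theorem toComatrix_of (i : I) (w : (coinvObj γ (Comod.regular C)).carrier) (a : A) :
    toComatrix hγ (tensorOf hγ _ i w a) =
      Comatrix.mk C γ i (C.counit (regularCoord i w)) a :=
  FreeSum.lift_of _ i a

/-- A coinvariant entry w_i equals ε(w_i)γ_i, so ε(w_i) ⊗ a is sent by `can` to w_i a. -/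
theorem canHom_toComatrix
    (z : ((tensorF hγ).obj (coinvObj γ (Comod.regular C))).carrier) :
    canHom C γ (toComatrix hγ z) = Comod.lin (counitMap hγ (Comod.regular C)) z := by
  induction z using tensor_induction with
  | zero =>
    rw [map_zero, map_zero, map_zero]
    rfl
  | add x y hx hy =>
    rw [map_add, map_add, map_add, hx, hy]
    rfl
  | of i w a =>
    rw [toComatrix_of, canHom_mk, counitMap_of, smul_comm]
    exact congrArg (op a • ·) (mem_coinv_regular (coinvι_mem _ w i)).symm

theorem toComatrix_surjective : Function.Surjective (toComatrix hγ) := fun x => by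
  classical
  induction x using Comatrix.ind with
  | zero => exact ⟨0, map_zero _⟩
  | add x y hx hy =>
    obtain ⟨a, rfl⟩ := hx
    obtain ⟨b, rfl⟩ := hy
    exact ⟨a + b, map_add _ _ _⟩
  | cls i a a' =>
    obtain ⟨w, hw⟩ := exists_coinvι _ (rowOf_mem_coinvRow (smul_mem_coinv_regular (hγ i) a))
    refine ⟨tensorOf hγ _ i w a', ?_⟩
    have h : regularCoord i w = a • γ i := by
      refine (congrArg (rowCoord γ (Comod.regular C).carrier i) hw).trans ?_
      exact (rowCoord_rowOf i i _).trans (if_pos rfl)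
    rw [toComatrix_of, h, C.counit_smul, (hγ i).2, smul_eq_mul, mul_one]

/-- The bijective counit at the coring factors as the surjection `toComatrix` followed by `can`, so
`can` is bijective. -/
theorem can_isIso_of_isEquivalence [(tensorF hγ).IsEquivalence] : (can C hγ).IsIso := by
  have h := bijective_counitMap hγ (Comod.regular C)
  refine Coring.Hom.isIso_of_bijective _ ⟨fun x y hxy => ?_, fun c => ?_⟩
  · obtain ⟨x, rfl⟩ := toComatrix_surjective hγ x
    obtain ⟨y, rfl⟩ := toComatrix_surjective hγ y
    exact congrArg _ (h.1 ((canHom_toComatrix hγ x).symm.trans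
      (hxy.trans (canHom_toComatrix hγ y))))
  · obtain ⟨z, rfl⟩ := h.2 c
    exact ⟨_, canHom_toComatrix hγ z⟩

/-! ### Descent along `Σ` -/

section Descent

variable (M : Type u) [AddCommGroup M] [Module Aᵐᵒᵖ M]

variable (C γ) in
/-- The class of `a ⊗_{A_{g,g}} a'`, `g = γ i`, in the coring `ℜ(G)`. -/
def comatrixOf (i : I) : A →+ A →+ comatrixCoring C γ := Comatrix.mk C γ i

@[elab_as_elim]
theorem comatrix_induction {p : comatrixCoring C γ → Prop} (x : comatrixCoring C γ) (zero : p 0)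
    (of : ∀ i a a', p (comatrixOf C γ i a a')) (add : ∀ x y, p x → p y → p (x + y)) : p x :=
  Comatrix.ind (p := p) x zero of add

theorem smul_comatrixOf (b : A) (i : I) (a a' : A) :
    b • comatrixOf C γ i a a' = comatrixOf C γ i (b * a) a' := Comatrix.smul_cls b i a a'

theorem comatrixOf_rel {g h : I} {t : A} (ht : op t • γ h = t • γ g) (a a' : A) :
    comatrixOf C γ h a (t * a') = comatrixOf C γ g (a * t) a' := Comatrix.mk_rel C γ ht a a'

theorem can_comatrixOf (i : I) (a a' : A) :
    (can C hγ).toFun (comatrixOf C γ i a a') = a • op a' • γ i := canHom_mk C γ i a a'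

/-- The map `w ⊗ [i]a ↦ w_i ⊗ (1 ⊗ a)`. -/
def rowTensor :
    ((tensorF hγ).obj (rowMod γ M)).carrier →+ BalTensor A M (comatrixCoring C γ) :=
  BalTensor.lift (R := matRing C γ)
    (AddMonoidHom.mk' (fun w => FreeSum.lift fun i =>
        (BalTensor.mk A (rowCoord γ M i w)).comp (comatrixOf C γ i 1))
      (fun v w => FreeSum.hom_ext fun i a => by
        rw [AddMonoidHom.add_apply, FreeSum.lift_of, FreeSum.lift_of, FreeSum.lift_of]
        exact (congrArg (fun m => BalTensor.tmul A m _) (map_add _ v w)).trans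
          (BalTensor.add_tmul _ _ _)))
    (balanced_of_matUnit _ fun i j b hb w k a => by
      classical
      rw [AddMonoidHom.mk'_apply, FreeSum.lift_of, matUnit_smul_row, rowCoord_rowOf]
      split_ifs with h
      · subst h
        rw [FreeSum.lift_of]
        refine (BalTensor.balanced _ _ _).trans (congrArg (BalTensor.tmul A _) ?_)
        rw [smul_comatrixOf, comatrixOf_rel hb, mul_one, one_mul]
      · rw [map_zero]
        rfl)

theorem rowTensor_of (i : I) (w : (rowMod γ M).carrier) (a : A) :
    rowTensor hγ M (tensorOf hγ _ i w a) =
      BalTensor.tmul A (rowCoord γ M i w) (comatrixOf C γ i 1 a) :=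
  FreeSum.lift_of _ i a

/-- The counterpart in rows ⊗_R Σ of the relations that define ℜ(G); it makes the inverse of
`rowTensor` well defined. -/
theorem tensorOf_rowOf {g h : I} {t : A} (ht : op t • γ h = t • γ g) (m : M) (a : A) :
    tensorOf hγ _ h (rowOf γ M h m) (t * a) = tensorOf hγ _ g (rowOf γ M g (op t • m)) a := by
  classical
  have h1 := tensorOf_matUnit hγ (rowMod γ M) ht (rowOf γ M h m) g a
  rw [if_pos rfl, matUnit_smul_row, rowCoord_rowOf, if_pos rfl] at h1
  exact h1.symm

/-- The map `a ⊗_{A_{g,g}} a' ↦ [i](ma) ⊗ [i]a'`, `g = γ i`. -/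
def rowTensorInvAux (m : M) : comatrixCoring C γ →+ ((tensorF hγ).obj (rowMod γ M)).carrier :=
  Comatrix.lift
    (fun i => AddMonoidHom.mk' (fun a => tensorOf hγ _ i (rowOf γ M i (op a • m)))
      (fun a b => by rw [op_add_smul_right, map_add, map_add]))
    (fun g h t ht a a' => by
      refine (tensorOf_rowOf hγ M ht (op a • m) a').trans ?_
      rw [AddMonoidHom.mk'_apply, op_mul, mul_smul])

theorem rowTensorInvAux_of (m : M) (i : I) (a a' : A) :
    rowTensorInvAux hγ M m (comatrixOf C γ i a a') =
      tensorOf hγ _ i (rowOf γ M i (op a • m)) a' := Comatrix.lift_cls _ _ i a a'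

/-- The inverse `m ⊗ (a ⊗_{A_{g,g}} a') ↦ [i](ma) ⊗ [i]a'`, `g = γ i`, of `rowTensor`. -/
def rowTensorInv :
    BalTensor A M (comatrixCoring C γ) →+ ((tensorF hγ).obj (rowMod γ M)).carrier :=
  BalTensor.lift
    (AddMonoidHom.mk' (rowTensorInvAux hγ M) fun m m' => AddMonoidHom.ext fun x => by
      rw [AddMonoidHom.add_apply]
      induction x using comatrix_induction with
      | zero => simp only [map_zero, add_zero]
      | add x y hx hy =>
        simp only [map_add, hx, hy]
        abel
      | of i a a' =>
        rw [rowTensorInvAux_of, rowTensorInvAux_of, rowTensorInvAux_of, smul_add, map_add, map_add,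
          AddMonoidHom.add_apply])
    (fun m b x => by
      change rowTensorInvAux hγ M (op b • m) x = rowTensorInvAux hγ M m (b • x)
      induction x using comatrix_induction with
      | zero => rw [smul_zero, map_zero, map_zero]
      | add x y hx hy => rw [smul_add, map_add, map_add, hx, hy]
      | of i a a' =>
        rw [smul_comatrixOf, rowTensorInvAux_of, rowTensorInvAux_of, op_mul, mul_smul])

theorem rowTensorInv_tmul (m : M) (i : I) (a a' : A) :
    rowTensorInv hγ M (BalTensor.tmul A m (comatrixOf C γ i a a')) =
      tensorOf hγ _ i (rowOf γ M i (op a • m)) a' := rowTensorInvAux_of hγ M m i a a'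

/-- The relations that define ℜ(G) are those of tensoring over R: A_{g,h} moves between the h-th and
the g-th summand. So rows in M tensored with Σ give M ⊗_A ℜ(G), without any assumption on the coring
beyond the grouplikes. -/
theorem rowTensor_bijective : Function.Bijective (rowTensor hγ M) := by
  classical
  refine Function.bijective_iff_has_inverse.2 ⟨rowTensorInv hγ M, fun z => ?_, fun z => ?_⟩
  · induction z using tensor_induction with
    | zero => simp only [map_zero]
    | add x y hx hy => simp only [map_add, hx, hy]
    | of i w a =>
      rw [rowTensor_of, rowTensorInv_tmul, ← tensorOf_matIdem hγ _ w i, matIdem, matUnit_smul_row,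
        op_one]
  · induction z using BalTensor.ind with
    | zero => simp only [map_zero]
    | add x y hx hy => simp only [map_add, hx, hy]
    | tmul m x =>
      induction x using comatrix_induction with
      | zero => simp only [BalTensor.tmul_zero, map_zero]
      | add x y hx hy => simp only [BalTensor.tmul_add, map_add, hx, hy]
      | of i a a' =>
        rw [rowTensorInv_tmul, rowTensor_of, rowCoord_rowOf, if_pos rfl, BalTensor.balanced,
          smul_comatrixOf, mul_one]

/-- The map `w ⊗ [i]a ↦ w_i ⊗ γ_i a`. -/
def rowTensorCan : ((tensorF hγ).obj (rowMod γ M)).carrier →+ BalTensor A M C :=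
  (BalTensor.lTensor M (can C hγ).toFun (can C hγ).map_smul).comp (rowTensor hγ M)

@[simp] theorem rowTensorCan_of (i : I) (w : (rowMod γ M).carrier) (a : A) :
    rowTensorCan hγ M (tensorOf hγ _ i w a) =
      BalTensor.tmul A (rowCoord γ M i w) (op a • γ i) := by
  rw [rowTensorCan, AddMonoidHom.comp_apply, rowTensor_of, BalTensor.lTensor_tmul,
    can_comatrixOf, one_smul]

theorem rowTensorCan_bijective (hcan : (can C hγ).IsIso) :
    Function.Bijective (rowTensorCan hγ M) := by
  obtain ⟨f', h1, h2⟩ := hcan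
  exact (Function.bijective_iff_has_inverse.2 ⟨BalTensor.lTensor M f'.toFun f'.map_smul,
    BalTensor.lTensor_leftInverse _ (can C hγ).map_smul _ _ h1,
    BalTensor.lTensor_leftInverse _ _ _ (can C hγ).map_smul h2⟩).comp
    (rowTensor_bijective hγ M)

end Descent

/-- The additive map `[i]m ↦ [i](ρ(m) - m ⊗ γ_i)`. -/
def coactDiffHom (γ : I → C) (M : Comod C) :
    (rowMod γ M.carrier).carrier →+ (rowMod γ (BalTensor A M.carrier C)).carrier :=
  Finsupp.liftAddHom fun i => (rowOf γ (BalTensor A M.carrier C) i).comp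
    (M.coact.toAddMonoidHom - (BalTensor.mk A).flip (γ i))

theorem coactDiffHom_rowOf (M : Comod C) (i : I) (m : M.carrier) :
    coactDiffHom γ M (rowOf γ _ i m) = rowOf γ _ i (M.coact m - BalTensor.tmul A m (γ i)) :=
  Finsupp.liftAddHom_apply_single _ i m

theorem rowCoord_coactDiffHom (M : Comod C) (i : I) (w : (rowMod γ M.carrier).carrier) :
    rowCoord γ _ i (coactDiffHom γ M w) =
      M.coact (rowCoord γ _ i w) - BalTensor.tmul A (rowCoord γ _ i w) (γ i) := by
  classical
  induction w using row_ind with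
  | zero => simp only [map_zero, BalTensor.zero_tmul, sub_zero]
  | add x y hx hy =>
    simp only [map_add, hx, hy, BalTensor.add_tmul]
    abel
  | of j m =>
    rw [coactDiffHom_rowOf, rowCoord_rowOf, rowCoord_rowOf]
    split_ifs with h
    · rw [h]
    · rw [map_zero, BalTensor.zero_tmul, sub_zero]

/-- The homomorphism of row modules `[i]m ↦ [i](ρ(m) - m ⊗ γ_i)`, with kernel the rows of
coinvariants. -/
def coactDiff (γ : I → C) (M : Comod C) :
    rowMod γ M.carrier ⟶ rowMod γ (BalTensor A M.carrier C) :=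
  UnitalMod.ofFn (coactDiffHom γ M) fun r w => by
    induction r using matRing_induction with
    | zero => rw [UnitalMod.op_zero_smul, UnitalMod.op_zero_smul, map_zero]
    | add r s hr hs => rw [UnitalMod.add_smul, UnitalMod.add_smul, map_add, hr, hs]
    | unit i j b hb =>
      rw [matUnit_smul_row, matUnit_smul_row, coactDiffHom_rowOf, rowCoord_coactDiffHom, map_smul,
        smul_sub, BalTensor.op_smul_tmul, hb, BalTensor.balanced]

theorem exact_coinvι_coactDiff (M : Comod C) :
    Function.Exact (UnitalMod.fn (coinvι γ M)) (UnitalMod.fn (coactDiff γ M)) := fun w => by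
  have h : UnitalMod.fn (coactDiff γ M) w = 0 ↔ w ∈ coinvRow γ M := by
    refine ⟨fun h i => ?_, fun h => row_ext fun i => ?_⟩
    · have := rowCoord_coactDiffHom M i w
      rw [show coactDiffHom γ M w = 0 from h, map_zero] at this
      exact sub_eq_zero.1 this.symm
    · rw [map_zero]
      exact (rowCoord_coactDiffHom M i w).trans (sub_eq_zero.2 (h i))
  rw [h]
  exact ⟨fun hw => ⟨⟨w, hw⟩, rfl⟩, fun ⟨v, hv⟩ => hv ▸ v.2⟩

/-- Left square of the descent diagram: the inclusion of coinvariants into rows, tensored with Σ,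
becomes the counit followed by ρ. -/
theorem rowTensorCan_coinvι (M : Comod C)
    (z : ((tensorF hγ).obj (coinvObj γ M)).carrier) :
    rowTensorCan hγ M.carrier (Comod.lin ((tensorF hγ).map (coinvι γ M)) z) =
      M.coact (Comod.lin (counitMap hγ M) z) := by
  induction z using tensor_induction with
  | zero => simp only [map_zero]
  | add x y hx hy => simp only [map_add, hx, hy]
  | of i w a =>
    rw [tensorF_map, rowTensorCan_of, counitMap_of, map_smul,
      Comod.mem_coinv.1 (coinvι_mem M w i), BalTensor.op_smul_tmul]

/-- Right square of the descent diagram. Since Δ(γ_i a) = γ_i ⊗ γ_i a, the element (ρ(w_i) - w_i ⊗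
γ_i) ⊗ γ_i a is the difference of the two coactions on w_i ⊗ γ_i a. -/
theorem rowTensorCan_coactDiff (M : Comod C)
    (z : ((tensorF hγ).obj (rowMod γ M.carrier)).carrier) :
    BalTensor.assoc (rowTensorCan hγ _ (Comod.lin ((tensorF hγ).map (coactDiff γ M)) z)) =
      BalTensor.assoc (BalTensor.rTensor C M.coact (rowTensorCan hγ _ z)) -
        BalTensor.lTensor _ C.comul C.comul_smul (rowTensorCan hγ _ z) := by
  induction z using tensor_induction with
  | zero => simp only [map_zero, sub_zero]
  | add x y hx hy =>
    simp only [map_add, hx, hy]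
    abel
  | of i w a =>
    rw [tensorF_map, rowTensorCan_of, rowTensorCan_of, BalTensor.rTensor_tmul,
      BalTensor.lTensor_tmul, C.comul_op_smul, (hγ i).1, BalTensor.op_smul_tmul]
    rw [← BalTensor.assoc_tmul, ← map_sub]
    refine congrArg _ ((congrArg (fun m => BalTensor.tmul A m (op a • γ i))
      (rowCoord_coactDiffHom M i w)).trans ?_)
    rw [eq_sub_iff_add_eq, ← BalTensor.add_tmul, sub_add_cancel]

/-- Exactness of - ⊗_R Σ makes the coinvariants, tensored with Σ, the kernel of the difference of ρ
⊗ C and M ⊗ Δ on M ⊗_A C. By the axioms of a comodule this kernel is ρ(M), a copy of M. -/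
theorem counitMap_bijective_of_flat (hcan : (can C hγ).IsIso)
    (hf : IsFaithfullyFlat (matRing C γ) (FreeSum I A)) (M : Comod C) :
    Function.Bijective (Comod.lin (counitMap hγ M)) := by
  have hinj : Function.Injective (Comod.lin ((tensorF hγ).map (coinvι γ M))) := by
    -- Flatness is stated by exact pairs; pairing the inclusion with a zero map expresses its
    -- injectivity, which then survives tensoring.
    let z : coinvObj γ M ⟶ coinvObj γ M := UnitalMod.ofFn 0 fun r _ =>
      (UnitalMod.op_smul_zero _ r).symm
    have hz : Function.Exact (UnitalMod.fn z) (UnitalMod.fn (coinvι γ M)) := fun w =>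
      ⟨fun h => ⟨0, (coinvι_injective M (h.trans (map_zero _).symm)).symm⟩, by
        rintro ⟨v, rfl⟩
        exact map_zero (UnitalMod.fn (coinvι γ M))⟩
    refine (injective_iff_map_eq_zero _).2 fun v hv => ?_
    obtain ⟨u, rfl⟩ := (hf.exact z (coinvι γ M) hz v).1 hv
    refine DFunLike.congr_fun (f := UnitalMod.tensorMap (FreeSum I A) z) (g := 0)
      (BalTensor.hom_ext fun x v => ?_) u
    exact BalTensor.zero_tmul v
  refine ⟨fun x y h => hinj ((rowTensorCan_bijective hγ _ hcan).1 ?_), fun m => ?_⟩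
  · rw [rowTensorCan_coinvι, rowTensorCan_coinvι, h]
  · obtain ⟨w, hw⟩ := (rowTensorCan_bijective hγ M.carrier hcan).2 (M.coact m)
    -- Coassociativity of M says that ρ(m) is in the kernel.
    have h0 : Comod.lin ((tensorF hγ).map (coactDiff γ M)) w = 0 := by
      refine (rowTensorCan_bijective hγ _ hcan).1 (BalTensor.assoc.injective ?_)
      rw [rowTensorCan_coactDiff, hw, M.coassoc', sub_self, map_zero, map_zero]
    obtain ⟨z, rfl⟩ := (hf.exact _ _ (exact_coinvι_coactDiff M) w).1 h0
    refine ⟨z, M.coact_injective ?_⟩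
    exact (rowTensorCan_coinvι hγ M z).symm.trans hw

/-- Bijectivity of the counit comes from descent. By a triangle identity the unit becomes invertible
after - ⊗_R Σ; this functor is faithful, so the unit is both mono and epi, and hence bijective. -/
theorem tensorF_isEquivalence_of_flat (hcan : (can C hγ).IsIso)
    (hf : IsFaithfullyFlat (matRing C γ) (FreeSum I A)) : (tensorF hγ).IsEquivalence := by
  have hM := counitMap_bijective_of_flat hγ hcan hf
  have : (tensorF hγ).Faithful := ⟨fun {X Y f g} h => hf.faithful f g
    (DFunLike.ext _ _ fun z => congrArg (fun t => Comod.lin t z) h)⟩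
  refine tensorF_isEquivalence hγ (fun X => ?_) hM
  have h1 : (tensorF hγ).map (unitMap hγ X) ≫ counitMap hγ ((tensorF hγ).obj X) = 𝟙 _ :=
    (tensorAdj hγ).left_triangle_components X
  have := Comod.isIso_of_bijective _ (hM ((tensorF hγ).obj X))
  have : IsIso ((tensorF hγ).map (unitMap hγ X) ≫ counitMap hγ ((tensorF hγ).obj X)) := by
    rw [h1]
    infer_instance
  have := IsIso.of_isIso_comp_right ((tensorF hγ).map (unitMap hγ X))
    (counitMap hγ ((tensorF hγ).obj X))
  have := (tensorF hγ).mono_of_mono_map (f := unitMap hγ X) inferInstance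
  have := (tensorF hγ).epi_of_epi_map (f := unitMap hγ X) inferInstance
  exact ⟨UnitalMod.injective_of_mono _, UnitalMod.surjective_of_epi _⟩

end Can

/-! ### Change of the coring -/

section Push

open BalTensor

variable {A : Type u} [Ring A] {C D : Coring A}

/-- The map `M ⊗_A φ` for a homomorphism of corings `φ`, as a right linear map. -/
def Coring.Hom.tensor (φ : Coring.Hom D C) (M : Type u) [AddCommGroup M] [Module Aᵐᵒᵖ M] :
    BalTensor A M D →ₗ[Aᵐᵒᵖ] BalTensor A M C :=
  { lTensor M φ.toFun φ.map_smul with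
    map_smul' := fun a z => by
      change lTensor M φ.toFun φ.map_smul (op a.unop • z) =
        op a.unop • lTensor M φ.toFun φ.map_smul z
      induction z using ind with
      | zero => rw [smul_zero, map_zero, smul_zero]
      | add x y hx hy => rw [smul_add, map_add, hx, hy, map_add, smul_add]
      | tmul m d => rw [op_smul_tmul, lTensor_tmul, lTensor_tmul, φ.map_op_smul, op_smul_tmul] }

@[simp] theorem Coring.Hom.tensor_tmul (φ : Coring.Hom D C) {M : Type u} [AddCommGroup M]
    [Module Aᵐᵒᵖ M] (m : M) (d : D) : φ.tensor M (tmul A m d) = tmul A m (φ.toFun d) := rfl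

theorem Coring.Hom.tensor_rTensor (φ : Coring.Hom D C) {M N : Type u} [AddCommGroup M]
    [Module Aᵐᵒᵖ M] [AddCommGroup N] [Module Aᵐᵒᵖ N] (f : M →ₗ[Aᵐᵒᵖ] N) (z : BalTensor A M D) :
    φ.tensor N (rTensor D f z) = rTensor C f (φ.tensor M z) := by
  induction z using ind with
  | zero => simp only [map_zero]
  | add x y hx hy => simp only [map_add, hx, hy]
  | tmul m d => rfl

theorem Coring.Hom.tensor_leftInverse (φ : Coring.Hom D C) (φ' : Coring.Hom C D)
    (h : ∀ d, φ'.toFun (φ.toFun d) = d) {M : Type u} [AddCommGroup M] [Module Aᵐᵒᵖ M]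
    (z : BalTensor A M D) : φ'.tensor M (φ.tensor M z) = z :=
  lTensor_leftInverse _ φ.map_smul _ φ'.map_smul h z

namespace Comod

/-- The comodule over `C` induced by a comodule over `D` along a homomorphism `D → C`. -/
def push (φ : Coring.Hom D C) (M : Comod D) : Comod C where
  carrier := M.carrier
  coact := (φ.tensor M.carrier).comp M.coact
  coassoc m := by
    -- Compatibility of φ with comultiplication, tensored with M, reduces coassociativity over C to
    -- that over D.
    have h1 (z : BalTensor A M.carrier D) :
        lTensor M.carrier C.comul C.comul_smul (φ.tensor M.carrier z) =
          lTensor M.carrier (BalTensor.map φ.toFun φ.toFun φ.map_op_smul φ.map_smul)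
            (fun a z => by
              induction z using ind with
              | zero => simp only [smul_zero, map_zero]
              | add x y hx hy => simp only [smul_add, map_add, hx, hy]
              | tmul d d' => rw [smul_tmul, map_tmul, map_tmul, φ.map_smul, smul_tmul])
            (lTensor M.carrier D.comul D.comul_smul z) := by
      induction z using ind with
      | zero => simp only [map_zero]
      | add x y hx hy => simp only [map_add, hx, hy]
      | tmul m d =>
        rw [φ.tensor_tmul, lTensor_tmul, lTensor_tmul, lTensor_tmul, φ.map_comul]
    change lTensor M.carrier C.comul C.comul_smul (φ.tensor M.carrier (M.coact m)) =
      assoc (rTensor C ((φ.tensor M.carrier).comp M.coact) (φ.tensor M.carrier (M.coact m)))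
    rw [h1, coassoc', ← φ.tensor_rTensor, rTensor_comp]
    generalize rTensor D M.coact (M.coact m) = z
    induction z using ind with
    | zero => simp only [map_zero]
    | add x y hx hy => simp only [map_add, hx, hy]
    | tmul w d =>
      induction w using ind with
      | zero => simp only [map_zero, zero_tmul]
      | add x y hx hy => simp only [map_add, add_tmul, hx, hy]
      | tmul m d' => rfl
  coact_counit m := by
    change rid (lTensor M.carrier C.counit C.counit_smul (φ.tensor M.carrier (M.coact m))) = m
    rw [← M.coact_counit' m]
    congr 1
    rw [coact_counit']
    generalize M.coact m = z
    induction z using ind with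
    | zero => simp only [map_zero]
    | add x y hx hy => simp only [map_add, hx, hy]
    | tmul m d => rw [φ.tensor_tmul, lTensor_tmul, lTensor_tmul, φ.map_counit]

/-- The morphism of comodules over `C` given by a morphism of comodules over `D`. -/
def pushMap (φ : Coring.Hom D C) {M N : Comod D} (f : M ⟶ N) : push φ M ⟶ push φ N :=
  let t : M.carrier →ₗ[Aᵐᵒᵖ] N.carrier := lin f
  ofLin (M := push φ M) (N := push φ N) t fun m => by
    change rTensor C t (φ.tensor M.carrier (M.coact m)) = φ.tensor N.carrier (N.coact (t m))
    exact (φ.tensor_rTensor t _).symm.trans (congrArg _ (rTensor_coact f m))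

/-- The functor induced on comodules by a homomorphism of corings. -/
def pushFunctor (φ : Coring.Hom D C) : Comod D ⥤ Comod C where
  obj := push φ
  map := pushMap φ
  map_id _ := rfl
  map_comp _ _ := rfl

/-- The underlying linear map does not change; cancelling N ⊗ φ by its left inverse N ⊗ φ' turns
colinearity over C into colinearity over D. -/
theorem exists_pushMap_eq (φ : Coring.Hom D C) (φ' : Coring.Hom C D)
    (h : ∀ d, φ'.toFun (φ.toFun d) = d) {M N : Comod D} (f : push φ M ⟶ push φ N) :
    ∃ f', pushMap φ f' = f := by
  let t : M.carrier →ₗ[Aᵐᵒᵖ] N.carrier := lin (M := push φ M) (N := push φ N) f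
  have ht (m : M.carrier) : rTensor C t (φ.tensor M.carrier (M.coact m)) =
    φ.tensor N.carrier (N.coact (t m)) :=
    rTensor_coact (M := push φ M) (N := push φ N) f m
  refine ⟨ofLin t fun m => ?_, rfl⟩
  rw [← φ.tensor_leftInverse φ' h (rTensor D t _), φ.tensor_rTensor, ht,
    φ.tensor_leftInverse φ' h]

theorem exists_push_iso (φ : Coring.Hom D C) (φ' : Coring.Hom C D)
    (h : ∀ c, φ.toFun (φ'.toFun c) = c) (N : Comod C) : Nonempty (push φ (push φ' N) ≅ N) := by
  let t : push φ (push φ' N) ⟶ N := ofLin (M := push φ (push φ' N)) LinearMap.id fun m =>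
    (rTensor_id _).trans (φ'.tensor_leftInverse φ h (N.coact m))
  have := isIso_of_bijective t Function.bijective_id
  exact ⟨asIso t⟩

theorem pushFunctor_isEquivalence (φ : Coring.Hom D C) (hφ : φ.IsIso) :
    (pushFunctor φ).IsEquivalence := by
  obtain ⟨φ', h1, h2⟩ := hφ
  refine { faithful := ⟨fun {M N f g} h => hom_ext fun m => ?_⟩,
           full := ⟨exists_pushMap_eq φ φ' h1⟩,
           essSurj := ⟨fun N => ⟨push φ' N, exists_push_iso φ φ' h2 N⟩⟩ }
  have h' := congrArg (fun t : push φ M ⟶ push φ N => lin t m) h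
  exact h'

end Comod

variable {I : Type u} {γ : I → C} {δ : I → D} (hγ : ∀ i, C.IsGrouplike (γ i))
  (hδ : ∀ i, D.IsGrouplike (δ i)) {R : NonUnitalSubring (FinMat I A)} (hR : R ≤ matRing C γ)
  (hR' : R ≤ matRing D δ)

theorem push_tensorCoact (φ : Coring.Hom D C) (hφ : ∀ i, φ.toFun (δ i) = γ i) (X : UnitalMod R)
    (z : BalTensor R X.carrier (FreeSum I A)) :
    φ.tensor _ (tensorCoact hR' X z) = tensorCoact hR X z := by
  induction z using tensor_ind with
  | zero => simp only [map_zero]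
  | add x y hx hy => simp only [map_add, hx, hy]
  | tmul x i a =>
    rw [tensorCoact_tmul, tensorCoact_tmul, φ.tensor_tmul, φ.map_op_smul, hφ]

/-- The comodules `X ⊗_R Σ` are compatible with homomorphisms of corings. -/
def pushTensorSigma (φ : Coring.Hom D C) (hφ : ∀ i, φ.toFun (δ i) = γ i) (X : UnitalMod R) :
    Comod.push φ (tensorSigmaObj hδ hR' X) ≅ tensorSigmaObj hγ hR X :=
  let t : Comod.push φ (tensorSigmaObj hδ hR' X) ⟶ tensorSigmaObj hγ hR X :=
    Comod.ofLin (M := Comod.push φ (tensorSigmaObj hδ hR' X)) (N := tensorSigmaObj hγ hR X)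
      (LinearMap.id (M := BalTensor R X.carrier (FreeSum I A))) fun z =>
        (rTensor_id _).trans (push_tensorCoact hR hR' φ hφ X z)
  have : IsIso t := Comod.isIso_of_bijective _ Function.bijective_id
  asIso t

/-- The functors `- ⊗_R Σ` are compatible with homomorphisms of corings. -/
def tensorSigmaPush (φ : Coring.Hom D C) (hφ : ∀ i, φ.toFun (δ i) = γ i) :
    tensorSigma hδ hR' ⋙ Comod.pushFunctor φ ≅ tensorSigma hγ hR :=
  NatIso.ofComponents (fun X => pushTensorSigma hγ hδ hR hR' φ hφ X) fun _ => rfl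

/-- The two functors differ by the equivalence of comodule categories induced by φ. It is applied to
`can`, to pass between ℜ(G) and the given coring. -/
theorem tensorSigma_isEquivalence_iff (φ : Coring.Hom D C) (hφ : φ.IsIso)
    (h : ∀ i, φ.toFun (δ i) = γ i) :
    (tensorSigma hδ hR').IsEquivalence ↔ (tensorSigma hγ hR).IsEquivalence := by
  have := Comod.pushFunctor_isEquivalence φ hφ
  rw [← Functor.isEquivalence_iff_of_iso (tensorSigmaPush hγ hδ hR hR' φ h)]
  exact ⟨fun _ => inferInstance,
    fun _ => Functor.isEquivalence_of_comp_right _ (Comod.pushFunctor φ)⟩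

end Push

end GaloisCoring

end

/-! ### The equivalence of the four conditions -/

theorem mainTheorem4 {A : Type u} [Ring A] (C : GaloisCoring.Coring A) (G : Set C)
    (hG : ∀ g : G, C.IsGrouplike (g : C)) :
    List.TFAE [
      -- `C` is flat, `can` is an isomorphism, `S` is faithfully flat as a left `R`-module
      C.IsLeftFlat ∧ (GaloisCoring.can C hG).IsIso ∧
        GaloisCoring.IsFaithfullyFlat (GaloisCoring.matRing C (fun g : G => (g : C)))
          (GaloisCoring.FinMat G A),
      -- `C` is flat, `can` is an isomorphism, `- ⊗_R Σ : Mod-R → Comod-ℜ(G)` is an equivalence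
      C.IsLeftFlat ∧ (GaloisCoring.can C hG).IsIso ∧
        (GaloisCoring.tensorSigma
          (GaloisCoring.comatrixGrouplike_isGrouplike C (fun g : G => (g : C)))
          (GaloisCoring.matRing_le_comatrix C (fun g : G => (g : C)))).IsEquivalence,
      -- `C` is flat, `Σ` is a projective generator of `Comod-C`
      C.IsLeftFlat ∧ CategoryTheory.Projective (GaloisCoring.sigma C hG) ∧
        CategoryTheory.IsSeparator (GaloisCoring.sigma C hG),
      -- `C` is flat, `- ⊗_R Σ : Mod-R → Comod-C` is an equivalence
      C.IsLeftFlat ∧ (GaloisCoring.tensorSigma hG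
        (le_refl (GaloisCoring.matRing C (fun g : G => (g : C))))).IsEquivalence] := by
  -- As `can` matches the grouplikes 1 ⊗ 1 with the given g, it transports one functor - ⊗_R Σ to
  -- the other.
  have hcan (i : G) : (GaloisCoring.can C hG).toFun
      (GaloisCoring.comatrixGrouplike C (fun g : G => (g : C)) i) = i := by
    refine (GaloisCoring.canHom_mk C _ i 1 1).trans ?_
    rw [MulOpposite.op_one, one_smul, one_smul]
  tfae_have 1 → 2 := fun ⟨hC, hi, hf⟩ => ⟨hC, hi,
    (GaloisCoring.tensorSigma_isEquivalence_iff hG _ le_rfl _ _ hi hcan).2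
      (GaloisCoring.tensorF_isEquivalence_of_flat hG hi
        (GaloisCoring.isFaithfullyFlat_finMat_iff.1 hf))⟩
  tfae_have 2 → 4 := fun ⟨hC, hi, he⟩ => ⟨hC,
    (GaloisCoring.tensorSigma_isEquivalence_iff hG _ le_rfl _ _ hi hcan).1 he⟩
  tfae_have 4 → 1 := fun ⟨hC, _⟩ => ⟨hC, GaloisCoring.can_isIso_of_isEquivalence hG,
    GaloisCoring.isFaithfullyFlat_finMat_iff.2
      (GaloisCoring.isFaithfullyFlat_of_isEquivalence hG hC)⟩
  tfae_have 4 → 3 := fun ⟨hC, _⟩ => ⟨hC, GaloisCoring.projective_sigma hG,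
    GaloisCoring.isSeparator_sigma hG⟩
  tfae_have 3 → 4 := fun ⟨hC, hp, hs⟩ => ⟨hC,
    GaloisCoring.tensorF_isEquivalence_of_generator hG hC hp hs⟩
  tfae_finish
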